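/- Fix $n\ge 1$ and work over $\mathbf{C}$. Let $\mathscr{U}$ (resp. $\mathscr{D}$) be the category of finite sets $S$ with a weight function $S\to[n]=\{1,\dots,n\}$, whose morphisms are the bijections that do not decrease (resp. do not increase) weights. Thus $\mathscr{D}\cong\mathscr{U}^{\mathrm{op}}$ by inverting bijections. Let $\mathrm{Mod}_{\mathscr{D}}$ be the category of functors $N$ from $\mathscr{D}$ to finite-dimensional complex vector spaces that are supported on finitely many objects up to isomorphism. It is a symmetric monoidal category under Day convolution, $(M\otimes N)(X)=\bigoplus_{X=A\sqcup B}M(A)\otimes N(B)$, with unit $X\mapsto\mathbf{C}[\mathrm{Hom}_{\mathscr{D}}(\varnothing,X)]$. For $a\in\mathscr{D}$ let $\mathbf{J}_a\in\mathrm{Mod}_{\mathscr{D}}$ be the module $X\mapsto\mathbf{C}[\mathrm{Hom}_{\mathscr{D}}(X,a)]^*$; it is covariant for $a\in\mathscr{U}$. Let $e_i$ be the one-point set of weight $i$; the morphisms $e_1\to e_2\to\cdots\to e_n$ of $\mathscr{U}$ induce maps $\mathbf{J}_{e_1}\to\mathbf{J}_{e_2}\to\cdots\to\mathbf{J}_{e_n}$.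 Let $\mathscr{C}$ be an abelian tensor category, that is, a $\mathbf{C}$-linear abelian category with a symmetric monoidal structure whose tensor product is bilinear and left exact in each variable. Let $T(\mathscr{C})$ be the category of chains $\{A_i\}=(A_1\to A_2\to\cdots\to A_n)$ of morphisms in $\mathscr{C}$, with commutative ladders as morphisms. For $\{A_i\}\in T(\mathscr{C})$ let $\mathcal{K}(\{A_i\}):\mathscr{U}\to\mathscr{C}$ be the functor sending a weighted set with $a_i$ elements of weight $i$ to $\bigotimes_{i}A_i^{\otimes a_i}$, a morphism acting by permuting the tensor factors and applying the maps of the chain. For a functor $\mathcal{K}:\mathscr{U}\to\mathscr{C}$ and $N\in\mathrm{Mod}_{\mathscr{D}}$, let $N^\vee(S)=N(S)^*$, and let the structured tensor product $N\odot\mathcal{K}$ be the object of $\mathscr{C}$ such that morphisms $X\to N\odot\mathcal{K}$ correspond, naturally in $X$, to families of linear maps $N(S)^*\to\mathrm{Hom}_{\mathscr{C}}(X,\mathcal{K}(S))$, $S\in\mathscr{U}$, compatible with the morphisms of $\mathscr{U}$. Let $\mathrm{LEx}(\mathrm{Mod}_{\mathscr{D}},\mathscr{C})$ be the category of left-exact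 tensor functors ($\mathbf{C}$-linear strong symmetric monoidal functors preserving finite limits) $\mathrm{Mod}_{\mathscr{D}}\to\mathscr{C}$ and monoidal natural transformations. **Proposition.** The functor $$\Phi:\mathrm{LEx}(\mathrm{Mod}_{\mathscr{D}},\mathscr{C})\to T(\mathscr{C}),\qquad F\mapsto\bigl(F(\mathbf{J}_{e_1})\to F(\mathbf{J}_{e_2})\to\cdots\to F(\mathbf{J}_{e_n})\bigr)$$ is an equivalence of categories. It has a quasi-inverse $\Psi:T(\mathscr{C})\to\mathrm{LEx}(\mathrm{Mod}_{\mathscr{D}},\mathscr{C})$ such that $\Psi(\{A_i\})$ has as underlying functor $N\mapsto N\odot\mathcal{K}(\{A_i\})$, naturally in $\{A_i\}$; in particular, these structured tensor products exist. -/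

import Mathlib

open CategoryTheory MonoidalCategory Limits

attribute [-instance] CategoryTheory.catToReflQuiver

set_option linter.unusedSectionVars false

universe v u

namespace WeightedSets

/-- A finite set with weights in `[n]`; the weights are indexed by `Fin n`. -/
structure WSet (n : ℕ) where
  carrier : Type
  [finite : Finite carrier]
  weight : carrier → Fin n

attribute [instance] WSet.finite

/-- Weighted finite sets, as objects of the category of upwards bijections. -/
structure U (n : ℕ) extends WSet n

/-- Weighted finite sets, as objects of the category of downwards bijections. -/
structure D (n : ℕ) extends WSet n

/-- An upwards bijection: weights do not decrease. -/
@[ext]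
structure UHom {n : ℕ} (S T : U n) where
  equiv : S.carrier ≃ T.carrier
  weight_le : ∀ s, S.weight s ≤ T.weight (equiv s)

/-- A downwards bijection: weights do not increase. -/
@[ext]
structure DHom {n : ℕ} (S T : D n) where
  equiv : S.carrier ≃ T.carrier
  weight_le : ∀ s, T.weight (equiv s) ≤ S.weight s

instance (n : ℕ) : Category (U n) where
  Hom S T := UHom S T
  id S := ⟨Equiv.refl _, fun _ => le_refl _⟩
  comp f g := ⟨f.equiv.trans g.equiv, fun s => (f.weight_le s).trans (g.weight_le _)⟩

instance (n : ℕ) : Category (D n) where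
  Hom S T := DHom S T
  id S := ⟨Equiv.refl _, fun _ => le_refl _⟩
  comp f g := ⟨f.equiv.trans g.equiv, fun s => (g.weight_le _).trans (f.weight_le s)⟩

variable {n : ℕ}

theorem U.hom_ext {S T : U n} {f g : S ⟶ T} (h : ∀ s, f.equiv s = g.equiv s) : f = g :=
  UHom.ext (Equiv.ext h)

theorem D.hom_ext {S T : D n} {f g : S ⟶ T} (h : ∀ s, f.equiv s = g.equiv s) : f = g :=
  DHom.ext (Equiv.ext h)

@[simp] theorem U.id_equiv (S : U n) : UHom.equiv (𝟙 S) = Equiv.refl _ := rfl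
@[simp] theorem U.comp_equiv {S T W : U n} (f : S ⟶ T) (g : T ⟶ W) :
    UHom.equiv (f ≫ g) = (UHom.equiv f).trans (UHom.equiv g) := rfl
@[simp] theorem D.id_equiv (S : D n) : DHom.equiv (𝟙 S) = Equiv.refl _ := rfl
@[simp] theorem D.comp_equiv {S T W : D n} (f : S ⟶ T) (g : T ⟶ W) :
    DHom.equiv (f ≫ g) = (DHom.equiv f).trans (DHom.equiv g) := rfl

/-- A weight preserving bijection is an isomorphism. -/
def D.mkIso {S T : D n} (e : S.carrier ≃ T.carrier) (h : ∀ s, T.weight (e s) = S.weight s) :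
    S ≅ T where
  hom := ⟨e, fun s => (h s).le⟩
  inv := ⟨e.symm, fun t => by rw [← h, e.apply_symm_apply]⟩
  hom_inv_id := D.hom_ext fun s => e.symm_apply_apply s
  inv_hom_id := D.hom_ext fun s => e.apply_symm_apply s

/-- Disjoint union of weighted sets. -/
def D.union (S T : D n) : D n where
  carrier := S.carrier ⊕ T.carrier
  weight := Sum.elim S.weight T.weight

/-- The empty weighted set. -/
def D.empty (n : ℕ) : D n where
  carrier := Empty
  weight := Empty.elim

/-- Disjoint union of morphisms. -/
def D.unionMap {S S' T T' : D n} (f : S ⟶ S') (g : T ⟶ T') : S.union T ⟶ S'.union T' :=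
  ⟨Equiv.sumCongr f.equiv g.equiv, by rintro (s | t); exacts [f.weight_le s, g.weight_le t]⟩

instance (n : ℕ) : MonoidalCategory (D n) where
  tensorObj := D.union
  tensorHom := D.unionMap
  whiskerLeft S _ _ g := D.unionMap (𝟙 S) g
  whiskerRight f T := D.unionMap f (𝟙 T)
  tensorUnit := D.empty n
  associator S T W := D.mkIso (Equiv.sumAssoc _ _ _) (by rintro ((_ | _) | _) <;> rfl)
  leftUnitor S := D.mkIso (Equiv.emptySum Empty _) (by rintro (a | _); exacts [a.elim, rfl])
  rightUnitor S := D.mkIso (Equiv.sumEmpty _ Empty) (by rintro (_ | a); exacts [rfl, a.elim])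
  tensorHom_def _ _ := D.hom_ext (by rintro (_ | _) <;> rfl)
  id_tensorHom_id _ _ := D.hom_ext (by rintro (_ | _) <;> rfl)
  tensorHom_comp_tensorHom _ _ _ _ := D.hom_ext (by rintro (_ | _) <;> rfl)
  whiskerLeft_id _ _ := D.hom_ext (by rintro (_ | _) <;> rfl)
  id_whiskerRight _ _ := D.hom_ext (by rintro (_ | _) <;> rfl)
  associator_naturality _ _ _ := D.hom_ext (by rintro ((_ | _) | _) <;> rfl)
  leftUnitor_naturality _ := D.hom_ext (by rintro (a | _); exacts [a.elim, rfl])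
  rightUnitor_naturality _ := D.hom_ext (by rintro (_ | a); exacts [rfl, a.elim])
  pentagon _ _ _ _ := D.hom_ext (by rintro (((_ | _) | _) | _) <;> rfl)
  triangle _ _ := D.hom_ext (by rintro ((_ | a) | _); exacts [rfl, a.elim, rfl])

instance (n : ℕ) : SymmetricCategory (D n) where
  braiding S T := D.mkIso (Equiv.sumComm _ _) (by rintro (_ | _) <;> rfl)
  braiding_naturality_right _ _ _ _ := D.hom_ext (by rintro (_ | _) <;> rfl)
  braiding_naturality_left _ _ := D.hom_ext (by rintro (_ | _) <;> rfl)
  hexagon_forward _ _ _ := D.hom_ext (by rintro ((_ | _) | _) <;> rfl)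
  hexagon_reverse _ _ _ := D.hom_ext (by rintro (_ | (_ | _)) <;> rfl)
  symmetry _ _ := D.hom_ext (by rintro (_ | _) <;> rfl)

/-- The subset `A` of `X`, with the induced weights. -/
def D.sub (X : D n) (A : Set X.carrier) : D n where
  carrier := A
  weight a := X.weight a

/-- The restriction of a morphism `X ⟶ Y` to a subset of `X` and its image in `Y`. -/
def D.subMap {X Y : D n} (f : X ⟶ Y) (A : Set X.carrier) :
    X.sub A ⟶ Y.sub (f.equiv.symm ⁻¹' A) :=
  ⟨f.equiv.subtypeEquiv fun a => by simp, fun a => f.weight_le a.1⟩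

/-- The restriction of a morphism `X ⟶ Y` to the complement of a subset of `X`. -/
def D.subMapCompl {X Y : D n} (f : X ⟶ Y) (A : Set X.carrier) :
    X.sub Aᶜ ⟶ Y.sub (f.equiv.symm ⁻¹' A)ᶜ :=
  ⟨f.equiv.subtypeEquiv fun a => by simp, fun a => f.weight_le a.1⟩

@[simp] theorem D.subMap_apply {X Y : D n} (f : X ⟶ Y) (A : Set X.carrier) (a) :
    ((D.subMap f A).equiv a).1 = f.equiv a.1 := rfl

@[simp] theorem D.subMapCompl_apply {X Y : D n} (f : X ⟶ Y) (A : Set X.carrier) (a) :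
    ((D.subMapCompl f A).equiv a).1 = f.equiv a.1 := rfl

open scoped Classical in
/-- The isomorphism `A ⊔ Aᶜ ≅ X`. -/
noncomputable def D.glue (X : D n) (A : Set X.carrier) : X.sub A ⊗ X.sub Aᶜ ≅ X :=
  D.mkIso (Equiv.Set.sumCompl A) (by rintro (_ | _) <;> rfl)

@[simp] theorem D.glue_inl (X : D n) (A : Set X.carrier) (a : A) :
    (D.glue X A).hom.equiv (Sum.inl a) = a.1 := rfl

@[simp] theorem D.glue_inr (X : D n) (A : Set X.carrier) (a : (Aᶜ : Set X.carrier)) :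
    (D.glue X A).hom.equiv (Sum.inr a) = a.1 := rfl

/-- Complex vector spaces. -/
abbrev Vect : Type 1 := ModuleCat.{0} ℂ

/-- The value at `X` of the tensor product of `M` and `N`: the direct sum of
`M(A) ⊗ N(X ∖ A)` over all decompositions `X = A ⊔ (X ∖ A)`. -/
noncomputable def convObj (M N : D n ⥤ Vect) (X : D n) : Vect :=
  ∐ fun A : Set X.carrier => M.obj (X.sub A) ⊗ N.obj (X.sub Aᶜ)

/-- The inclusion of the summand indexed by a decomposition of `X`. -/
noncomputable def convInc (M N : D n ⥤ Vect) (X : D n) (A : Set X.carrier) :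
    M.obj (X.sub A) ⊗ N.obj (X.sub Aᶜ) ⟶ convObj M N X :=
  Sigma.ι (fun A : Set X.carrier => M.obj (X.sub A) ⊗ N.obj (X.sub Aᶜ)) A

/-- The map out of the direct sum given by maps out of the summands. -/
noncomputable def convIncDesc (M N : D n ⥤ Vect) (X : D n) {V : Vect}
    (f : ∀ A : Set X.carrier, M.obj (X.sub A) ⊗ N.obj (X.sub Aᶜ) ⟶ V) : convObj M N X ⟶ V :=
  Sigma.desc f

@[simp] theorem convInc_desc (M N : D n ⥤ Vect) (X : D n) {V : Vect}
    (f : ∀ A : Set X.carrier, M.obj (X.sub A) ⊗ N.obj (X.sub Aᶜ) ⟶ V) (A : Set X.carrier) :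
    convInc M N X A ≫ convIncDesc M N X f = f A :=
  Sigma.ι_desc _ _

theorem convInc_hom_ext (M N : D n ⥤ Vect) (X : D n) {V : Vect} {f g : convObj M N X ⟶ V}
    (h : ∀ A, convInc M N X A ≫ f = convInc M N X A ≫ g) : f = g :=
  Sigma.hom_ext _ _ h

theorem convInc_congr (M N : D n ⥤ Vect) (X S T : D n) {A B : Set X.carrier} (h : A = B)
    (f : S ⟶ X.sub A) (f' : S ⟶ X.sub B) (hf : ∀ s, (f.equiv s).1 = (f'.equiv s).1)
    (g : T ⟶ X.sub Aᶜ) (g' : T ⟶ X.sub Bᶜ) (hg : ∀ t, (g.equiv t).1 = (g'.equiv t).1) :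
    (M.map f ⊗ₘ N.map g) ≫ convInc M N X A = (M.map f' ⊗ₘ N.map g') ≫ convInc M N X B := by
  subst h
  obtain rfl : f = f' := D.hom_ext fun a => Subtype.ext (hf a)
  obtain rfl : g = g' := D.hom_ext fun a => Subtype.ext (hg a)
  rfl

/-- The tensor product of functors `M` and `N` on weighted sets, given by
`(M ⊗ N)(X) = ⨁ M(A) ⊗ N(X ∖ A)`. -/
noncomputable def conv (M N : D n ⥤ Vect) : D n ⥤ Vect where
  obj X := convObj M N X
  map {X Y} f := convIncDesc M N X fun A =>
    (M.map (D.subMap f A) ⊗ₘ N.map (D.subMapCompl f A)) ≫ convInc M N Y (f.equiv.symm ⁻¹' A)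
  map_id X := by
    refine convInc_hom_ext _ _ _ fun A => ?_
    rw [convInc_desc, Category.comp_id]
    refine (convInc_congr M N X _ _ (B := A) rfl _ (𝟙 _) ?_ _ (𝟙 _) ?_).trans ?_
    · intro s; rfl
    · intro s; rfl
    · rw [M.map_id, N.map_id, id_tensorHom_id, Category.id_comp]
  map_comp {X Y Z} f g := by
    refine convInc_hom_ext _ _ _ fun A => ?_
    rw [convInc_desc, ← Category.assoc, convInc_desc, Category.assoc, convInc_desc,
      tensorHom_comp_tensorHom_assoc, ← M.map_comp, ← N.map_comp]
    refine convInc_congr M N Z _ _ rfl _ _ ?_ _ _ ?_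
    · intro s; rfl
    · intro s; rfl

/-- The inclusion of the summand indexed by a decomposition of `X`. -/
noncomputable def convι (M N : D n ⥤ Vect) (X : D n) (A : Set X.carrier) :
    M.obj (X.sub A) ⊗ N.obj (X.sub Aᶜ) ⟶ (conv M N).obj X :=
  convInc M N X A

/-- The map out of the direct sum given by maps out of the summands. -/
noncomputable def convDesc (M N : D n ⥤ Vect) (X : D n) {V : Vect}
    (f : ∀ A : Set X.carrier, M.obj (X.sub A) ⊗ N.obj (X.sub Aᶜ) ⟶ V) : (conv M N).obj X ⟶ V :=
  convIncDesc M N X f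

@[simp] theorem convι_desc (M N : D n ⥤ Vect) (X : D n) {V : Vect}
    (f : ∀ A : Set X.carrier, M.obj (X.sub A) ⊗ N.obj (X.sub Aᶜ) ⟶ V) (A : Set X.carrier) :
    convι M N X A ≫ convDesc M N X f = f A :=
  convInc_desc _ _ _ _ _

theorem conv_hom_ext (M N : D n ⥤ Vect) (X : D n) {V : Vect} {f g : (conv M N).obj X ⟶ V}
    (h : ∀ A, convι M N X A ≫ f = convι M N X A ≫ g) : f = g :=
  convInc_hom_ext _ _ _ h

theorem convι_congr (M N : D n ⥤ Vect) (X S T : D n) {A B : Set X.carrier} (h : A = B)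
    (f : S ⟶ X.sub A) (f' : S ⟶ X.sub B) (hf : ∀ s, (f.equiv s).1 = (f'.equiv s).1)
    (g : T ⟶ X.sub Aᶜ) (g' : T ⟶ X.sub Bᶜ) (hg : ∀ t, (g.equiv t).1 = (g'.equiv t).1) :
    (M.map f ⊗ₘ N.map g) ≫ convι M N X A = (M.map f' ⊗ₘ N.map g') ≫ convι M N X B :=
  convInc_congr M N X S T h f f' hf g g' hg

theorem convι_map (M N : D n ⥤ Vect) {X Y : D n} (f : X ⟶ Y) (A : Set X.carrier) :
    convι M N X A ≫ (conv M N).map f =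
      (M.map (D.subMap f A) ⊗ₘ N.map (D.subMapCompl f A)) ≫
        convι M N Y (f.equiv.symm ⁻¹' A) :=
  convInc_desc _ _ _ _ _

/-- The subset `S` of `S ⊔ T`. -/
def D.left (S T : D n) : Set (S ⊗ T : D n).carrier := {x | x.isLeft = true}

/-- The canonical identification of `S` with a subset of `S ⊔ T`. -/
def D.inlIso (S T : D n) : S ≅ (S ⊗ T).sub (D.left S T) :=
  D.mkIso
    { toFun := fun s => ⟨Sum.inl s, rfl⟩
      invFun := fun x => x.1.getLeft x.2
      left_inv := fun _ => rfl
      right_inv := by rintro ⟨_ | _, h⟩; exacts [rfl, nomatch h] } (fun _ => rfl)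

/-- The canonical identification of `T` with the complement of `S` in `S ⊔ T`. -/
def D.inrIso (S T : D n) : T ≅ (S ⊗ T).sub (D.left S T)ᶜ :=
  D.mkIso
    { toFun := fun s => ⟨Sum.inr s, fun h => nomatch h⟩
      invFun := fun x => x.1.getRight (by
        obtain ⟨_ | _, h⟩ := x
        exacts [(h rfl).elim, rfl])
      left_inv := fun _ => rfl
      right_inv := by rintro ⟨_ | _, h⟩; exacts [(h rfl).elim, rfl] } (fun _ => rfl)

open MonoidalCategory.ExternalProduct
open scoped CategoryTheory.Prod

/-- The canonical map `M(S) ⊗ N(T) ⟶ (M ⊗ N)(S ⊔ T)`. -/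
noncomputable def convUnitApp (M N : D n ⥤ Vect) (S T : D n) :
    M.obj S ⊗ N.obj T ⟶ (conv M N).obj (S ⊗ T) :=
  (M.map (D.inlIso S T).hom ⊗ₘ N.map (D.inrIso S T).hom) ≫ convι M N (S ⊗ T) (D.left S T)

theorem convUnitApp_map (M N : D n ⥤ Vect) (S T X : D n) (f : S ⊗ T ⟶ X)
    (A : Set X.carrier) (h : f.equiv.symm ⁻¹' (D.left S T) = A)
    (g : S ⟶ X.sub A) (hg : ∀ s, (g.equiv s).1 = f.equiv (Sum.inl s))
    (g' : T ⟶ X.sub Aᶜ) (hg' : ∀ s, (g'.equiv s).1 = f.equiv (Sum.inr s)) :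
    convUnitApp M N S T ≫ (conv M N).map f = (M.map g ⊗ₘ N.map g') ≫ convι M N X A := by
  rw [convUnitApp, Category.assoc, convι_map, tensorHom_comp_tensorHom_assoc, ← M.map_comp,
    ← N.map_comp]
  refine convι_congr M N X _ _ h _ _ ?_ _ _ ?_
  · intro s; rw [hg]; rfl
  · intro s; rw [hg']; rfl

theorem extProd_map (M N : D n ⥤ Vect) {S T S' T' : D n} (f : S ⟶ S') (g : T ⟶ T') :
    (M ⊠ N).map (f ×ₘ g) = M.map f ⊗ₘ N.map g := by
  rw [MonoidalCategory.tensorHom_def]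
  rfl

/-- The natural map `M(S) ⊗ N(T) ⟶ (M ⊗ N)(S ⊔ T)`. -/
noncomputable def convUnit (M N : D n ⥤ Vect) : M ⊠ N ⟶ tensor (D n) ⋙ conv M N where
  app p := convUnitApp M N p.1 p.2
  naturality := by
    rintro ⟨S, T⟩ ⟨S', T'⟩ ⟨f, g⟩
    refine Eq.trans ?_ (convUnitApp_map M N S T (S' ⊗ T') (f ⊗ₘ g) (D.left S' T') ?_
      (f ≫ (D.inlIso S' T').hom) ?_ (g ≫ (D.inrIso S' T').hom) ?_).symm
    · change (M ⊠ N).map (f ×ₘ g) ≫ convUnitApp M N S' T' = _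
      rw [extProd_map, convUnitApp, tensorHom_comp_tensorHom_assoc, M.map_comp, N.map_comp]
    · ext x
      rcases x with _ | _
      · exact Iff.rfl
      · exact Iff.rfl
    · intro s; rfl
    · intro s; rfl

/-- The restriction of `S ⊔ T ⟶ X` to `S`, onto its image. -/
def D.partl {S T X : D n} (f : S ⊗ T ⟶ X) : S ⟶ X.sub (f.equiv.symm ⁻¹' (D.left S T)) :=
  (D.inlIso S T).hom ≫ D.subMap f _

/-- The restriction of `S ⊔ T ⟶ X` to `T`, onto the complement of the image of `S`. -/
def D.partr {S T X : D n} (f : S ⊗ T ⟶ X) : T ⟶ X.sub (f.equiv.symm ⁻¹' (D.left S T))ᶜ :=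
  (D.inrIso S T).hom ≫ D.subMapCompl f _

/-- The leg of a cocone at a decomposition of `X`. -/
noncomputable def convLeg (M N : D n ⥤ Vect) (X : D n)
    (s : Cocone (CostructuredArrow.proj (tensor (D n)) X ⋙ M ⊠ N)) {S T : D n} (f : S ⊗ T ⟶ X) :
    M.obj S ⊗ N.obj T ⟶ s.pt :=
  s.ι.app (CostructuredArrow.mk (Y := ((S, T) : D n × D n)) (S := tensor (D n)) f)

theorem convLeg_comp (M N : D n ⥤ Vect) (X : D n)
    (s : Cocone (CostructuredArrow.proj (tensor (D n)) X ⋙ M ⊠ N)) {S T S' T' : D n}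
    (f : S ⊗ T ⟶ X) (f' : S' ⊗ T' ⟶ X) (g : S ⟶ S') (g' : T ⟶ T') (h : (g ⊗ₘ g') ≫ f' = f) :
    (M.map g ⊗ₘ N.map g') ≫ convLeg M N X s f' = convLeg M N X s f :=
  (congrArg (· ≫ convLeg M N X s f') (extProd_map M N g g')).symm.trans <|
    s.w (CostructuredArrow.homMk (f := CostructuredArrow.mk (Y := ((S, T) : D n × D n))
      (S := tensor (D n)) f)
    (f' := CostructuredArrow.mk (Y := ((S', T') : D n × D n)) (S := tensor (D n)) f')
    (g ×ₘ g') h)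

theorem convDesc_fac (M N : D n ⥤ Vect) (X : D n)
    (s : Cocone (CostructuredArrow.proj (tensor (D n)) X ⋙ M ⊠ N)) {S T : D n} (f : S ⊗ T ⟶ X) :
    (convUnitApp M N S T ≫ (conv M N).map f) ≫
      convDesc M N X (fun A => convLeg M N X s (D.glue X A).hom) = convLeg M N X s f := by
  rw [convUnitApp_map M N S T X f _ rfl (D.partl f) (fun _ => rfl) (D.partr f) (fun _ => rfl),
    Category.assoc, convι_desc]
  exact convLeg_comp M N X s _ _ _ _ (D.hom_ext (by rintro (_ | _) <;> rfl))

theorem convUnitApp_glue (M N : D n ⥤ Vect) (X : D n) (A : Set X.carrier) :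
    convUnitApp M N (X.sub A) (X.sub Aᶜ) ≫ (conv M N).map (D.glue X A).hom = convι M N X A := by
  rw [convUnitApp_map M N _ _ X (D.glue X A).hom A ?_ (𝟙 _) (fun _ => rfl) (𝟙 _) (fun _ => rfl),
    M.map_id, N.map_id, id_tensorHom_id, Category.id_comp]
  ext x
  obtain ⟨y, rfl⟩ := (D.glue X A).hom.equiv.surjective x
  rw [Set.mem_preimage, Equiv.symm_apply_apply]
  rcases y with y | y
  · exact iff_of_true rfl y.2
  · exact iff_of_false (fun h => nomatch h) y.2

/-- The tensor product is the pointwise left Kan extension of `M(S) ⊗ N(T)` along the disjoint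
union, i.e. the Day convolution. -/
noncomputable def convIsColimit (M N : D n ⥤ Vect) (X : D n) :
    IsColimit ((Functor.LeftExtension.mk (conv M N) (convUnit M N)).coconeAt X) where
  desc s := convDesc M N X fun A => convLeg M N X s (D.glue X A).hom
  fac s j := convDesc_fac M N X s j.hom
  uniq s m hm := conv_hom_ext M N X fun A =>
    ((congrArg (· ≫ (show (conv M N).obj X ⟶ s.pt from m)) (convUnitApp_glue M N X A)).symm.trans
      (hm (CostructuredArrow.mk (Y := ((X.sub A, X.sub Aᶜ) : D n × D n))
        (S := tensor (D n)) (D.glue X A).hom))).trans (convι_desc M N X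
          (fun A => convLeg M N X s (D.glue X A).hom) A).symm

/-- The unit object, `X ↦ ℂ[Hom(∅, X)]`. -/
noncomputable def unitObj (X : D n) : Vect := ∐ fun _ : (𝟙_ (D n) ⟶ X) => 𝟙_ Vect

/-- The inclusion of a summand. -/
noncomputable def unitι {X : D n} (f : 𝟙_ (D n) ⟶ X) : 𝟙_ Vect ⟶ unitObj X :=
  Sigma.ι (fun _ : (𝟙_ (D n) ⟶ X) => 𝟙_ Vect) f

/-- The map out of the direct sum given by maps out of the summands. -/
noncomputable def unitDesc (X : D n) {V : Vect} (f : (𝟙_ (D n) ⟶ X) → (𝟙_ Vect ⟶ V)) :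
    unitObj X ⟶ V :=
  Sigma.desc f

@[simp] theorem unitι_desc (X : D n) {V : Vect} (f : (𝟙_ (D n) ⟶ X) → (𝟙_ Vect ⟶ V))
    (g : 𝟙_ (D n) ⟶ X) : unitι g ≫ unitDesc X f = f g :=
  Sigma.ι_desc _ _

theorem unitObj_hom_ext (X : D n) {V : Vect} {f g : unitObj X ⟶ V}
    (h : ∀ a : 𝟙_ (D n) ⟶ X, unitι a ≫ f = unitι a ≫ g) : f = g :=
  Sigma.hom_ext _ _ h

variable (n) in
/-- The unit of the tensor product, `X ↦ ℂ[Hom(∅, X)]`. -/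
noncomputable def unitFunctor : D n ⥤ Vect where
  obj X := unitObj X
  map {X Y} f := unitDesc X fun a => unitι (a ≫ f)
  map_id X := unitObj_hom_ext X fun a => by simp
  map_comp {X Y Z} f g := unitObj_hom_ext X fun a => by
    rw [unitι_desc, ← Category.assoc (unitι a), unitι_desc, unitι_desc, Category.assoc]

/-- The leg of a cocone at a morphism `∅ ⟶ X`. -/
noncomputable def unitLeg (X : D n)
    (s : Cocone (CostructuredArrow.proj (Functor.fromPUnit.{0} (𝟙_ (D n))) X ⋙
      Functor.fromPUnit.{0} (𝟙_ Vect))) (a : 𝟙_ (D n) ⟶ X) : 𝟙_ Vect ⟶ s.pt :=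
  s.ι.app (CostructuredArrow.mk (Y := ⟨⟨⟩⟩) (S := Functor.fromPUnit.{0} (𝟙_ (D n))) a)

theorem unitι_map {X Y : D n} (a : 𝟙_ (D n) ⟶ X) (f : X ⟶ Y) :
    (show 𝟙_ Vect ⟶ (unitFunctor n).obj X from unitι a) ≫ (unitFunctor n).map f =
      unitι (a ≫ f) :=
  unitι_desc _ _ _

theorem unitι_id_map {X : D n} (a : 𝟙_ (D n) ⟶ X) :
    (show 𝟙_ Vect ⟶ (unitFunctor n).obj _ from unitι (𝟙 _)) ≫ (unitFunctor n).map a =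
      unitι a := by
  rw [unitι_map, Category.id_comp]

/-- `X ↦ ℂ[Hom(∅, X)]` is the unit of Day convolution. -/
noncomputable instance unitDayUnit : DayConvolutionUnit (unitFunctor n) where
  can := unitι (𝟙 _)
  isPointwiseLeftKanExtensionCan X := {
    desc := fun s => unitDesc X (unitLeg X s)
    fac := fun s j =>
      (congrArg (· ≫ unitDesc X (unitLeg X s)) (unitι_id_map j.hom)).trans
        (unitι_desc X (unitLeg X s) j.hom)
    uniq := fun s m hm => unitObj_hom_ext X fun a => by
      have h : unitι a ≫ (show unitObj X ⟶ s.pt from m) = unitLeg X s a := by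
        rw [← unitι_id_map a]
        exact hm (CostructuredArrow.mk (Y := ⟨⟨⟩⟩) (S := Functor.fromPUnit.{0} (𝟙_ (D n))) a)
      exact h.trans (unitι_desc X (unitLeg X s) a).symm }

/-- A `D n`-module: a functor to finite dimensional vector spaces which is supported on
finitely many objects up to isomorphism. -/
def IsModule (n : ℕ) : ObjectProperty (D n ⥤ Vect) := fun M =>
  (∀ X, Module.Finite ℂ (M.obj X)) ∧
    ∃ s : Set (D n), s.Finite ∧ ∀ X, ¬ IsZero (M.obj X) → ∃ Y ∈ s, Nonempty (X ≅ Y)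

/-- The category of `D n`-modules. -/
abbrev ModD (n : ℕ) := (IsModule n).FullSubcategory

theorem finite_coprod {ι : Type} [Finite ι] (Z : ι → Vect) [∀ i, Module.Finite ℂ (Z i)] :
    Module.Finite ℂ (∐ Z : Vect) := by
  classical
  exact (Module.Finite.equiv_iff (ModuleCat.coprodIsoDirectSum Z).toLinearEquiv).mpr inferInstance

theorem isZero_coprod {ι : Type} (Z : ι → Vect) (h : ∀ i, IsZero (Z i)) :
    IsZero (∐ Z : Vect) := by
  rw [IsZero.iff_id_eq_zero]
  exact Sigma.hom_ext _ _ fun i => (h i).eq_of_src _ _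

theorem isModule_conv {M N : D n ⥤ Vect} (hM : IsModule n M) (hN : IsModule n N) :
    IsModule n (conv M N) := by
  obtain ⟨fM, s, hs, hsM⟩ := hM
  obtain ⟨fN, t, ht, htN⟩ := hN
  refine ⟨fun X => ?_, Set.image2 (· ⊗ ·) s t, hs.image2 _ ht, fun X hX => ?_⟩
  · have (A : Set X.carrier) : Module.Finite ℂ (M.obj (X.sub A) ⊗ N.obj (X.sub Aᶜ) : Vect) := by
      change Module.Finite ℂ (TensorProduct ℂ (M.obj (X.sub A)) (N.obj (X.sub Aᶜ)))
      infer_instance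
    exact finite_coprod _
  · by_contra! h
    refine hX (isZero_coprod _ fun A => ?_)
    have key : IsZero (M.obj (X.sub A)) ∨ IsZero (N.obj (X.sub Aᶜ)) := by
      by_contra! hc
      obtain ⟨Y, hY, ⟨e⟩⟩ := hsM _ hc.1
      obtain ⟨Z, hZ, ⟨e'⟩⟩ := htN _ hc.2
      exact (h _ ⟨Y, hY, Z, hZ, rfl⟩).elim' ((D.glue X A).symm ≪≫ (e ⊗ᵢ e'))
    rw [IsZero.iff_id_eq_zero]
    rcases key with h | h
    · rw [← id_whiskerRight, h.eq_of_src (𝟙 _) 0, MonoidalPreadditive.zero_whiskerRight]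
    · rw [← whiskerLeft_id, h.eq_of_src (𝟙 _) 0, MonoidalPreadditive.whiskerLeft_zero]

instance (X Y : D n) : Finite (X ⟶ Y) :=
  Finite.of_injective (fun f : X ⟶ Y => f.equiv) fun _ _ h => DHom.ext h

theorem isModule_unit : IsModule n (unitFunctor n) := by
  refine ⟨fun X => ?_, {𝟙_ (D n)}, Set.finite_singleton _, fun X hX => ?_⟩
  · have : Module.Finite ℂ (𝟙_ Vect : Vect) := inferInstanceAs (Module.Finite ℂ ℂ)
    exact finite_coprod _
  · by_contra! h
    refine hX (isZero_coprod _ fun a => ?_)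
    refine (h _ rfl).elim' (D.mkIso a.equiv.symm fun x => (a.equiv.symm x).elim)

/-- Modules are closed under the tensor product `conv` and contain its unit. -/
noncomputable instance dayCore :
    InducedLawfulDayConvolutionMonoidalCategoryStructCore (D n) Vect (ModD n) where
  ι := (IsModule n).ι
  fullyFaithulι := (IsModule n).fullyFaithfulι
  tensorObj M N := ⟨conv M.obj N.obj, isModule_conv M.property N.property⟩
  convolutions' M N :=
    { convolution := conv M.obj N.obj
      unit := convUnit M.obj N.obj
      isPointwiseLeftKanExtensionUnit := convIsColimit M.obj N.obj }
  tensorObjIsoConvolution M N := Iso.refl _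
  convolutionUnitApp M N S T := convUnitApp M.obj N.obj S T
  convolutionUnitApp_eq _ _ _ _ := (Category.comp_id _).symm
  tensorUnit := ⟨unitFunctor n, isModule_unit⟩
  tensorUnitConvolutionUnit := unitDayUnit

/-- The tensor product of modules, with the associativity and unit constraints induced by those of
disjoint union and of the tensor product of vector spaces. -/
noncomputable instance : MonoidalCategory (ModD n) :=
  letI := (dayCore (n := n)).mkMonoidalCategoryStruct
  letI : LawfulDayConvolutionMonoidalCategoryStruct (D n) Vect (ModD n) :=
    (dayCore (n := n)).mkLawfulDayConvolutionMonoidalCategoryStruct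
  monoidalOfLawfulDayConvolutionMonoidalCategoryStruct (D n) Vect (ModD n)

/-- The inclusion of modules into functors exhibits the tensor product of modules as the Day
convolution. -/
noncomputable instance dayLawful : LawfulDayConvolutionMonoidalCategoryStruct (D n) Vect (ModD n) :=
  (dayCore (n := n)).mkLawfulDayConvolutionMonoidalCategoryStruct

section

open LawfulDayConvolutionMonoidalCategoryStruct

attribute [local instance] convolution convolution₂ convolution₂'

/-- The symmetry of the tensor product of modules, induced by the symmetries of disjoint union and
of the tensor product of vector spaces. -/
noncomputable def braid (M N : ModD n) : M ⊗ N ≅ N ⊗ M :=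
  (IsModule n).fullyFaithfulι.preimageIso
    (DayConvolution.braiding ((ι (D n) Vect (ModD n)).obj M) ((ι (D n) Vect (ModD n)).obj N))

theorem ι_map_braid (M N : ModD n) : (ι (D n) Vect (ModD n)).map (braid M N).hom =
    (DayConvolution.braiding ((ι (D n) Vect (ModD n)).obj M) ((ι (D n) Vect (ModD n)).obj N)).hom :=
  rfl

noncomputable instance : SymmetricCategory (ModD n) where
  braiding := braid
  braiding_naturality_right M N N' f := by
    apply (ι (D n) Vect (ModD n)).map_injective
    rw [Functor.map_comp, Functor.map_comp, ← id_tensorHom, ← tensorHom_id, ι_map_braid,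
      ι_map_braid, ι_map_tensorHom_hom_eq_tensorHom, ι_map_tensorHom_hom_eq_tensorHom,
      CategoryTheory.Functor.map_id]
    exact DayConvolution.braiding_naturality_right _ _
  braiding_naturality_left f M := by
    apply (ι (D n) Vect (ModD n)).map_injective
    rw [Functor.map_comp, Functor.map_comp, ← id_tensorHom, ← tensorHom_id, ι_map_braid,
      ι_map_braid, ι_map_tensorHom_hom_eq_tensorHom, ι_map_tensorHom_hom_eq_tensorHom,
      CategoryTheory.Functor.map_id]
    exact DayConvolution.braiding_naturality_left _ _
  hexagon_forward M N P := by
    apply (ι (D n) Vect (ModD n)).map_injective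
    simp only [Functor.map_comp, ← id_tensorHom, ← tensorHom_id, ι_map_braid,
      ι_map_tensorHom_hom_eq_tensorHom, ι_map_associator_hom_eq_associator_hom,
      CategoryTheory.Functor.map_id]
    exact DayConvolution.hexagon_forward _ _ _
  hexagon_reverse M N P := by
    apply (ι (D n) Vect (ModD n)).map_injective
    have h (M N P : ModD n) : (ι (D n) Vect (ModD n)).map (α_ M N P).inv =
      (DayConvolution.associator ((ι (D n) Vect (ModD n)).obj M) ((ι (D n) Vect (ModD n)).obj N)
        ((ι (D n) Vect (ModD n)).obj P)).inv :=
      congrArg (fun e : (ι (D n) Vect (ModD n)).obj ((M ⊗ N) ⊗ P) ≅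
          (ι (D n) Vect (ModD n)).obj (M ⊗ N ⊗ P) => e.inv)
        (Iso.ext (α := (ι (D n) Vect (ModD n)).mapIso (α_ M N P))
          (β := DayConvolution.associator ((ι (D n) Vect (ModD n)).obj M)
            ((ι (D n) Vect (ModD n)).obj N) ((ι (D n) Vect (ModD n)).obj P))
          (ι_map_associator_hom_eq_associator_hom (D n) Vect (ModD n) M N P))
    simp only [Functor.map_comp, ← id_tensorHom, ← tensorHom_id, ι_map_braid,
      ι_map_tensorHom_hom_eq_tensorHom, h, CategoryTheory.Functor.map_id]
    exact DayConvolution.hexagon_reverse _ _ _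
  symmetry M N := by
    apply (ι (D n) Vect (ModD n)).map_injective
    rw [Functor.map_comp, CategoryTheory.Functor.map_id, ι_map_braid, ι_map_braid]
    exact DayConvolution.symmetry _ _

end

/-- `Ins a t l`: a way to obtain the list `l` from the list `t` by inserting `a`. -/
inductive Ins {ι : Type} (a : ι) : List ι → List ι → Type
  | here (t : List ι) : Ins a t (a :: t)
  | there (b : ι) {t l : List ι} (i : Ins a t l) : Ins a (b :: t) (b :: l)

/-- `Arr l l'`: a way to rearrange the list `l` into the list `l'`. -/
inductive Arr {ι : Type} : List ι → List ι → Type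
  | nil : Arr [] []
  | cons {a : ι} {t t' l : List ι} (p : Arr t t') (i : Ins a t' l) : Arr (a :: t) l

section

variable {ι : Type}

theorem Ins.unique {a : ι} : ∀ {l t t' : List ι} (i : Ins a t l) (i' : Ins a t' l), l.Nodup →
    (⟨t, i⟩ : Σ t, Ins a t l) = ⟨t', i'⟩
  | _, _, _, .here _, .here _, _ => rfl
  | _, _, _, .here _, .there _ i, h => by
    exfalso
    have := (List.nodup_cons.1 h).1
    clear h
    revert this
    induction i with
    | here => simp
    | there b i ih => intro h; simp at h; exact ih (by simpa using h.2)
  | _, _, _, .there _ i, .here _, h => by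
    exfalso
    have := (List.nodup_cons.1 h).1
    clear h
    revert this
    induction i with
    | here => simp
    | there b i ih => intro h; simp at h; exact ih (by simpa using h.2)
  | _, _, _, .there _ i, .there _ i', h => by
    have := Ins.unique i i' (List.nodup_cons.1 h).2
    cases this
    rfl

theorem Ins.nodup {a : ι} : ∀ {l t : List ι}, Ins a t l → l.Nodup → t.Nodup
  | _, _, .here _, h => (List.nodup_cons.1 h).2
  | _, _, .there b i, h => by
    have key : ∀ {t l : List ι}, Ins a t l → t ⊆ l := by
      intro t l i
      induction i with
      | here => simp
      | there b i ih => exact List.cons_subset_cons _ ih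
    rw [List.nodup_cons] at h ⊢
    exact ⟨fun hb => h.1 (key i hb), i.nodup h.2⟩

/-- There is at most one way to rearrange lists without repetitions. -/
theorem Arr.unique : ∀ {l l' : List ι} (p p' : Arr l l'), l'.Nodup → p = p'
  | _, _, .nil, .nil, _ => rfl
  | _, _, .cons p i, .cons p' i', h => by
    cases Ins.unique i i' h
    rw [Arr.unique p p' (i.nodup h)]

theorem Ins.exists {a : ι} : ∀ {l : List ι}, a ∈ l → ∃ t, Nonempty (Ins a t l) ∧ l.Perm (a :: t)
  | [], h => by simp at h
  | b :: l, h => by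
    by_cases hab : a = b
    · subst hab
      exact ⟨l, ⟨.here l⟩, .refl _⟩
    · obtain ⟨t, ⟨i⟩, ht⟩ := Ins.exists ((List.mem_cons.1 h).resolve_left hab)
      exact ⟨b :: t, ⟨.there b i⟩, (ht.cons b).trans (.swap _ _ _)⟩

theorem Arr.exists : ∀ {l l' : List ι}, l.Perm l' → Nonempty (Arr l l')
  | [], l', h => by rw [List.nil_perm.1 h]; exact ⟨.nil⟩
  | a :: t, l', h => by
    obtain ⟨t', ⟨i⟩, ht⟩ := Ins.exists (h.mem_iff.1 List.mem_cons_self)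
    obtain ⟨p⟩ := Arr.exists ((h.trans ht).cons_inv)
    exact ⟨.cons p i⟩

/-- The identity rearrangement. -/
def Arr.id : ∀ l : List ι, Arr l l
  | [] => .nil
  | _ :: t => .cons (Arr.id t) (.here t)

/-- Apply a function to all elements. -/
def Ins.map {κ : Type} (φ : ι → κ) {a : ι} : ∀ {t l : List ι}, Ins a t l →
    Ins (φ a) (t.map φ) (l.map φ)
  | _, _, .here _ => .here _
  | _, _, .there b i => .there (φ b) (i.map φ)

/-- Apply a function to all elements. -/
def Arr.map {κ : Type} (φ : ι → κ) : ∀ {l l' : List ι}, Arr l l' → Arr (l.map φ) (l'.map φ)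
  | _, _, .nil => .nil
  | _, _, .cons p i => .cons (p.map φ) (i.map φ)

variable {C : Type u} [Category.{v} C] [MonoidalCategory C] [SymmetricCategory C]

/-- The tensor product of a list of objects. -/
def tens (A : ι → C) : List ι → C
  | [] => 𝟙_ C
  | a :: t => A a ⊗ tens A t

/-- Interchange of the first two factors. -/
def swap (X Y Z : C) : X ⊗ (Y ⊗ Z) ⟶ Y ⊗ (X ⊗ Z) :=
  (α_ X Y Z).inv ≫ (β_ X Y).hom ▷ Z ≫ (α_ Y X Z).hom

theorem swap_swap (X Y Z : C) : swap X Y Z ≫ swap Y X Z = 𝟙 _ := by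
  simp [swap, ← comp_whiskerRight_assoc]

theorem swap_naturality {X X' Y Y' Z Z' : C} (f : X ⟶ X') (g : Y ⟶ Y') (h : Z ⟶ Z') :
    (f ⊗ₘ (g ⊗ₘ h)) ≫ swap X' Y' Z' = swap X Y Z ≫ (g ⊗ₘ (f ⊗ₘ h)) := by
  simp only [swap, associator_inv_naturality_assoc, Category.assoc, ← associator_naturality]
  rw [← tensorHom_id, ← tensorHom_id, tensorHom_comp_tensorHom_assoc,
    tensorHom_comp_tensorHom_assoc]
  simp

theorem swap_yb (X Y Z T : C) :
    X ◁ swap Y Z T ≫ swap X Z (Y ⊗ T) ≫ Z ◁ swap X Y T =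
      swap X Y (Z ⊗ T) ≫ Y ◁ swap X Z T ≫ swap Y Z (X ⊗ T) := by
  have h := congrArg (fun f => (α_ X Y (Z ⊗ T)).inv ≫ (α_ (X ⊗ Y) Z T).inv ≫ (α_ X Y Z).hom ▷ T ≫
    f ▷ T ≫ (α_ Z (Y ⊗ X) T).hom ≫ Z ◁ (α_ Y X T).hom) (BraidedCategory.yang_baxter X Y Z)
  refine Eq.trans ?_ (h.symm.trans ?_)
  · dsimp only [swap]
    monoidal
  · dsimp only [swap]
    monoidal

theorem exchange_step {a b c t l s L : C} (P : a ⊗ t ⟶ l) (Q : b ⊗ l ⟶ L) (P' : b ⊗ t ⟶ s)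
    (Q' : a ⊗ s ⟶ L) (h : b ◁ P ≫ Q = swap b a t ≫ a ◁ P' ≫ Q') :
    b ◁ (swap a c t ≫ c ◁ P) ≫ (swap b c l ≫ c ◁ Q) =
      swap b a (c ⊗ t) ≫ a ◁ (swap b c t ≫ c ◁ P') ≫ (swap a c s ≫ c ◁ Q') := by
  have hs := swap_naturality (𝟙 b) (𝟙 c) P
  have hs' := swap_naturality (𝟙 a) (𝟙 c) P'
  simp only [id_tensorHom] at hs hs'
  have h' := congrArg (fun f => c ◁ f) h
  simp only [whiskerLeft_comp] at h'
  simp only [whiskerLeft_comp, Category.assoc]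
  rw [reassoc_of% hs, h', reassoc_of% hs', reassoc_of% swap_yb b a c t]

theorem arrange_step {a b t l l' t' s L : C} (P : a ⊗ t ⟶ l) (p : l ⟶ l') (p' : t ⟶ t')
    (P' : a ⊗ t' ⟶ l') (Q : b ⊗ l' ⟶ L) (J : b ⊗ t' ⟶ s) (Q' : a ⊗ s ⟶ L)
    (h : P ≫ p = a ◁ p' ≫ P') (h' : b ◁ P' ≫ Q = swap b a t' ≫ a ◁ J ≫ Q') :
    (swap a b t ≫ b ◁ P) ≫ (b ◁ p ≫ Q) = a ◁ (b ◁ p' ≫ J) ≫ Q' := by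
  have hs := swap_naturality (𝟙 b) (𝟙 a) p'
  simp only [id_tensorHom] at hs
  have h2 := congrArg (fun f => b ◁ f) h
  simp only [whiskerLeft_comp] at h2
  simp only [whiskerLeft_comp, Category.assoc]
  rw [reassoc_of% h2, h', reassoc_of% hs, ← Category.assoc (swap a b t), swap_swap,
    Category.id_comp]

theorem comp_step {a t t' l t'' L : C} (p : t ⟶ t') (P : a ⊗ t' ⟶ l) (p' : l ⟶ L)
    (q : t' ⟶ t'') (P' : a ⊗ t'' ⟶ L) (r : t ⟶ t'') (h : P ≫ p' = a ◁ q ≫ P')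
    (hr : p ≫ q = r) : (a ◁ p ≫ P) ≫ p' = a ◁ r ≫ P' := by
  rw [Category.assoc, h, ← hr, whiskerLeft_comp, Category.assoc]

theorem put_nat_step {a b t l a' b' t' l' : C} (P : a ⊗ t ⟶ l) (P' : a' ⊗ t' ⟶ l')
    (f : a ⟶ a') (g : b ⟶ b') (k : t ⟶ t') (k' : l ⟶ l') (h : P ≫ k' = (f ⊗ₘ k) ≫ P') :
    (swap a b t ≫ b ◁ P) ≫ (g ⊗ₘ k') = (f ⊗ₘ (g ⊗ₘ k)) ≫ (swap a' b' t' ≫ b' ◁ P') := by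
  rw [← Category.assoc (f ⊗ₘ (g ⊗ₘ k)), swap_naturality, Category.assoc, Category.assoc,
    ← id_tensorHom, ← id_tensorHom, tensorHom_comp_tensorHom, tensorHom_comp_tensorHom, h,
    Category.id_comp, Category.comp_id]

theorem relabel_step {a a' t t' s s' : C} (p : t ⟶ t') (f : a ⟶ a') (k : t ⟶ s) (k' : t' ⟶ s')
    (q : s ⟶ s') (h : p ≫ k' = k ≫ q) : a ◁ p ≫ (f ⊗ₘ k') = (f ⊗ₘ k) ≫ a' ◁ q := by
  rw [← id_tensorHom, ← id_tensorHom, tensorHom_comp_tensorHom, tensorHom_comp_tensorHom, h,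
    Category.id_comp, Category.comp_id]

theorem relabel_id_step {a t t' : C} (p : t ⟶ t') (q : t' ⟶ t) (h : p ≫ q = 𝟙 _) :
    a ◁ p ≫ (a ◁ q ≫ 𝟙 _) = 𝟙 _ := by
  rw [Category.comp_id, ← whiskerLeft_comp, h, whiskerLeft_id]

theorem relabel_comp_step {a t t' t'' s : C} (p : t ⟶ t') (q : t' ⟶ t'') (r : t'' ⟶ s)
    (r' : t ⟶ s) (h : p ≫ q ≫ r = r') : a ◁ p ≫ a ◁ q ≫ (a ◁ r ≫ 𝟙 _) = a ◁ r' := by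
  rw [Category.comp_id, ← whiskerLeft_comp, ← whiskerLeft_comp, h]

theorem arr_nat_step {a t t' l a' s s' l' : C} (p : t ⟶ t') (P : a ⊗ t' ⟶ l) (f : a ⟶ a')
    (k : t ⟶ s) (k' : t' ⟶ s') (q : s ⟶ s') (P' : a' ⊗ s' ⟶ l') (k'' : l ⟶ l')
    (h : p ≫ k' = k ≫ q) (h' : P ≫ k'' = (f ⊗ₘ k') ≫ P') :
    (a ◁ p ≫ P) ≫ k'' = (f ⊗ₘ k) ≫ (a' ◁ q ≫ P') := by
  rw [Category.assoc, h', ← id_tensorHom, ← id_tensorHom, tensorHom_comp_tensorHom_assoc,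
    tensorHom_comp_tensorHom_assoc, h, Category.id_comp, Category.comp_id]

/-- Move a new first factor to its place. -/
def put (A : ι → C) {a : ι} : ∀ {t l : List ι}, Ins a t l → (A a ⊗ tens A t ⟶ tens A l)
  | _, _, .here _ => 𝟙 _
  | _, _, .there b (t := t) i => swap (A a) (A b) (tens A t) ≫ A b ◁ put A i

/-- Rearrange the factors of a tensor product, using the symmetry. -/
def arrange (A : ι → C) : ∀ {l l' : List ι}, Arr l l' → (tens A l ⟶ tens A l')
  | _, _, .nil => 𝟙 _
  | _, _, .cons (a := a) p i => A a ◁ arrange A p ≫ put A i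

theorem arrange_id (A : ι → C) : ∀ l : List ι, arrange A (Arr.id l) = 𝟙 _
  | [] => rfl
  | a :: t => by
    rw [Arr.id, arrange, arrange_id A t, put, whiskerLeft_id]
    exact Category.comp_id _

theorem exchange (A : ι → C) {a b : ι} : ∀ {t l l' : List ι} (i : Ins a t l) (j : Ins b l l'),
    ∃ (s : List ι) (j' : Ins b t s) (i' : Ins a s l'),
      A b ◁ put A i ≫ put A j = swap (A b) (A a) (tens A t) ≫ A a ◁ put A j' ≫ put A i'
  | t, l, _, i, .here _ => by
    refine ⟨b :: t, .here t, .there b i, ?_⟩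
    simp only [put]
    erw [whiskerLeft_id, Category.comp_id, Category.id_comp, ← Category.assoc, swap_swap,
      Category.id_comp]
  | _, _, _, .here t, .there _ j => by
    refine ⟨_, j, .here _, ?_⟩
    simp only [put]
    erw [whiskerLeft_id, Category.comp_id, Category.id_comp]
    rfl
  | _, _, _, .there _ (t := t) i, .there c (l := l') j => by
    obtain ⟨s, j', i', h⟩ := exchange A i j
    refine ⟨c :: s, .there c j', .there c i', ?_⟩
    exact exchange_step _ _ _ _ h

theorem put_arrange (A : ι → C) {a : ι} : ∀ {t l l' : List ι} (i : Ins a t l) (p : Arr l l'),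
    ∃ (t' : List ι) (p' : Arr t t') (i' : Ins a t' l'),
      put A i ≫ arrange A p = A a ◁ arrange A p' ≫ put A i'
  | _, _, _, .here _, .cons p j => ⟨_, p, j, Category.id_comp _⟩
  | _, _, _, .there b i, .cons p j => by
    obtain ⟨t', p', i', h⟩ := put_arrange A i p
    obtain ⟨s, j', i'', h'⟩ := exchange A i' j
    refine ⟨s, .cons p' j', i'', ?_⟩
    exact arrange_step _ _ _ _ _ _ _ h h'

theorem arrange_comp (A : ι → C) : ∀ {l l' l'' : List ι} (p : Arr l l') (p' : Arr l' l''),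
    ∃ q : Arr l l'', arrange A p ≫ arrange A p' = arrange A q
  | _, _, _, .nil, .nil => ⟨.nil, Category.id_comp _⟩
  | _, _, _, .cons p i, p' => by
    obtain ⟨t', q, i', h⟩ := put_arrange A i p'
    obtain ⟨r, hr⟩ := arrange_comp A p q
    refine ⟨.cons r i', ?_⟩
    exact comp_step _ _ _ _ _ _ h hr

/-- Tensor product of morphisms. -/
def tensMap {A B : ι → C} (f : ∀ a, A a ⟶ B a) : ∀ l : List ι, tens A l ⟶ tens B l
  | [] => 𝟙 _
  | a :: t => f a ⊗ₘ tensMap f t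

theorem tensMap_id (A : ι → C) : ∀ l : List ι, tensMap (fun a => 𝟙 (A a)) l = 𝟙 _
  | [] => rfl
  | a :: t => by rw [tensMap, tensMap_id A t]; exact id_tensorHom_id _ _

theorem tensMap_comp {A B B' : ι → C} (f : ∀ a, A a ⟶ B a) (g : ∀ a, B a ⟶ B' a) :
    ∀ l : List ι, tensMap (fun a => f a ≫ g a) l = tensMap f l ≫ tensMap g l
  | [] => (Category.id_comp _).symm
  | a :: t => by
    rw [tensMap, tensMap_comp f g t]
    exact (tensorHom_comp_tensorHom _ _ _ _).symm

theorem put_naturality {A B : ι → C} (f : ∀ a, A a ⟶ B a) {a : ι} :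
    ∀ {t l : List ι} (i : Ins a t l),
      put A i ≫ tensMap f l = (f a ⊗ₘ tensMap f t) ≫ put B i
  | _, _, .here _ => (Category.id_comp _).trans (Category.comp_id _).symm
  | _, _, .there b i => put_nat_step _ _ _ _ _ _ (put_naturality f i)

theorem arrange_naturality {A B : ι → C} (f : ∀ a, A a ⟶ B a) :
    ∀ {l l' : List ι} (p : Arr l l'),
      arrange A p ≫ tensMap f l' = tensMap f l ≫ arrange B p
  | _, _, .nil => (Category.comp_id _).trans (Category.id_comp _).symm
  | _, _, .cons p i => arr_nat_step _ _ _ _ _ _ _ _ (arrange_naturality f p) (put_naturality f i)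

/-- The identification of the tensor product of `B (φ a)` over `l` with the tensor product of `B`
over the image of `l`. -/
def relabel {κ : Type} (φ : ι → κ) (B : κ → C) : ∀ l : List ι,
    tens (fun a => B (φ a)) l ⟶ tens B (l.map φ)
  | [] => 𝟙 _
  | a :: t => B (φ a) ◁ relabel φ B t


theorem relabel_naturality {κ : Type} (φ : ι → κ) {B B' : κ → C} (f : ∀ b, B b ⟶ B' b) :
    ∀ l : List ι, relabel φ B l ≫ tensMap f (l.map φ) =
      tensMap (fun a => f (φ a)) l ≫ relabel φ B' l
  | [] => rfl
  | _ :: t => relabel_step _ _ _ _ _ (relabel_naturality φ f t)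

theorem put_relabel {κ : Type} (φ : ι → κ) (B : κ → C) {a : ι} : ∀ {t l : List ι} (i : Ins a t l),
    put (fun a => B (φ a)) i ≫ relabel φ B l = B (φ a) ◁ relabel φ B t ≫ put B (i.map φ)
  | _, _, .here _ => (Category.id_comp _).trans (Category.comp_id _).symm
  | _, _, .there b i => by
    have := put_nat_step (put (fun a => B (φ a)) i) (put B (i.map φ)) (𝟙 _) (𝟙 (B (φ b))) _ _
      ((put_relabel φ B i).trans (by rw [id_tensorHom]))
    rw [id_tensorHom, id_tensorHom, id_tensorHom] at this
    exact this

theorem arrange_relabel {κ : Type} (φ : ι → κ) (B : κ → C) : ∀ {l l' : List ι} (p : Arr l l'),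
    arrange (fun a => B (φ a)) p ≫ relabel φ B l' = relabel φ B l ≫ arrange B (p.map φ)
  | _, _, .nil => rfl
  | _, _, .cons p i => by
    have := arr_nat_step _ _ (𝟙 _) _ _ _ _ _ (arrange_relabel φ B p)
      ((put_relabel φ B i).trans (by rw [id_tensorHom]))
    rw [id_tensorHom] at this
    exact this

theorem relabel_id (A : ι → C) : ∀ l : List ι, ∃ p : Arr (l.map id) l,
    relabel id A l ≫ arrange A p = 𝟙 _
  | [] => ⟨.nil, Category.id_comp _⟩
  | a :: t => by
    obtain ⟨p, hp⟩ := relabel_id A t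
    refine ⟨.cons p (.here t), ?_⟩
    exact relabel_id_step _ _ hp

theorem relabel_comp {κ μ : Type} (φ : ι → κ) (ψ : κ → μ) (B : μ → C) : ∀ l : List ι,
    ∃ p : Arr ((l.map φ).map ψ) (l.map (ψ ∘ φ)),
      relabel φ (fun b => B (ψ b)) l ≫ relabel ψ B (l.map φ) ≫ arrange B p = relabel (ψ ∘ φ) B l
  | [] => ⟨.nil, (Category.id_comp _).trans (Category.id_comp _)⟩
  | a :: t => by
    obtain ⟨p, hp⟩ := relabel_comp φ ψ B t
    refine ⟨.cons p (.here _), ?_⟩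
    exact relabel_comp_step _ _ _ _ hp

theorem arrange_eq (A : ι → C) {l l' : List ι} (p p' : Arr l l') (h : l'.Nodup) :
    arrange A p = arrange A p' := by rw [Arr.unique p p' h]

end

section

variable {C : Type u} [Category.{v} C] [MonoidalCategory C] [SymmetricCategory C]

/-- A chosen enumeration of a weighted set. -/
noncomputable def order (S : U n) : List S.carrier :=
  letI := Fintype.ofFinite S.carrier
  Finset.univ.toList

theorem order_nodup (S : U n) : (order S).Nodup := Finset.nodup_toList _

theorem order_perm {S T : U n} (φ : S ⟶ T) : ((order S).map φ.equiv).Perm (order T) := by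
  refine (List.perm_ext_iff_of_nodup ((order_nodup S).map φ.equiv.injective) (order_nodup T)).2
    fun t => ?_
  refine iff_of_true (List.mem_map.2 ⟨φ.equiv.symm t, ?_, by simp⟩) ?_ <;> simp [order]

/-- The rearrangement of enumerations along a morphism. -/
noncomputable def orderArr {S T : U n} (φ : S ⟶ T) : Arr ((order S).map φ.equiv) (order T) :=
  (Arr.exists (order_perm φ)).some

/-- The functor `𝒦({A_i})`: a weighted set `S` is sent to the tensor product of the `A_{w(s)}`
over the elements `s` of `S`, i.e. up to canonical isomorphism to `⨂ A_i^{⊗ a_i}` if `S` has `a_i`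
elements of weight `i`. A morphism permutes the tensor factors, and applies the maps of the
chain. -/
noncomputable def kObj (A : Fin n ⥤ C) : U n ⥤ C where
  obj S := tens (fun s => A.obj (S.weight s)) (order S)
  map {S T} φ :=
    tensMap (B := fun s => A.obj (T.weight (φ.equiv s)))
        (fun s => A.map (homOfLE (φ.weight_le s))) (order S) ≫
      relabel φ.equiv (fun t => A.obj (T.weight t)) (order S) ≫
      arrange (fun t => A.obj (T.weight t)) (orderArr φ)
  map_id S := by
    obtain ⟨p, hp⟩ := relabel_id (fun s => A.obj (S.weight s)) (order S)
    have h1 : (fun s => A.map (homOfLE (UHom.weight_le (𝟙 S) s))) =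
      fun s => 𝟙 (A.obj (S.weight s)) := funext fun s => A.map_id _
    exact (congrArg₂ (fun f g => f ≫ relabel id (fun t => A.obj (S.weight t)) (order S) ≫ g)
      ((congrArg (fun f => tensMap f (order S)) h1).trans (tensMap_id _ _))
      (arrange_eq _ (orderArr (𝟙 S)) p (order_nodup S))).trans
      ((Category.id_comp _).trans hp)
  map_comp {S T W} φ ψ := by
    obtain ⟨p, hp⟩ := relabel_comp φ.equiv ψ.equiv (fun t => A.obj (W.weight t)) (order S)
    obtain ⟨x, hx⟩ := arrange_comp (fun t => A.obj (W.weight t)) p (orderArr (φ ≫ ψ))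
    obtain ⟨y, hy⟩ := arrange_comp (fun t => A.obj (W.weight t))
      ((orderArr φ).map ψ.equiv) (orderArr ψ)
    have hxy := arrange_eq (fun t => A.obj (W.weight t)) x y (order_nodup W)
    have h1 : (fun s => A.map (homOfLE (UHom.weight_le (φ ≫ ψ) s))) =
      fun s => A.map (homOfLE (φ.weight_le s)) ≫ A.map (homOfLE (ψ.weight_le (φ.equiv s))) :=
      funext fun s => A.map_comp (homOfLE (φ.weight_le s)) (homOfLE (ψ.weight_le (φ.equiv s)))
    have h2 := arrange_naturality (B := fun s => A.obj (W.weight (ψ.equiv s)))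
      (fun s => A.map (homOfLE (ψ.weight_le s))) (orderArr φ)
    have h3 := arrange_relabel ψ.equiv (fun t => A.obj (W.weight t)) (orderArr φ)
    have h4 := relabel_naturality φ.equiv (B' := fun s => A.obj (W.weight (ψ.equiv s)))
      (fun s => A.map (homOfLE (ψ.weight_le s))) (order S)
    simp only [Category.assoc]
    rw [reassoc_of% h2, reassoc_of% h3, reassoc_of% h4, hy, ← hxy, ← hx, reassoc_of% hp]
    refine (congrArg (· ≫ _) ((congrArg (fun f => tensMap f (order S)) h1).trans
      (tensMap_comp _ _ _))).trans ?_
    rw [Category.assoc]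
    rfl

variable (n C) in
/-- The functor `𝒦` from chains `A_1 ⟶ ⋯ ⟶ A_n` to functors on weighted sets. -/
noncomputable def kFunctor : (Fin n ⥤ C) ⥤ (U n ⥤ C) where
  obj A := kObj A
  map {A B} f :=
    { app S := tensMap (fun s => f.app (S.weight s)) (order S)
      naturality S T φ := by
        have h1 := arrange_naturality (fun s => f.app (T.weight s)) (orderArr φ)
        have h2 := relabel_naturality φ.equiv (fun s => f.app (T.weight s)) (order S)
        have h3 : tensMap (B := fun s => A.obj (T.weight (φ.equiv s)))
              (fun s => A.map (homOfLE (φ.weight_le s))) (order S) ≫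
              tensMap (fun s => f.app (T.weight (φ.equiv s))) (order S) =
            tensMap (fun s => f.app (S.weight s)) (order S) ≫
              tensMap (B := fun s => B.obj (T.weight (φ.equiv s)))
                (fun s => B.map (homOfLE (φ.weight_le s))) (order S) := by
          rw [← tensMap_comp, ← tensMap_comp]
          exact congrArg (fun g => tensMap g (order S)) (funext fun s => f.naturality _)
        simp only [kObj, Category.assoc]
        rw [h1, reassoc_of% h2, reassoc_of% h3] }
  map_id A := by ext S; exact tensMap_id _ _
  map_comp f g := by ext S; exact tensMap_comp _ _ _

end

section

/-- A weighted set regarded as an object of `D n`. -/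
abbrev U.toD (S : U n) : D n := ⟨S.toWSet⟩

/-- The inverse of an upwards bijection is a downwards bijection. -/
def U.invD {S T : U n} (φ : S ⟶ T) : T.toD ⟶ S.toD :=
  ⟨φ.equiv.symm, fun t => by
    obtain ⟨s, rfl⟩ := φ.equiv.surjective t
    simpa using φ.weight_le s⟩

@[simp] theorem U.invD_id (S : U n) : U.invD (𝟙 S) = 𝟙 S.toD := rfl

@[simp] theorem U.invD_comp {S T W : U n} (φ : S ⟶ T) (ψ : T ⟶ W) :
    U.invD (φ ≫ ψ) = U.invD ψ ≫ U.invD φ := rfl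

/-- The dual `S ↦ N(S)^*` of a `D n`-module. -/
noncomputable def dual (N : ModD n) : U n ⥤ Vect where
  obj S := ModuleCat.of ℂ (Module.Dual ℂ (N.obj.obj S.toD))
  map φ := ModuleCat.ofHom (N.obj.map (U.invD φ)).hom.dualMap
  map_id S := by ext; simp
  map_comp φ ψ := by ext; simp

/-- The map of duals induced by a map of `D n`-modules. -/
noncomputable def dualMap {N N' : ModD n} (f : N ⟶ N') : dual N' ⟶ dual N where
  app S := ModuleCat.ofHom (f.hom.app S.toD).hom.dualMap
  naturality S T φ := by
    refine ModuleCat.hom_ext (LinearMap.ext fun (x : Module.Dual ℂ (N'.obj.obj S.toD)) =>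
      LinearMap.ext fun (y : N.obj.obj T.toD) => congrArg x ?_)
    exact (ConcreteCategory.congr_hom (f.hom.naturality (U.invD φ)) y).symm

/-- The functor `X ↦ ℂ[Hom(X, a)]^*` on `D n`. -/
noncomputable def injFunctor (a : D n) : D n ⥤ Vect where
  obj X := ModuleCat.of ℂ (Module.Dual ℂ ((X ⟶ a) →₀ ℂ))
  map f := ModuleCat.ofHom (Finsupp.lmapDomain ℂ ℂ (f ≫ ·)).dualMap
  map_id X := by ext; simp
  map_comp f g := by ext; simp

theorem isModule_inj (a : D n) : IsModule n (injFunctor a) := by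
  refine ⟨fun X => ?_, Set.range fun w : a.carrier → Fin n => (⟨⟨a.carrier, w⟩⟩ : D n),
    Set.finite_range _, fun X hX => ?_⟩
  · change Module.Finite ℂ (Module.Dual ℂ ((X ⟶ a) →₀ ℂ))
    infer_instance
  · by_cases h : Nonempty (X ⟶ a)
    · obtain ⟨f⟩ := h
      exact ⟨_, ⟨fun x => X.weight (f.equiv.symm x), rfl⟩,
        ⟨D.mkIso f.equiv fun s => congrArg X.weight (f.equiv.symm_apply_apply s)⟩⟩
    · rw [not_nonempty_iff] at h
      exact (hX (ModuleCat.isZero_of_subsingleton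
        (ModuleCat.of ℂ (Module.Dual ℂ ((X ⟶ a) →₀ ℂ))))).elim

variable (n) in
/-- The principal injective `D n`-modules `J_a = (X ↦ ℂ[Hom(X, a)]^*)`. They depend
contravariantly on `a` in `D n`, so covariantly on `a` in `U n`. -/
noncomputable def principalInjective : U n ⥤ ModD n where
  obj a := ⟨injFunctor a.toD, isModule_inj _⟩
  map {a b} φ := ObjectProperty.homMk
    { app X := ModuleCat.ofHom (Finsupp.lmapDomain ℂ ℂ (fun f : X ⟶ b.toD => f ≫ U.invD φ)).dualMap
      naturality X Y f := by
        refine ModuleCat.hom_ext (LinearMap.ext fun (x : Module.Dual ℂ ((X ⟶ a.toD) →₀ ℂ)) =>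
          LinearMap.ext fun (y : (Y ⟶ b.toD) →₀ ℂ) => congrArg x ?_)
        change Finsupp.mapDomain _ (Finsupp.mapDomain _ y) =
          Finsupp.mapDomain _ (Finsupp.mapDomain _ y)
        rw [← Finsupp.mapDomain_comp, ← Finsupp.mapDomain_comp]
        exact congrArg (fun g => Finsupp.mapDomain g y) (funext fun g =>
          (Category.assoc f g (U.invD φ)).symm) }
  map_id a := by
    refine ObjectProperty.hom_ext _ (NatTrans.ext (funext fun X => ModuleCat.hom_ext
      (LinearMap.ext fun (x : Module.Dual ℂ ((X ⟶ a.toD) →₀ ℂ)) =>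
        LinearMap.ext fun (y : (X ⟶ a.toD) →₀ ℂ) => congrArg x ?_)))
    change Finsupp.mapDomain _ y = y
    refine Eq.trans ?_ (Finsupp.mapDomain_id (v := y))
    exact congrArg (fun g => Finsupp.mapDomain g y) (funext fun g => Category.comp_id _)
  map_comp {a b c} φ ψ := by
    refine ObjectProperty.hom_ext _ (NatTrans.ext (funext fun X => ModuleCat.hom_ext
      (LinearMap.ext fun (x : Module.Dual ℂ ((X ⟶ a.toD) →₀ ℂ)) =>
        LinearMap.ext fun (y : (X ⟶ c.toD) →₀ ℂ) => congrArg x ?_)))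
    change Finsupp.mapDomain _ y = Finsupp.mapDomain _ (Finsupp.mapDomain _ y)
    rw [← Finsupp.mapDomain_comp]
    exact congrArg (fun g => Finsupp.mapDomain g y) (funext fun g =>
      (Category.assoc g (U.invD ψ) (U.invD φ)).symm)

variable (n) in
/-- The one-point weighted sets `e_1 ⟶ e_2 ⟶ ⋯ ⟶ e_n` in `U n`. -/
def point : Fin n ⥤ U n where
  obj i := ⟨⟨Unit, fun _ => i⟩⟩
  map h := ⟨Equiv.refl _, fun _ => leOfHom h⟩

end

section

variable (n) (C : Type u) [Category.{v} C] [Preadditive C] [Linear ℂ C] [MonoidalCategory C]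
  [SymmetricCategory C]

/-- A left-exact tensor functor from `D n`-modules to `C`: a `ℂ`-linear (strong) symmetric monoidal
functor which preserves finite limits. -/
structure LExTensorFunctor where
  functor : ModD n ⥤ C
  [braided : functor.Braided]
  [additive : functor.Additive]
  [linear : functor.Linear ℂ]
  [leftExact : PreservesFiniteLimits functor]

attribute [instance] LExTensorFunctor.braided LExTensorFunctor.additive LExTensorFunctor.linear
  LExTensorFunctor.leftExact

variable {n C} in
/-- Morphisms of left-exact tensor functors are monoidal natural transformations. -/
@[ext]
structure LExTensorFunctor.Hom (F G : LExTensorFunctor n C) where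
  natTrans : F.functor ⟶ G.functor
  [isMonoidal : NatTrans.IsMonoidal natTrans]

attribute [instance] LExTensorFunctor.Hom.isMonoidal

instance : Category (LExTensorFunctor n C) where
  Hom F G := LExTensorFunctor.Hom F G
  id F := { natTrans := 𝟙 F.functor }
  comp α β := { natTrans := α.natTrans ≫ β.natTrans }

/-- The underlying functor of a left-exact tensor functor. -/
def LExTensorFunctor.forget : LExTensorFunctor n C ⥤ (ModD n ⥤ C) where
  obj F := F.functor
  map α := α.natTrans

/-- The functor sending `F` to the chain `F(J_{e_1}) ⟶ ⋯ ⟶ F(J_{e_n})`. -/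
noncomputable def evalInjectives : LExTensorFunctor n C ⥤ (Fin n ⥤ C) :=
  LExTensorFunctor.forget n C ⋙ (Functor.whiskeringLeft _ _ _).obj (point n ⋙ principalInjective n)

variable {n C}

/-- The structured Hom object `Hom(M, K)` in `C`, where `K : U n ⥤ C` and `M` is a `U n`-module, is
defined by its mapping property: a morphism `X ⟶ Hom(M, K)` in `C` is a family of linear maps
`M(S) ⟶ Hom_C(X, K(S))` which is compatible with the morphisms of `U n`. -/
@[ext]
structure ToStructuredHom (X : C) (M : U n ⥤ Vect) (K : U n ⥤ C) where
  app (S : U n) : M.obj S →ₗ[ℂ] (X ⟶ K.obj S)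
  naturality {S T : U n} (φ : S ⟶ T) (m : M.obj S) :
    app T ((M.map φ).hom m) = app S m ≫ K.map φ

namespace ToStructuredHom

/-- The datum corresponding to the composite `X' ⟶ X ⟶ Hom(M, K)`. -/
def precomp {X X' : C} (f : X' ⟶ X) {M : U n ⥤ Vect} {K : U n ⥤ C} (t : ToStructuredHom X M K) :
    ToStructuredHom X' M K where
  app S := Linear.leftComp ℂ _ f ∘ₗ t.app S
  naturality φ m := by simp [t.naturality]

/-- The datum corresponding to the composite `X ⟶ Hom(M, K) ⟶ Hom(M, K')`. -/
def postcomp {X : C} {M : U n ⥤ Vect} {K K' : U n ⥤ C} (t : ToStructuredHom X M K) (g : K ⟶ K') :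
    ToStructuredHom X M K' where
  app S := Linear.rightComp ℂ _ (g.app S) ∘ₗ t.app S
  naturality φ m := by simp [t.naturality]

/-- The datum corresponding to the composite `X ⟶ Hom(M, K) ⟶ Hom(M', K)`. -/
def restrict {X : C} {M M' : U n ⥤ Vect} {K : U n ⥤ C} (t : ToStructuredHom X M K) (h : M' ⟶ M) :
    ToStructuredHom X M' K where
  app S := t.app S ∘ₗ (h.app S).hom
  naturality φ m := by
    have := ConcreteCategory.congr_hom (h.naturality φ) m
    dsimp at this ⊢
    rw [this, t.naturality]

end ToStructuredHom

/-- `G(A)(N)` is the structured tensor product `N ⊙ K(A) = Hom(N^∨, K(A))`, functorially in `A` and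
`N`: it has the mapping property of `Hom(N^∨, K(A))`, naturally in `A`, in `N` and in the test
object `X`. -/
structure IsStructuredTensor {T : Type*} [Category* T] (K : T ⥤ U n ⥤ C) (G : T ⥤ ModD n ⥤ C) where
  homEquiv (A : T) (N : ModD n) (X : C) :
    (X ⟶ (G.obj A).obj N) ≃ ToStructuredHom X (dual N) (K.obj A)
  homEquiv_precomp (A : T) (N : ModD n) {X X' : C} (f : X' ⟶ X) (g : X ⟶ (G.obj A).obj N) :
    homEquiv A N X' (f ≫ g) = (homEquiv A N X g).precomp f
  homEquiv_map (A : T) {N N' : ModD n} (h : N ⟶ N') {X : C} (g : X ⟶ (G.obj A).obj N) :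
    homEquiv A N' X (g ≫ (G.obj A).map h) = (homEquiv A N X g).restrict (dualMap h)
  homEquiv_app {A A' : T} (k : A ⟶ A') (N : ModD n) {X : C} (g : X ⟶ (G.obj A).obj N) :
    homEquiv A' N X (g ≫ (G.map k).app N) = (homEquiv A N X g).postcomp (K.map k)

end

end WeightedSets

-- A functional on `N(S)` is the same as a morphism from `N` to `J_S` (Yoneda, `dualMap_toInj` and
-- `toInj_hom_ext`), so `N^∨(S) = Hom(N, J_S)`. Since the values of `N` are finite dimensional, `N`
-- is recovered from its dual: `N = N ⊙ J`, where `J` is the functor of principal injectives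
-- (`injFamily_isUniversal`).
--
-- As a `U n`-module, `N^∨` has a finite presentation, with generators in degrees `S_i` and
-- relations in degrees `R_j`. Hence `N ⊙ K` is the kernel of a map from the product of the `K(S_i)`
-- to the product of the `K(R_j)`; in particular it exists (`exists_isUniversal`), and every linear
-- left-exact functor preserves it (`ToStructuredHom.IsUniversal.map`). Applied to `N = N ⊙ J`, this
-- gives `F(N) = N ⊙ (F ∘ J)` for every left-exact `F`. Conversely `N ↦ N ⊙ K` is left exact,
-- because dualising turns kernels of modules into cokernels, and its value at `J_A` is `K(A)`,
-- because the dual of `J_A` is free on one generator in degree `A`. Apart from tensor structures,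
-- left-exact functors thus amount to functors `K` on `U n`.
--
-- For the tensor structures, `(M ⊗ N)^∨` is the Day convolution of `M^∨` and `N^∨`: a family on it
-- with values in `K` is a bilinear family `M^∨(S) × N^∨(T) → K(S ⊔ T)`
-- (`ToStructuredHom.tensor_ext`, `Bifamily.union_pair`). On the other side, since the tensor
-- product of `C` is left exact in each variable, morphisms to `(M ⊙ K) ⊗ (N ⊙ K)` are bilinear
-- families with values in `K(S) ⊗ K(T)` (`ToStructuredHom.IsUniversal.exists_tensor_lift`). So a
-- symmetric monoidal structure on `K` induces one on `N ↦ N ⊙ K`. In the other direction `J` is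
-- itself symmetric monoidal, because `J_A ⊗ J_B ≅ J_{A ⊔ B}` (`IsFree.tensor`), so `F ∘ J` is
-- symmetric monoidal when `F` is.
--
-- It remains to see that symmetric monoidal functors on `U n` amount to chains, every weighted set
-- being the disjoint union of its points. From a chain `A` one gets `𝒦(A)` with `𝒦(A)(e_i) ≅ A_i`
-- (`kPoint`), and from a symmetric monoidal `H` a monoidal isomorphism from `𝒦` of its chain to `H`
-- (`kCounit`). The coherence needed here rests on one fact: a list without repetitions can be
-- rearranged into another one in at most one way, so identities may be checked up to rearrangement
-- (`Sim.eq`).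

universe v' u'

namespace WeightedSets

variable {n : ℕ}

/-! ### The symmetric monoidal category of upwards bijections. -/

/-- A weight preserving bijection is an isomorphism. -/
def U.mkIso {S T : U n} (e : S.carrier ≃ T.carrier) (h : ∀ s, T.weight (e s) = S.weight s) :
    S ≅ T where
  hom := ⟨e, fun s => (h s).ge⟩
  inv := ⟨e.symm, fun t => by rw [← h, e.apply_symm_apply]⟩
  hom_inv_id := U.hom_ext fun s => e.symm_apply_apply s
  inv_hom_id := U.hom_ext fun s => e.apply_symm_apply s

/-- Disjoint union of weighted sets. -/
def U.union (S T : U n) : U n := ⟨(S.toD.union T.toD).toWSet⟩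

/-- Disjoint union of morphisms. -/
def U.unionMap {S S' T T' : U n} (f : S ⟶ S') (g : T ⟶ T') : S.union T ⟶ S'.union T' :=
  ⟨Equiv.sumCongr f.equiv g.equiv, by rintro (s | t); exacts [f.weight_le s, g.weight_le t]⟩

instance (n : ℕ) : MonoidalCategory (U n) where
  tensorObj := U.union
  tensorHom := U.unionMap
  whiskerLeft S _ _ g := U.unionMap (𝟙 S) g
  whiskerRight f T := U.unionMap f (𝟙 T)
  tensorUnit := ⟨(D.empty n).toWSet⟩
  associator S T W := U.mkIso (Equiv.sumAssoc _ _ _) (by rintro ((_ | _) | _) <;> rfl)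
  leftUnitor S := U.mkIso (Equiv.emptySum Empty _) (by rintro (a | _); exacts [a.elim, rfl])
  rightUnitor S := U.mkIso (Equiv.sumEmpty _ Empty) (by rintro (_ | a); exacts [rfl, a.elim])
  tensorHom_def _ _ := U.hom_ext (by rintro (_ | _) <;> rfl)
  id_tensorHom_id _ _ := U.hom_ext (by rintro (_ | _) <;> rfl)
  tensorHom_comp_tensorHom _ _ _ _ := U.hom_ext (by rintro (_ | _) <;> rfl)
  whiskerLeft_id _ _ := U.hom_ext (by rintro (_ | _) <;> rfl)
  id_whiskerRight _ _ := U.hom_ext (by rintro (_ | _) <;> rfl)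
  associator_naturality _ _ _ := U.hom_ext (by rintro ((_ | _) | _) <;> rfl)
  leftUnitor_naturality _ := U.hom_ext (by rintro (a | _); exacts [a.elim, rfl])
  rightUnitor_naturality _ := U.hom_ext (by rintro (_ | a); exacts [rfl, a.elim])
  pentagon _ _ _ _ := U.hom_ext (by rintro (((_ | _) | _) | _) <;> rfl)
  triangle _ _ := U.hom_ext (by rintro ((_ | a) | _); exacts [rfl, a.elim, rfl])

instance (n : ℕ) : SymmetricCategory (U n) where
  braiding S T := U.mkIso (Equiv.sumComm _ _) (by rintro (_ | _) <;> rfl)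
  braiding_naturality_right _ _ _ _ := U.hom_ext (by rintro (_ | _) <;> rfl)
  braiding_naturality_left _ _ := U.hom_ext (by rintro (_ | _) <;> rfl)
  hexagon_forward _ _ _ := U.hom_ext (by rintro ((_ | _) | _) <;> rfl)
  hexagon_reverse _ _ _ := U.hom_ext (by rintro (_ | (_ | _)) <;> rfl)
  symmetry _ _ := U.hom_ext (by rintro (_ | _) <;> rfl)

theorem U.invD_tensorHom {S S' T T' : U n} (f : S ⟶ S') (g : T ⟶ T') :
    U.invD (f ⊗ₘ g) = U.invD f ⊗ₘ U.invD g := D.hom_ext (by rintro (_ | _) <;> rfl)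

/-! ### Day convolution of modules: structure morphisms on the generating maps. -/

section Day

open LawfulDayConvolutionMonoidalCategoryStruct

attribute [local instance] convolution convolution₂ convolution₂' convolutionUnit

/-- The canonical map `M(S) ⊗ N(T) ⟶ (M ⊗ N)(S ⊔ T)`. -/
noncomputable def inc (M N : ModD n) (S T : D n) :
    M.obj.obj S ⊗ N.obj.obj T ⟶ (M ⊗ N).obj.obj (S ⊗ T) := convUnitApp M.obj N.obj S T

theorem inc_naturality (M N : ModD n) {S S' T T' : D n} (f : S ⟶ S') (g : T ⟶ T') :
    (M.obj.map f ⊗ₘ N.obj.map g) ≫ inc M N S' T' = inc M N S T ≫ (M ⊗ N).obj.map (f ⊗ₘ g) :=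
  DayConvolution.unit_naturality ((ι (D n) Vect (ModD n)).obj M) ((ι (D n) Vect (ModD n)).obj N) f g

theorem inc_tensorHom {M M' N N' : ModD n} (f : M ⟶ M') (g : N ⟶ N') (S T : D n) :
    inc M N S T ≫ (f ⊗ₘ g).hom.app (S ⊗ T) =
      (f.hom.app S ⊗ₘ g.hom.app T) ≫ inc M' N' S T := by
  have h := ι_map_tensorHom_hom_eq_tensorHom (D n) Vect (ModD n) f g
  have h' := DayConvolution.unit_app_map_app ((ι (D n) Vect (ModD n)).map f)
    ((ι (D n) Vect (ModD n)).map g) S T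
  rw [← h] at h'
  exact h'

theorem inc_associator (M N P : ModD n) (S T W : D n) :
    inc M N S T ▷ P.obj.obj W ≫ inc (M ⊗ N) P (S ⊗ T) W ≫
      (α_ M N P).hom.hom.app ((S ⊗ T) ⊗ W) =
    (α_ _ _ _).hom ≫ M.obj.obj S ◁ inc N P T W ≫ inc M (N ⊗ P) S (T ⊗ W) ≫
      (M ⊗ N ⊗ P).obj.map (α_ S T W).inv := by
  have h := ι_map_associator_hom_eq_associator_hom (D n) Vect (ModD n) M N P
  have h' := DayConvolution.associator_hom_unit_unit ((ι (D n) Vect (ModD n)).obj M)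
    ((ι (D n) Vect (ModD n)).obj N) ((ι (D n) Vect (ModD n)).obj P) S T W
  rw [← h] at h'
  exact h'

theorem inc_braiding (M N : ModD n) (S T : D n) :
    inc M N S T ≫ (β_ M N).hom.hom.app (S ⊗ T) =
      (β_ _ _).hom ≫ inc N M T S ≫ (N ⊗ M).obj.map (β_ T S).hom := by
  have h := ι_map_braid M N
  have h' := DayConvolution.unit_app_braiding_hom_app ((ι (D n) Vect (ModD n)).obj M)
    ((ι (D n) Vect (ModD n)).obj N) S T
  rw [← h] at h'
  exact h'

/-- The canonical map `ℂ ⟶ 1(∅)`. -/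
noncomputable def unitCan : 𝟙_ Vect ⟶ (𝟙_ (ModD n)).obj.obj (𝟙_ (D n)) := unitι (𝟙 _)

theorem inc_leftUnitor (M : ModD n) (S : D n) :
    unitCan ▷ M.obj.obj S ≫ inc (𝟙_ (ModD n)) M (𝟙_ (D n)) S ≫
      (λ_ M).hom.hom.app (𝟙_ (D n) ⊗ S) = (λ_ (M.obj.obj S)).hom ≫ M.obj.map (λ_ S).inv := by
  have h := ι_map_leftUnitor_hom_eq_leftUnitor_hom (D n) Vect (ModD n) M
  have h' := DayConvolutionUnit.leftUnitor_hom_unit_app ((ι (D n) Vect (ModD n)).obj (𝟙_ (ModD n)))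
    ((ι (D n) Vect (ModD n)).obj M) S
  rw [← h] at h'
  exact h'

end Day

/-! ### The same formulas on elements, and generators of `(M ⊗ N)(X)`. -/

section Elements

open scoped TensorProduct

/-- The element of `(M ⊗ N)(S ⊔ T)` given by `x ∈ M(S)` and `y ∈ N(T)`. -/
noncomputable def incl {M N : ModD n} {S T : D n} (x : M.obj.obj S) (y : N.obj.obj T) :
    (M ⊗ N).obj.obj (S ⊗ T) := (inc M N S T).hom (x ⊗ₜ[ℂ] y)

theorem incl_map {M N : ModD n} {S S' T T' : D n} (f : S ⟶ S') (g : T ⟶ T')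
    (x : M.obj.obj S) (y : N.obj.obj T) :
    incl ((M.obj.map f).hom x) ((N.obj.map g).hom y) =
      ((M ⊗ N).obj.map (f ⊗ₘ g)).hom (incl x y) :=
  ConcreteCategory.congr_hom (inc_naturality M N f g) (x ⊗ₜ[ℂ] y)

theorem tensorHom_incl {M M' N N' : ModD n} (f : M ⟶ M') (g : N ⟶ N') {S T : D n}
    (x : M.obj.obj S) (y : N.obj.obj T) :
    ((f ⊗ₘ g).hom.app (S ⊗ T)).hom (incl x y) =
      incl ((f.hom.app S).hom x) ((g.hom.app T).hom y) :=
  ConcreteCategory.congr_hom (inc_tensorHom f g S T) (x ⊗ₜ[ℂ] y)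

theorem associator_incl {M N P : ModD n} {S T W : D n}
    (x : M.obj.obj S) (y : N.obj.obj T) (z : P.obj.obj W) :
    ((α_ M N P).hom.hom.app ((S ⊗ T) ⊗ W)).hom (incl (incl x y) z) =
      ((M ⊗ N ⊗ P).obj.map (α_ S T W).inv).hom (incl x (incl y z)) :=
  ConcreteCategory.congr_hom (inc_associator M N P S T W) ((x ⊗ₜ[ℂ] y) ⊗ₜ[ℂ] z)

theorem braiding_incl {M N : ModD n} {S T : D n} (x : M.obj.obj S) (y : N.obj.obj T) :
    ((β_ M N).hom.hom.app (S ⊗ T)).hom (incl x y) =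
      ((N ⊗ M).obj.map (β_ T S).hom).hom (incl y x) :=
  ConcreteCategory.congr_hom (inc_braiding M N S T) (x ⊗ₜ[ℂ] y)

/-- The canonical element of `1(∅)`. -/
noncomputable def unitElt : (𝟙_ (ModD n)).obj.obj (𝟙_ (D n)) := unitCan.hom (1 : ℂ)

theorem leftUnitor_incl {M : ModD n} {S : D n} (x : M.obj.obj S) :
    ((λ_ M).hom.hom.app (𝟙_ (D n) ⊗ S)).hom (incl unitElt x) =
      (M.obj.map (λ_ S).inv).hom x :=
  (ConcreteCategory.congr_hom (inc_leftUnitor M S) ((1 : ℂ) ⊗ₜ[ℂ] x)).trans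
    (congrArg (M.obj.map (λ_ S).inv).hom (one_smul ℂ x))

/-- The element of the summand of `(M ⊗ N)(X)` indexed by a subset of `X`. -/
noncomputable def summand {M N : ModD n} {X : D n} (A : Set X.carrier)
    (x : M.obj.obj (X.sub A)) (y : N.obj.obj (X.sub Aᶜ)) : (M ⊗ N).obj.obj X :=
  (convι M.obj N.obj X A).hom (x ⊗ₜ[ℂ] y)

theorem map_incl {M N : ModD n} {S T X : D n} (u : S ⊗ T ⟶ X) (x : M.obj.obj S)
    (y : N.obj.obj T) : ((M ⊗ N).obj.map u).hom (incl x y) =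
      summand (u.equiv.symm ⁻¹' D.left S T) ((M.obj.map (D.partl u)).hom x)
        ((N.obj.map (D.partr u)).hom y) :=
  ConcreteCategory.congr_hom (convUnitApp_map M.obj N.obj S T X u _ rfl (D.partl u) (fun _ => rfl)
    (D.partr u) (fun _ => rfl)) (x ⊗ₜ[ℂ] y)

theorem summand_eq {M N : ModD n} {X : D n} (A : Set X.carrier)
    (x : M.obj.obj (X.sub A)) (y : N.obj.obj (X.sub Aᶜ)) :
    summand A x y = ((M ⊗ N).obj.map (D.glue X A).hom).hom (incl x y) :=
  (ConcreteCategory.congr_hom (convUnitApp_glue M.obj N.obj X A) (x ⊗ₜ[ℂ] y)).symm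

/-- Linear maps on `(M ⊗ N)(X)` agree if they agree on the generators. -/
theorem tensor_linear_ext {M N : ModD n} {X : D n} {V : Type*} [AddCommGroup V] [Module ℂ V]
    {f g : (M ⊗ N).obj.obj X →ₗ[ℂ] V}
    (h : ∀ {S T : D n} (u : S ⊗ T ⟶ X) (x : M.obj.obj S) (y : N.obj.obj T),
      f (((M ⊗ N).obj.map u).hom (incl x y)) = g (((M ⊗ N).obj.map u).hom (incl x y))) :
    f = g := by
  -- The coproduct property only tests against spaces in the universe of `Vect`, while `V` is
  -- arbitrary. The quotient by `ker (f - g)` lies in that universe, so its projection is compared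
  -- with zero.
  have key : ∀ z : (M ⊗ N).obj.obj X, z ∈ LinearMap.ker (f - g) := by
    have := conv_hom_ext M.obj N.obj X
      (f := ModuleCat.ofHom (LinearMap.ker (f - g)).mkQ) (g := 0) fun A => by
        refine ModuleCat.hom_ext (TensorProduct.ext' fun x y => ?_)
        refine (Submodule.Quotient.mk_eq_zero _).2 ?_
        rw [LinearMap.mem_ker, LinearMap.sub_apply, sub_eq_zero]
        have := h (D.glue X A).hom x y
        rwa [← summand_eq] at this
    intro z
    exact (Submodule.Quotient.mk_eq_zero _).1 (ConcreteCategory.congr_hom this z)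
  ext z
  exact sub_eq_zero.1 (key z)

end Elements

/-! ### External product of functionals on `M(S)` and `N(T)`. -/

section Pairing

open scoped TensorProduct

/-- Subsets which are equal. -/
def D.subCongr (X : D n) {A B : Set X.carrier} (h : A = B) : X.sub A ≅ X.sub B :=
  D.mkIso (Equiv.setCongr h) fun _ => rfl

open scoped Classical in
/-- The functional on `(M ⊗ N)(S ⊔ T)` given by functionals on `M(S)` and `N(T)`. It vanishes on
the summands which are not indexed by `S`. -/
noncomputable def pair {M N : ModD n} {S T : D n} (φ : Module.Dual ℂ (M.obj.obj S))
    (ψ : Module.Dual ℂ (N.obj.obj T)) : Module.Dual ℂ ((M ⊗ N).obj.obj (S ⊗ T)) :=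
  (convDesc M.obj N.obj (S ⊗ T) (V := ModuleCat.of ℂ ℂ) fun A => ModuleCat.ofHom <|
    if h : A = D.left S T then
      LinearMap.mul' ℂ ℂ ∘ₗ TensorProduct.map
        (φ ∘ₗ (M.obj.map ((D.subCongr (S ⊗ T) h).hom ≫ (D.inlIso S T).inv)).hom)
        (ψ ∘ₗ (N.obj.map ((D.subCongr (S ⊗ T) (congrArg compl h)).hom ≫ (D.inrIso S T).inv)).hom)
    else 0).hom

open scoped Classical in
theorem pair_summand {M N : ModD n} {S T : D n} (φ : Module.Dual ℂ (M.obj.obj S))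
    (ψ : Module.Dual ℂ (N.obj.obj T)) (A : Set (S ⊗ T : D n).carrier)
    (x : M.obj.obj ((S ⊗ T).sub A)) (y : N.obj.obj ((S ⊗ T).sub Aᶜ)) :
    pair φ ψ (summand A x y) = if h : A = D.left S T then
      φ ((M.obj.map ((D.subCongr (S ⊗ T) h).hom ≫ (D.inlIso S T).inv)).hom x) *
      ψ ((N.obj.map ((D.subCongr (S ⊗ T) (congrArg compl h)).hom ≫ (D.inrIso S T).inv)).hom y)
    else 0 := by
  refine (ConcreteCategory.congr_hom (convι_desc M.obj N.obj (S ⊗ T) (V := ModuleCat.of ℂ ℂ) _ A)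
    (x ⊗ₜ[ℂ] y)).trans ?_
  split_ifs with h
  · rfl
  · rfl

theorem map_map {J : Type*} [Category* J] {M : J ⥤ Vect} {S T W : J} (f : S ⟶ T) (g : T ⟶ W) (x : M.obj S) :
    (M.map g).hom ((M.map f).hom x) = (M.map (f ≫ g)).hom x :=
  (ConcreteCategory.congr_hom (M.map_comp f g) x).symm

/-- With `pair_map_eq_zero`, this is the working description of `pair`, free of summands: a morphism
from `S' ⊔ T'` to `S ⊔ T` either splits into two morphisms, and the pairing is a product, or it does
not, and the pairing vanishes. -/
theorem pair_map_tensorHom {M N : ModD n} {S T S' T' : D n} (φ : Module.Dual ℂ (M.obj.obj S))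
    (ψ : Module.Dual ℂ (N.obj.obj T)) (f : S' ⟶ S) (g : T' ⟶ T) (x : M.obj.obj S')
    (y : N.obj.obj T') :
    pair φ ψ (((M ⊗ N).obj.map (f ⊗ₘ g)).hom (incl x y)) =
      φ ((M.obj.map f).hom x) * ψ ((N.obj.map g).hom y) := by
  have h : (f ⊗ₘ g : S' ⊗ T' ⟶ S ⊗ T).equiv.symm ⁻¹' D.left S' T' = D.left S T := by
    ext (_ | _)
    · exact Iff.rfl
    · exact Iff.rfl
  rw [map_incl, pair_summand, dif_pos h, map_map, map_map]
  rfl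

/-- The element lies in the summand indexed by the image of `S'`. If that image were `S`, the
restrictions of `u` to `S'` and `T'` would split it. -/
theorem pair_map_eq_zero {M N : ModD n} {S T S' T' : D n} (φ : Module.Dual ℂ (M.obj.obj S))
    (ψ : Module.Dual ℂ (N.obj.obj T)) (u : S' ⊗ T' ⟶ S ⊗ T)
    (h : ¬ ∃ (f : S' ⟶ S) (g : T' ⟶ T), u = f ⊗ₘ g) (x : M.obj.obj S') (y : N.obj.obj T') :
    pair φ ψ (((M ⊗ N).obj.map u).hom (incl x y)) = 0 := by
  rw [map_incl, pair_summand, dif_neg]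
  intro hA
  refine h ⟨D.partl u ≫ (D.subCongr (S ⊗ T) hA).hom ≫ (D.inlIso S T).inv,
    D.partr u ≫ (D.subCongr (S ⊗ T) (congrArg compl hA)).hom ≫ (D.inrIso S T).inv,
    D.hom_ext ?_⟩
  rintro (s | t)
  · exact (congrArg Subtype.val ((D.inlIso S T).hom.equiv.apply_symm_apply
      ((D.partl u ≫ (D.subCongr (S ⊗ T) hA).hom).equiv s))).symm
  · exact (congrArg Subtype.val ((D.inrIso S T).hom.equiv.apply_symm_apply
      ((D.partr u ≫ (D.subCongr (S ⊗ T) (congrArg compl hA)).hom).equiv t))).symm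

end Pairing

/-! ### Characterisation, bilinearity and coherence of the pairing. -/

section Pairing

/-- A test on elements, which passes easily through composition with a split morphism. -/
theorem D.exists_tensorHom_iff {S T S' T' : D n} (u : S' ⊗ T' ⟶ S ⊗ T) :
    (∃ (f : S' ⟶ S) (g : T' ⟶ T), u = f ⊗ₘ g) ↔
      ∀ x, Sum.isLeft (u.equiv x) = Sum.isLeft x := by
  constructor
  · rintro ⟨f, g, rfl⟩ (_ | _) <;> rfl
  · intro h
    have hA : u.equiv.symm ⁻¹' D.left S' T' = D.left S T := by
      ext x
      obtain ⟨y, rfl⟩ := u.equiv.surjective x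
      rw [Set.mem_preimage, Equiv.symm_apply_apply]
      exact iff_of_eq (congrArg (· = true) (h y)).symm
    refine ⟨D.partl u ≫ (D.subCongr (S ⊗ T) hA).hom ≫ (D.inlIso S T).inv,
      D.partr u ≫ (D.subCongr (S ⊗ T) (congrArg compl hA)).hom ≫ (D.inrIso S T).inv,
      D.hom_ext ?_⟩
    rintro (s | t)
    · exact (congrArg Subtype.val ((D.inlIso S T).hom.equiv.apply_symm_apply
        ((D.partl u ≫ (D.subCongr (S ⊗ T) hA).hom).equiv s))).symm
    · exact (congrArg Subtype.val ((D.inrIso S T).hom.equiv.apply_symm_apply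
        ((D.partr u ≫ (D.subCongr (S ⊗ T) (congrArg compl hA)).hom).equiv t))).symm

variable {M N P : ModD n} {S T : D n}

/-- The elements `(M ⊗ N)(u)(x ⊗ y)` span, so the two cases, `u` split or not, determine a
functional. Bilinearity and naturality of `pair` are all read off from this. -/
theorem eq_pair {φ : Module.Dual ℂ (M.obj.obj S)} {ψ : Module.Dual ℂ (N.obj.obj T)}
    {ℓ : Module.Dual ℂ ((M ⊗ N).obj.obj (S ⊗ T))}
    (h : ∀ {S' T' : D n} (f : S' ⟶ S) (g : T' ⟶ T) (x : M.obj.obj S') (y : N.obj.obj T'),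
      ℓ (((M ⊗ N).obj.map (f ⊗ₘ g)).hom (incl x y)) =
        φ ((M.obj.map f).hom x) * ψ ((N.obj.map g).hom y))
    (h' : ∀ {S' T' : D n} (u : S' ⊗ T' ⟶ S ⊗ T), (¬ ∃ (f : S' ⟶ S) (g : T' ⟶ T), u = f ⊗ₘ g) →
      ∀ (x : M.obj.obj S') (y : N.obj.obj T'),
        ℓ (((M ⊗ N).obj.map u).hom (incl x y)) = 0) : ℓ = pair φ ψ := by
  refine tensor_linear_ext fun {S' T'} u x y => ?_
  by_cases hu : ∃ (f : S' ⟶ S) (g : T' ⟶ T), u = f ⊗ₘ g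
  · obtain ⟨f, g, rfl⟩ := hu
    rw [h, pair_map_tensorHom]
  · rw [h' u hu, pair_map_eq_zero φ ψ u hu]

theorem pair_add_left (φ φ' : Module.Dual ℂ (M.obj.obj S)) (ψ : Module.Dual ℂ (N.obj.obj T)) :
    pair (φ + φ') ψ = pair φ ψ + pair φ' ψ := by
  refine (eq_pair (fun f g x y => ?_) fun u hu x y => ?_).symm
  · simp only [LinearMap.add_apply, pair_map_tensorHom, add_mul]
  · simp only [LinearMap.add_apply, pair_map_eq_zero _ _ u hu, add_zero]

theorem pair_smul_left (c : ℂ) (φ : Module.Dual ℂ (M.obj.obj S))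
    (ψ : Module.Dual ℂ (N.obj.obj T)) : pair (c • φ) ψ = c • pair φ ψ := by
  refine (eq_pair (fun f g x y => ?_) fun u hu x y => ?_).symm
  · simp only [LinearMap.smul_apply, pair_map_tensorHom, smul_eq_mul, mul_assoc]
  · simp only [LinearMap.smul_apply, pair_map_eq_zero _ _ u hu, smul_zero]

theorem pair_add_right (φ : Module.Dual ℂ (M.obj.obj S)) (ψ ψ' : Module.Dual ℂ (N.obj.obj T)) :
    pair φ (ψ + ψ') = pair φ ψ + pair φ ψ' := by
  refine (eq_pair (fun f g x y => ?_) fun u hu x y => ?_).symm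
  · simp only [LinearMap.add_apply, pair_map_tensorHom, mul_add]
  · simp only [LinearMap.add_apply, pair_map_eq_zero _ _ u hu, add_zero]

theorem pair_smul_right (c : ℂ) (φ : Module.Dual ℂ (M.obj.obj S))
    (ψ : Module.Dual ℂ (N.obj.obj T)) : pair φ (c • ψ) = c • pair φ ψ := by
  refine (eq_pair (fun f g x y => ?_) fun u hu x y => ?_).symm
  · simp only [LinearMap.smul_apply, pair_map_tensorHom, smul_eq_mul]; ring
  · simp only [LinearMap.smul_apply, pair_map_eq_zero _ _ u hu, smul_zero]

/-- `pair` as a bilinear map. -/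
noncomputable def pairₗ (M N : ModD n) (S T : D n) : Module.Dual ℂ (M.obj.obj S) →ₗ[ℂ]
    Module.Dual ℂ (N.obj.obj T) →ₗ[ℂ] Module.Dual ℂ ((M ⊗ N).obj.obj (S ⊗ T)) :=
  LinearMap.mk₂ ℂ pair pair_add_left pair_smul_left pair_add_right pair_smul_right

theorem pair_comp_map {S' T' : D n} (φ : Module.Dual ℂ (M.obj.obj S))
    (ψ : Module.Dual ℂ (N.obj.obj T)) (f : S' ⟶ S) (g : T' ⟶ T) :
    pair φ ψ ∘ₗ ((M ⊗ N).obj.map (f ⊗ₘ g)).hom =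
      pair (φ ∘ₗ (M.obj.map f).hom) (ψ ∘ₗ (N.obj.map g).hom) := by
  refine eq_pair (fun f' g' x y => ?_) fun u hu x y => ?_
  · rw [LinearMap.comp_apply, map_map, tensorHom_comp_tensorHom, pair_map_tensorHom,
      LinearMap.comp_apply, LinearMap.comp_apply, map_map, map_map]
  · rw [LinearMap.comp_apply, map_map]
    -- The morphism `f ⊗ₘ g` keeps the two sides apart, so if the composite splits then so does `u`.
    refine pair_map_eq_zero _ _ _ (fun h => hu ?_) _ _
    rw [D.exists_tensorHom_iff] at h ⊢
    intro x
    refine Eq.trans ?_ (h x)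
    change _ = Sum.isLeft ((f ⊗ₘ g : S' ⊗ T' ⟶ S ⊗ T).equiv (u.equiv x))
    generalize u.equiv x = y
    revert y
    rintro (_ | _) <;> rfl

theorem naturality_apply {M N : ModD n} (f : M ⟶ N) {S T : D n} (u : S ⟶ T) (x : M.obj.obj S) :
    (f.hom.app T).hom ((M.obj.map u).hom x) = (N.obj.map u).hom ((f.hom.app S).hom x) :=
  ConcreteCategory.congr_hom (f.hom.naturality u) x

theorem pair_comp_tensorHom {M' N' : ModD n} (φ : Module.Dual ℂ (M'.obj.obj S))
    (ψ : Module.Dual ℂ (N'.obj.obj T)) (f : M ⟶ M') (g : N ⟶ N') :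
    pair φ ψ ∘ₗ ((f ⊗ₘ g).hom.app (S ⊗ T)).hom =
      pair (φ ∘ₗ (f.hom.app S).hom) (ψ ∘ₗ (g.hom.app T).hom) := by
  refine eq_pair (fun f' g' x y => ?_) fun u hu x y => ?_
  · rw [LinearMap.comp_apply, naturality_apply, tensorHom_incl, pair_map_tensorHom,
      LinearMap.comp_apply, LinearMap.comp_apply, naturality_apply, naturality_apply]
  · rw [LinearMap.comp_apply, naturality_apply, tensorHom_incl, pair_map_eq_zero _ _ u hu]

theorem incl_map_left {S' : D n} (f : S' ⟶ S) (x : M.obj.obj S') (y : N.obj.obj T) :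
    incl ((M.obj.map f).hom x) y = ((M ⊗ N).obj.map (f ▷ T)).hom (incl x y) := by
  have h := incl_map (M := M) (N := N) f (𝟙 T) x y
  rw [N.obj.map_id, tensorHom_id] at h
  exact h

/-- The generators are applied twice; the morphism appearing in the first factor is absorbed into
`u` by `incl_map_left`. -/
theorem tensor_linear_ext₃ {X : D n} {V : Type*} [AddCommGroup V] [Module ℂ V]
    {f g : ((M ⊗ N) ⊗ P).obj.obj X →ₗ[ℂ] V}
    (h : ∀ {S T W : D n} (u : (S ⊗ T) ⊗ W ⟶ X) (x : M.obj.obj S) (y : N.obj.obj T)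
      (z : P.obj.obj W), f ((((M ⊗ N) ⊗ P).obj.map u).hom (incl (incl x y) z)) =
        g ((((M ⊗ N) ⊗ P).obj.map u).hom (incl (incl x y) z))) :
    f = g := by
  refine tensor_linear_ext fun {S T} u w z => ?_
  have key : f ∘ₗ (((M ⊗ N) ⊗ P).obj.map u).hom ∘ₗ (inc (M ⊗ N) P S T).hom ∘ₗ
        (TensorProduct.mk ℂ _ _).flip z =
      g ∘ₗ (((M ⊗ N) ⊗ P).obj.map u).hom ∘ₗ (inc (M ⊗ N) P S T).hom ∘ₗ
        (TensorProduct.mk ℂ _ _).flip z := by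
    refine tensor_linear_ext fun v x y => ?_
    change f ((((M ⊗ N) ⊗ P).obj.map u).hom (incl (((M ⊗ N).obj.map v).hom (incl x y)) z)) =
      g ((((M ⊗ N) ⊗ P).obj.map u).hom (incl (((M ⊗ N).obj.map v).hom (incl x y)) z))
    rw [incl_map_left, map_map]
    exact h _ x y z
  exact LinearMap.congr_fun key w

theorem pair_associator {W : D n} (φ : Module.Dual ℂ (M.obj.obj S))
    (ψ : Module.Dual ℂ (N.obj.obj T)) (χ : Module.Dual ℂ (P.obj.obj W)) :
    pair φ (pair ψ χ) ∘ₗ ((α_ M N P).hom.hom.app (S ⊗ T ⊗ W)).hom =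
      pair (pair φ ψ) χ ∘ₗ (((M ⊗ N) ⊗ P).obj.map (α_ S T W).inv).hom := by
  refine tensor_linear_ext₃ fun {S' T' W'} u x y z => ?_
  rw [LinearMap.comp_apply, LinearMap.comp_apply, naturality_apply, associator_incl, map_map,
    map_map]
  by_cases h : ∃ (f : S' ⟶ S) (g : T' ⟶ T) (k : W' ⟶ W), (α_ _ _ _).inv ≫ u = f ⊗ₘ (g ⊗ₘ k)
  · obtain ⟨f, g, k, h⟩ := h
    have h' : u ≫ (α_ _ _ _).inv = (f ⊗ₘ g) ⊗ₘ k := by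
      rw [Iso.inv_comp_eq] at h
      rw [h, Category.assoc, associator_inv_naturality, Iso.hom_inv_id_assoc]
    rw [h, h', pair_map_tensorHom, pair_map_tensorHom, pair_map_tensorHom, pair_map_tensorHom,
      mul_assoc]
  -- If `u` does not split into three pieces, both sides vanish: either the outer pairing is zero,
  -- or `u` splits into two pieces one of which does not split further, and the inner pairing is
  -- zero.
  · trans 0
    · by_cases h1 : ∃ (f : S' ⟶ S) (g : T' ⊗ W' ⟶ T ⊗ W), (α_ _ _ _).inv ≫ u = f ⊗ₘ g
      · obtain ⟨f, g, h1⟩ := h1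
        rw [h1, pair_map_tensorHom, pair_map_eq_zero, mul_zero]
        rintro ⟨g, k, rfl⟩
        exact h ⟨f, g, k, h1⟩
      · exact pair_map_eq_zero _ _ _ h1 _ _
    · symm
      by_cases h1 : ∃ (f : S' ⊗ T' ⟶ S ⊗ T) (g : W' ⟶ W), u ≫ (α_ _ _ _).inv = f ⊗ₘ g
      · obtain ⟨f, k, h1⟩ := h1
        rw [h1, pair_map_tensorHom, pair_map_eq_zero, zero_mul]
        rintro ⟨f, g, rfl⟩
        refine h ⟨f, g, k, ?_⟩
        rw [Iso.inv_comp_eq, ← associator_naturality, ← h1, Category.assoc, Iso.inv_hom_id,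
          Category.comp_id]
      · exact pair_map_eq_zero _ _ _ h1 _ _

theorem pair_braiding (φ : Module.Dual ℂ (M.obj.obj S)) (ψ : Module.Dual ℂ (N.obj.obj T)) :
    pair ψ φ ∘ₗ ((β_ M N).hom.hom.app (T ⊗ S)).hom =
      pair φ ψ ∘ₗ ((M ⊗ N).obj.map (β_ T S).hom).hom := by
  refine tensor_linear_ext fun {S' T'} u x y => ?_
  rw [LinearMap.comp_apply, LinearMap.comp_apply, naturality_apply, braiding_incl, map_map,
    map_map]
  by_cases h : ∃ (f : S' ⟶ S) (g : T' ⟶ T), u ≫ (β_ _ _).hom = f ⊗ₘ g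
  · obtain ⟨f, g, h⟩ := h
    have h' : (β_ T' S').hom ≫ u = g ⊗ₘ f := by
      rw [← cancel_mono (β_ T S).hom, Category.assoc, h, BraidedCategory.braiding_naturality]
    rw [h, h', pair_map_tensorHom, pair_map_tensorHom, mul_comm]
  · rw [pair_map_eq_zero _ _ _ h, pair_map_eq_zero]
    rintro ⟨g, f, h'⟩
    refine h ⟨f, g, ?_⟩
    rw [← cancel_epi (β_ T' S').hom, reassoc_of% h', BraidedCategory.braiding_naturality]

theorem unit_linear_ext {X : D n} {V : Type*} [AddCommGroup V] [Module ℂ V]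
    {f g : (𝟙_ (ModD n)).obj.obj X →ₗ[ℂ] V}
    (h : ∀ u : 𝟙_ (D n) ⟶ X, f (((𝟙_ (ModD n)).obj.map u).hom unitElt) =
      g (((𝟙_ (ModD n)).obj.map u).hom unitElt)) : f = g := by
  have key : ∀ z : (𝟙_ (ModD n)).obj.obj X, z ∈ LinearMap.ker (f - g) := by
    have := unitObj_hom_ext X (V := ModuleCat.of ℂ (_ ⧸ LinearMap.ker (f - g)))
      (f := ModuleCat.ofHom (LinearMap.ker (f - g)).mkQ) (g := 0) fun u => by
        refine ModuleCat.hom_ext (LinearMap.ext_ring ?_)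
        refine (Submodule.Quotient.mk_eq_zero _).2 ?_
        have h1 : ((𝟙_ (ModD n)).obj.map u).hom unitElt = (unitι u).hom (1 : ℂ) :=
          ConcreteCategory.congr_hom (unitι_id_map u) (1 : ℂ)
        have := h u
        rw [h1] at this
        exact LinearMap.mem_ker.2 (sub_eq_zero.2 this)
    intro z
    exact (Submodule.Quotient.mk_eq_zero _).1 (ConcreteCategory.congr_hom this z)
  ext z
  exact sub_eq_zero.1 (key z)

variable (n) in
/-- The canonical functional on `1(∅)`. -/
noncomputable def unitFun : Module.Dual ℂ ((𝟙_ (ModD n)).obj.obj (𝟙_ (D n))) :=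
  (unitDesc (𝟙_ (D n)) (V := ModuleCat.of ℂ ℂ) fun _ => 𝟙 _).hom

theorem unitFun_map (u : 𝟙_ (D n) ⟶ 𝟙_ (D n)) :
    unitFun n (((𝟙_ (ModD n)).obj.map u).hom unitElt) = 1 := by
  have h1 : ((𝟙_ (ModD n)).obj.map u).hom unitElt = (unitι u).hom (1 : ℂ) :=
    ConcreteCategory.congr_hom (unitι_id_map u) (1 : ℂ)
  rw [h1]
  exact ConcreteCategory.congr_hom (unitι_desc (𝟙_ (D n)) (V := ModuleCat.of ℂ ℂ)
    (fun _ => 𝟙 _) u) (1 : ℂ)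

theorem pair_leftUnitor (φ : Module.Dual ℂ (M.obj.obj S)) :
    φ ∘ₗ ((λ_ M).hom.hom.app S).hom =
      pair (unitFun n) φ ∘ₗ ((𝟙_ (ModD n) ⊗ M).obj.map (λ_ S).inv).hom := by
  refine tensor_linear_ext fun {S' T'} u a x => ?_
  have key : φ ∘ₗ ((λ_ M).hom.hom.app S).hom ∘ₗ ((𝟙_ (ModD n) ⊗ M).obj.map u).hom ∘ₗ
        (inc _ M S' T').hom ∘ₗ (TensorProduct.mk ℂ _ _).flip x =
      pair (unitFun n) φ ∘ₗ ((𝟙_ (ModD n) ⊗ M).obj.map (λ_ S).inv).hom ∘ₗ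
        ((𝟙_ (ModD n) ⊗ M).obj.map u).hom ∘ₗ
        (inc _ M S' T').hom ∘ₗ (TensorProduct.mk ℂ _ _).flip x := by
    refine unit_linear_ext fun v => ?_
    change φ (((λ_ M).hom.hom.app S).hom (((𝟙_ (ModD n) ⊗ M).obj.map u).hom
      (incl (((𝟙_ (ModD n)).obj.map v).hom unitElt) x))) = pair (unitFun n) φ
        (((𝟙_ (ModD n) ⊗ M).obj.map (λ_ S).inv).hom (((𝟙_ (ModD n) ⊗ M).obj.map u).hom
      (incl (((𝟙_ (ModD n)).obj.map v).hom unitElt) x)))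
    rw [incl_map_left, map_map, map_map, naturality_apply, leftUnitor_incl, map_map]
    -- A morphism from `∅ ⊔ T'` to `∅ ⊔ S` always splits, so the vanishing case of `pair` does not
    -- occur.
    have h : (v ▷ T' ≫ u) ≫ (λ_ S).inv = 𝟙 _ ⊗ₘ ((λ_ _).inv ≫ v ▷ T' ≫ u) := by
      rw [id_tensorHom, ← cancel_mono (λ_ S).hom, leftUnitor_naturality, Category.assoc,
        Iso.inv_hom_id, Category.comp_id, Iso.hom_inv_id_assoc]
    rw [h, pair_map_tensorHom, unitFun_map, one_mul]
  exact LinearMap.congr_fun key a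

end Pairing

/-! ### Decompositions of weighted sets in `U n`. -/

section Sub

/-- The subset `A` of `X`, with the induced weights. -/
def U.sub (X : U n) (A : Set X.carrier) : U n := ⟨(X.toD.sub A).toWSet⟩

open scoped Classical in
/-- The isomorphism `A ⊔ Aᶜ ≅ X`. -/
noncomputable def U.glue (X : U n) (A : Set X.carrier) : X.sub A ⊗ X.sub Aᶜ ≅ X :=
  U.mkIso (Equiv.Set.sumCompl A) (by rintro (_ | _) <;> rfl)

/-- The restriction of a morphism to the preimage of a subset. -/
def U.subMap {X Y : U n} (f : X ⟶ Y) (B : Set Y.carrier) :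
    X.sub (f.equiv ⁻¹' B) ⟶ Y.sub B :=
  ⟨f.equiv.subtypeEquiv fun _ => Iff.rfl, fun a => f.weight_le a.1⟩

/-- The restriction of a morphism to the complement of the preimage of a subset. -/
def U.subMapCompl {X Y : U n} (f : X ⟶ Y) (B : Set Y.carrier) :
    X.sub (f.equiv ⁻¹' B)ᶜ ⟶ Y.sub Bᶜ :=
  ⟨f.equiv.subtypeEquiv fun _ => Iff.rfl, fun a => f.weight_le a.1⟩

theorem U.subMap_glue {X Y : U n} (f : X ⟶ Y) (B : Set Y.carrier) :
    (U.subMap f B ⊗ₘ U.subMapCompl f B) ≫ (Y.glue B).hom = (X.glue (f.equiv ⁻¹' B)).hom ≫ f :=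
  U.hom_ext (by rintro (_ | _) <;> rfl)

/-- The canonical identification of `S` with a subset of `S ⊔ T`. -/
def U.inlIso (S T : U n) : S ≅ (S ⊗ T).sub (D.left S.toD T.toD) :=
  U.mkIso (D.inlIso S.toD T.toD).hom.equiv fun _ => rfl

/-- The canonical identification of `T` with the complement of `S` in `S ⊔ T`. -/
def U.inrIso (S T : U n) : T ≅ (S ⊗ T).sub (D.left S.toD T.toD)ᶜ :=
  U.mkIso (D.inrIso S.toD T.toD).hom.equiv fun _ => rfl

theorem U.inl_inr_glue (S T : U n) :
    ((U.inlIso S T).hom ⊗ₘ (U.inrIso S T).hom) ≫ ((S ⊗ T).glue (D.left S.toD T.toD)).hom = 𝟙 _ :=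
  U.hom_ext (by rintro (_ | _) <;> rfl)

end Sub

/-! ### The dual of a tensor product, decomposed over subsets. -/

section DualPair

open scoped TensorProduct

instance (M : ModD n) (X : D n) : Module.Finite ℂ (M.obj.obj X) := M.property.1 X

variable {M N P : ModD n}

/-- The element of `(M ⊗ N)^∨(S ⊔ T)` given by elements of `M^∨(S)` and `N^∨(T)`. -/
noncomputable def dualPair (M N : ModD n) (S T : U n) :
    (dual M).obj S →ₗ[ℂ] (dual N).obj T →ₗ[ℂ] (dual (M ⊗ N)).obj (S ⊗ T) :=
  pairₗ M N S.toD T.toD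

theorem dualPair_map {S T S' T' : U n} (f : S ⟶ S') (g : T ⟶ T') (φ : (dual M).obj S)
    (ψ : (dual N).obj T) : dualPair M N S' T' (((dual M).map f).hom φ) (((dual N).map g).hom ψ) =
      ((dual (M ⊗ N)).map (f ⊗ₘ g)).hom (dualPair M N S T φ ψ) := by
  refine (pair_comp_map (S' := S'.toD) (T' := T'.toD) φ ψ (U.invD f) (U.invD g)).symm.trans ?_
  rw [← U.invD_tensorHom]
  rfl

/-- The map `M^∨(S) ⊗ N^∨(T) ⟶ (M(S) ⊗ N(T))^*`. -/
noncomputable def distrib (M N : ModD n) (S T : U n) :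
    (dual M).obj S ⊗[ℂ] (dual N).obj T →ₗ[ℂ]
      Module.Dual ℂ (M.obj.obj S.toD ⊗[ℂ] N.obj.obj T.toD) :=
  TensorProduct.dualDistrib ℂ (M.obj.obj S.toD) (N.obj.obj T.toD)

/-- The restriction of a functional on `(M ⊗ N)(S)` to the summand indexed by a subset, as an
element of a tensor product of dual spaces. -/
noncomputable def dualCoeff (M N : ModD n) (S : U n) (A : Set S.carrier) :
    (dual (M ⊗ N)).obj S →ₗ[ℂ] (dual M).obj (S.sub A) ⊗[ℂ] (dual N).obj (S.sub Aᶜ) :=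
  (TensorProduct.dualDistribEquiv ℂ (M.obj.obj (S.sub A).toD)
      (N.obj.obj (S.sub Aᶜ).toD)).symm.toLinearMap ∘ₗ
    (convι M.obj N.obj S.toD A).hom.dualMap

/-- This formula and `dualCoeff_eq` characterise `dualCoeff`. They rest on the isomorphism of `V^* ⊗
W^*` with `(V ⊗ W)^*`, which needs the values of modules to be finite dimensional. -/
theorem dualDistrib_dualCoeff (S : U n) (A : Set S.carrier)
    (ℓ : Module.Dual ℂ ((M ⊗ N).obj.obj S.toD)) (x : M.obj.obj (S.toD.sub A))
    (y : N.obj.obj (S.toD.sub Aᶜ)) :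
    distrib M N (S.sub A) (S.sub Aᶜ) (dualCoeff M N S A ℓ) (x ⊗ₜ y) = ℓ (summand A x y) := by
  have := (TensorProduct.dualDistribEquiv ℂ (M.obj.obj (S.toD.sub A))
    (N.obj.obj (S.toD.sub Aᶜ))).apply_symm_apply ((convι M.obj N.obj S.toD A).hom.dualMap ℓ)
  exact LinearMap.congr_fun this (x ⊗ₜ y)

theorem dualCoeff_eq {S : U n} {A : Set S.carrier}
    {ℓ : Module.Dual ℂ ((M ⊗ N).obj.obj S.toD)}
    {ω : (dual M).obj (S.sub A) ⊗[ℂ] (dual N).obj (S.sub Aᶜ)}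
    (h : ∀ (x : M.obj.obj (S.toD.sub A)) (y : N.obj.obj (S.toD.sub Aᶜ)),
      distrib M N (S.sub A) (S.sub Aᶜ) ω (x ⊗ₜ y) = ℓ (summand A x y)) : dualCoeff M N S A ℓ = ω := by
  refine (TensorProduct.dualDistribEquiv ℂ (M.obj.obj (S.toD.sub A))
    (N.obj.obj (S.toD.sub Aᶜ))).injective (TensorProduct.ext' fun x y => ?_)
  exact (dualDistrib_dualCoeff S A ℓ x y).trans (h x y).symm

theorem summand_map {X Y : D n} (f : X ⟶ Y) (A : Set X.carrier) (x : M.obj.obj (X.sub A))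
    (y : N.obj.obj (X.sub Aᶜ)) : ((M ⊗ N).obj.map f).hom (summand A x y) =
      summand (f.equiv.symm ⁻¹' A) ((M.obj.map (D.subMap f A)).hom x)
        ((N.obj.map (D.subMapCompl f A)).hom y) :=
  ConcreteCategory.congr_hom (convι_map M.obj N.obj f A) (x ⊗ₜ[ℂ] y)

/-- A morphism of `U n` acts on duals through its inverse in `D n`, which sends the summand of `B`
to the summand of the preimage of `B`. -/
theorem dualCoeff_map {S T : U n} (f : S ⟶ T) (B : Set T.carrier)
    (ℓ : (dual (M ⊗ N)).obj S) : dualCoeff M N T B (((dual (M ⊗ N)).map f).hom ℓ) =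
      TensorProduct.map ((dual M).map (U.subMap f B)).hom ((dual N).map (U.subMapCompl f B)).hom
        (dualCoeff M N S (f.equiv ⁻¹' B) ℓ) := by
  refine dualCoeff_eq fun x y => ?_
  trans (show Module.Dual ℂ ((M ⊗ N).obj.obj S.toD) from ℓ)
    (((M ⊗ N).obj.map (U.invD f)).hom (summand B x y))
  · rw [summand_map]
    refine Eq.trans ?_ (dualDistrib_dualCoeff S (f.equiv ⁻¹' B) ℓ _ _)
    generalize dualCoeff M N S (f.equiv ⁻¹' B) ℓ = ω
    induction ω using TensorProduct.induction_on with
    | zero => simp only [map_zero, LinearMap.zero_apply]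
    | tmul a b => rfl
    | add a b ha hb =>
      simp only [map_add, LinearMap.add_apply]
      exact congrArg₂ (· + ·) ha hb
  · rfl

theorem summand_linear_ext {X : D n} {V : Type*} [AddCommGroup V] [Module ℂ V]
    {f g : (M ⊗ N).obj.obj X →ₗ[ℂ] V}
    (h : ∀ (A : Set X.carrier) x y, f (summand A x y) = g (summand A x y)) : f = g :=
  tensor_linear_ext fun u x y => by rw [map_incl, h]

/-- The subsets of a weighted set form a finite type. -/
noncomputable local instance (S : U n) : Fintype (Set S.carrier) := Fintype.ofFinite _

/-- The splitting forces `B` into `A` and the complement of `B` into that of `A`. It excludes the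
off-diagonal terms in `dual_decomp`. -/
theorem D.eq_of_glue {X : D n} {A B : Set X.carrier} {f : X.sub B ⟶ X.sub A}
    {g : X.sub Bᶜ ⟶ X.sub Aᶜ} (h : (D.glue X B).hom ≫ (D.glue X A).inv = f ⊗ₘ g) : A = B := by
  rw [Iso.comp_inv_eq] at h
  have h1 : ∀ b : B, b.1 = (f.equiv b).1 := fun b =>
    congrArg (fun k => k.equiv (Sum.inl b)) h
  have h2 : ∀ b : (Bᶜ : Set X.carrier), b.1 = (g.equiv b).1 := fun b =>
    congrArg (fun k => k.equiv (Sum.inr b)) h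
  ext x
  by_cases hx : x ∈ B
  · exact iff_of_true (by have := h1 ⟨x, hx⟩; simp only at this; rw [this]; exact (f.equiv _).2) hx
  · exact iff_of_false (by have := h2 ⟨x, hx⟩; simp only at this; rw [this]; exact (g.equiv _).2) hx

/-- A functional is determined by its restrictions to the summands. -/
theorem dual_decomp {S : U n} (ℓ : (dual (M ⊗ N)).obj S) :
    ℓ = ∑ A : Set S.carrier, ((dual (M ⊗ N)).map (S.glue A).hom).hom
      (TensorProduct.lift (dualPair M N (S.sub A) (S.sub Aᶜ)) (dualCoeff M N S A ℓ)) := by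
  refine summand_linear_ext (X := S.toD) fun B x y => ?_
  have h0 : ∀ A, (show Module.Dual ℂ ((M ⊗ N).obj.obj S.toD) from
      ((dual (M ⊗ N)).map (S.glue A).hom).hom
      (TensorProduct.lift (dualPair M N (S.sub A) (S.sub Aᶜ)) (dualCoeff M N S A ℓ)))
        (summand B x y) = (show Module.Dual ℂ ((M ⊗ N).obj.obj (S.sub A ⊗ S.sub Aᶜ).toD) from
      (TensorProduct.lift (dualPair M N (S.sub A) (S.sub Aᶜ)) (dualCoeff M N S A ℓ)))
        (((M ⊗ N).obj.map ((D.glue S.toD B).hom ≫ (D.glue S.toD A).inv)).hom (incl x y)) := by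
    intro A
    rw [summand_eq, ← map_map]
    rfl
  -- Off-diagonal terms: regluing from `B` to `A` does not split, so a pairing for the decomposition
  -- `A` vanishes on the summand of `B`.
  have h1 : ∀ A, A ≠ B → (show Module.Dual ℂ ((M ⊗ N).obj.obj S.toD) from
      ((dual (M ⊗ N)).map (S.glue A).hom).hom
      (TensorProduct.lift (dualPair M N (S.sub A) (S.sub Aᶜ)) (dualCoeff M N S A ℓ)))
        (summand B x y) = 0 := by
    intro A hA
    rw [h0]
    generalize dualCoeff M N S A ℓ = ω
    induction ω using TensorProduct.induction_on with
    | zero => rw [map_zero]; rfl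
    | tmul a b =>
      exact pair_map_eq_zero (S := S.toD.sub A) (T := S.toD.sub Aᶜ) a b _
        (fun ⟨f, g, h⟩ => hA (D.eq_of_glue h)) _ _
    | add a b ha hb =>
      rw [map_add]
      exact (congrArg₂ (· + ·) ha hb).trans (add_zero _)
  -- The diagonal term returns the restriction of `ℓ`, by the defining property of `dualCoeff`.
  have h2 : (show Module.Dual ℂ ((M ⊗ N).obj.obj S.toD) from
      ((dual (M ⊗ N)).map (S.glue B).hom).hom
      (TensorProduct.lift (dualPair M N (S.sub B) (S.sub Bᶜ)) (dualCoeff M N S B ℓ)))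
        (summand B x y) = (show Module.Dual ℂ ((M ⊗ N).obj.obj S.toD) from ℓ)
          (summand B x y) := by
    rw [h0, Iso.hom_inv_id, ← id_tensorHom_id]
    refine Eq.trans ?_ (dualDistrib_dualCoeff S B ℓ _ _)
    generalize dualCoeff M N S B ℓ = ω
    induction ω using TensorProduct.induction_on with
    | zero => simp only [map_zero]; rfl
    | tmul a b =>
      refine (pair_map_tensorHom (S := S.toD.sub B) (T := S.toD.sub Bᶜ) a b _ _ _ _).trans ?_
      rw [M.obj.map_id, N.obj.map_id]
      rfl
    | add a b ha hb =>
      rw [map_add, (distrib M N _ _).map_add, LinearMap.add_apply]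
      exact congrArg₂ (· + ·) ha hb
  refine Eq.trans ?_ (LinearMap.sum_apply (M := (M ⊗ N).obj.obj S.toD) (M₂ := ℂ) Finset.univ
    (fun A : Set S.carrier => show Module.Dual ℂ ((M ⊗ N).obj.obj S.toD) from
      ((dual (M ⊗ N)).map (S.glue A).hom).hom
      (TensorProduct.lift (dualPair M N (S.sub A) (S.sub Aᶜ)) (dualCoeff M N S A ℓ)))
      (summand B x y)).symm
  rw [Finset.sum_eq_single B (fun A _ hA => h1 A hA) (fun h => (h (Finset.mem_univ B)).elim)]
  exact h2.symm

/-- Submodules of `(M ⊗ N)^∨` which contain the pairings are everything. -/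
theorem mem_of_dualPair_mem (W : ∀ S : U n, Submodule ℂ ((dual (M ⊗ N)).obj S))
    (hmap : ∀ {S T : U n} (f : S ⟶ T) (x), x ∈ W S → ((dual (M ⊗ N)).map f).hom x ∈ W T)
    (hpair : ∀ S T φ ψ, dualPair M N S T φ ψ ∈ W (S ⊗ T)) {S : U n} (ℓ : (dual (M ⊗ N)).obj S) :
    ℓ ∈ W S := by
  rw [dual_decomp ℓ]
  refine Submodule.sum_mem _ fun A _ => hmap _ _ ?_
  generalize dualCoeff M N S A ℓ = ω
  induction ω using TensorProduct.induction_on with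
  | zero => rw [map_zero]; exact Submodule.zero_mem _
  | tmul a b => exact hpair _ _ a b
  | add a b ha hb => rw [map_add]; exact Submodule.add_mem _ ha hb

/-! ### Families on `(M ⊗ N)^∨` as bilinear families on `M^∨` and `N^∨`. -/

section Bifamily

variable {C : Type u} [Category.{v} C] [Preadditive C] [Linear ℂ C]

/-- A family of bilinear maps `M(S) × M'(T) ⟶ Hom(X, K(S, T))`, natural in `S` and `T`. -/
structure Bifamily (X : C) (M M' : U n ⥤ Vect) (K : U n ⥤ U n ⥤ C) where
  app (S T : U n) : M.obj S →ₗ[ℂ] M'.obj T →ₗ[ℂ] (X ⟶ (K.obj S).obj T)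
  naturality {S S' T T' : U n} (f : S ⟶ S') (g : T ⟶ T') (m : M.obj S) (m' : M'.obj T) :
    app S' T' ((M.map f).hom m) ((M'.map g).hom m') =
      app S T m m' ≫ (K.map f).app T ≫ (K.obj S').map g

variable (K : U n ⥤ C)

/-- The functor `(S, T) ↦ K(S ⊔ T)`. -/
abbrev unionBifunctor : U n ⥤ U n ⥤ C :=
  curriedTensor (U n) ⋙ (Functor.whiskeringRight _ _ _).obj K

variable {K} {X : C}

/-- The locus where two families agree is stable under morphisms of `U n`, and the pairings generate
`(M ⊗ N)^∨`. -/
theorem ToStructuredHom.tensor_ext {t t' : ToStructuredHom X (dual (M ⊗ N)) K}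
    (h : ∀ S T φ ψ, t.app (S ⊗ T) (dualPair M N S T φ ψ) =
      t'.app (S ⊗ T) (dualPair M N S T φ ψ)) : t = t' := by
  refine ToStructuredHom.ext (funext fun S => LinearMap.ext fun ℓ => ?_)
  refine mem_of_dualPair_mem (fun S => LinearMap.eqLocus (t.app S) (t'.app S)) ?_ h ℓ
  intro S T f x hx
  rw [LinearMap.mem_eqLocus] at hx ⊢
  rw [t.naturality, t'.naturality, hx]

theorem ToStructuredHom.tensor_ext₃ {t t' : ToStructuredHom X (dual (M ⊗ (N ⊗ P))) K}
    (h : ∀ S T W φ ψ χ, t.app (S ⊗ (T ⊗ W)) (dualPair M (N ⊗ P) S (T ⊗ W) φ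
        (dualPair N P T W ψ χ)) =
      t'.app (S ⊗ (T ⊗ W)) (dualPair M (N ⊗ P) S (T ⊗ W) φ (dualPair N P T W ψ χ))) : t = t' := by
  refine ToStructuredHom.tensor_ext fun S V φ ω => ?_
  refine mem_of_dualPair_mem (M := N) (N := P) (fun V => LinearMap.eqLocus
    (t.app (S ⊗ V) ∘ₗ dualPair M (N ⊗ P) S V φ) (t'.app (S ⊗ V) ∘ₗ dualPair M (N ⊗ P) S V φ))
    ?_ (fun T W ψ χ => h S T W φ ψ χ) ω
  intro V V' f x hx
  rw [LinearMap.mem_eqLocus] at hx ⊢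
  have := dualPair_map (M := M) (N := N ⊗ P) (𝟙 S) f φ x
  rw [(dual M).map_id] at this
  have h' : dualPair M (N ⊗ P) S V' φ (((dual (N ⊗ P)).map f).hom x) = _ := this
  rw [LinearMap.comp_apply, LinearMap.comp_apply] at hx ⊢
  rw [h', t.naturality, t'.naturality, hx]

theorem lift_naturality (b : Bifamily X (dual M) (dual N) (unionBifunctor K)) {S S' T T' : U n}
    (f : S ⟶ S') (g : T ⟶ T') (ω : (dual M).obj S ⊗[ℂ] (dual N).obj T) :
    TensorProduct.lift (b.app S' T')
        (TensorProduct.map ((dual M).map f).hom ((dual N).map g).hom ω) =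
      TensorProduct.lift (b.app S T) ω ≫ K.map (f ⊗ₘ g) := by
  induction ω using TensorProduct.induction_on with
  | zero => simp
  | tmul x y =>
    refine (b.naturality f g x y).trans ?_
    rw [MonoidalCategory.tensorHom_def, K.map_comp]
    rfl
  | add x y hx hy => rw [map_add, map_add, map_add, hx, hy, Preadditive.add_comp]

/-- The family on `(M ⊗ N)^∨` corresponding to a family on `M^∨` and `N^∨`. -/
noncomputable def Bifamily.union (b : Bifamily X (dual M) (dual N) (unionBifunctor K)) :
    ToStructuredHom X (dual (M ⊗ N)) K where
  app S := ∑ A : Set S.carrier, Linear.rightComp ℂ _ (K.map (S.glue A).hom) ∘ₗ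
    TensorProduct.lift (b.app (S.sub A) (S.sub Aᶜ)) ∘ₗ dualCoeff M N S A
  naturality {S T} f ℓ := by
    rw [LinearMap.sum_apply, LinearMap.sum_apply, Preadditive.sum_comp]
    refine Fintype.sum_bijective (fun B : Set T.carrier => f.equiv ⁻¹' B)
      ⟨f.equiv.surjective.preimage_injective, f.equiv.injective.preimage_surjective⟩ _ _
      fun B => ?_
    change TensorProduct.lift (b.app (T.sub B) (T.sub Bᶜ)) (dualCoeff M N T B _) ≫
      K.map (T.glue B).hom = (TensorProduct.lift (b.app _ _) (dualCoeff M N S _ ℓ) ≫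
        K.map (S.glue _).hom) ≫ K.map f
    rw [dualCoeff_map, lift_naturality, Category.assoc, Category.assoc, ← K.map_comp,
      ← K.map_comp, U.subMap_glue]

/-- Only the subset `S` of `S ⊔ T` contributes to the sum, since the other coefficients of a pairing
vanish. With `ToStructuredHom.tensor_ext`, this shows that `(M ⊗ N)^∨` is the Day convolution of
`M^∨` and `N^∨`. -/
theorem Bifamily.union_pair (b : Bifamily X (dual M) (dual N) (unionBifunctor K)) (S T : U n)
    (φ : (dual M).obj S) (ψ : (dual N).obj T) :
    b.union.app (S ⊗ T) (dualPair M N S T φ ψ) = b.app S T φ ψ := by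
  change (∑ A : Set (S ⊗ T).carrier, Linear.rightComp ℂ _ (K.map ((S ⊗ T).glue A).hom) ∘ₗ
    TensorProduct.lift (b.app ((S ⊗ T).sub A) ((S ⊗ T).sub Aᶜ)) ∘ₗ dualCoeff M N (S ⊗ T) A)
      (dualPair M N S T φ ψ) = _
  rw [LinearMap.sum_apply]
  refine (Finset.sum_eq_single (D.left S.toD T.toD) ?_ ?_).trans ?_
  rotate_left 2
  · change TensorProduct.lift (b.app _ _) (dualCoeff M N (S ⊗ T) _ _) ≫ K.map _ = _
    have h : dualCoeff M N (S ⊗ T) (D.left S.toD T.toD) (dualPair M N S T φ ψ) =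
        TensorProduct.map ((dual M).map (U.inlIso S T).hom).hom
          ((dual N).map (U.inrIso S T).hom).hom (φ ⊗ₜ ψ) := by
      refine dualCoeff_eq fun x y => ?_
      refine Eq.trans ?_ (pair_summand (S := S.toD) (T := T.toD) φ ψ _ x y).symm
      rw [dif_pos rfl]
      rfl
    rw [h, lift_naturality, Category.assoc, ← K.map_comp, U.inl_inr_glue]
    exact (congrArg (_ ≫ ·) (K.map_id _)).trans (Category.comp_id _)
  · intro A _ hA
    have h : dualCoeff M N (S ⊗ T) A (dualPair M N S T φ ψ) = 0 := by
      refine dualCoeff_eq fun x y => ?_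
      refine Eq.trans ?_ (pair_summand (S := S.toD) (T := T.toD) φ ψ _ x y).symm
      rw [dif_neg hA, map_zero]
      rfl
    rw [LinearMap.comp_apply, LinearMap.comp_apply, h, map_zero, map_zero]
  · exact fun h => absurd (Finset.mem_univ (α := Set (S ⊗ T : U n).carrier) _) h

end Bifamily

end DualPair

/-! ### Finite presentations of modules over `U n`. -/

section Presentation

instance (X Y : U n) : Finite (X ⟶ Y) :=
  Finite.of_injective (fun f : X ⟶ Y => f.equiv) fun _ _ h => UHom.ext h

/-- The map from the free module on generators in degrees `S i` to `Q`. -/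
noncomputable def freeMap (Q : U n ⥤ Vect) {k : ℕ} {S : Fin k → U n} (m : ∀ i, Q.obj (S i))
    (T : U n) : ((Σ i, (S i ⟶ T)) →₀ ℂ) →ₗ[ℂ] Q.obj T :=
  Finsupp.linearCombination ℂ fun p => (Q.map p.2).hom (m p.1)

/-- The action of a morphism on the free module on generators in degrees `S i`. -/
noncomputable def freePush {k : ℕ} (S : Fin k → U n) {T W : U n} (f : T ⟶ W) :
    ((Σ i, (S i ⟶ T)) →₀ ℂ) →ₗ[ℂ] ((Σ i, (S i ⟶ W)) →₀ ℂ) :=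
  Finsupp.lmapDomain ℂ ℂ fun p => ⟨p.1, p.2 ≫ f⟩

theorem freePush_id {k : ℕ} (S : Fin k → U n) (T : U n) :
    freePush S (𝟙 T) = LinearMap.id := by
  refine Finsupp.lhom_ext fun p a => ?_
  simp [freePush, Finsupp.mapDomain_single]

theorem freePush_comp {k : ℕ} (S : Fin k → U n) {T W V : U n} (f : T ⟶ W) (g : W ⟶ V) :
    freePush S (f ≫ g) = freePush S g ∘ₗ freePush S f := by
  refine Finsupp.lhom_ext fun p a => ?_
  simp [freePush, Finsupp.mapDomain_single]

theorem freeMap_push (Q : U n ⥤ Vect) {k : ℕ} {S : Fin k → U n} (m : ∀ i, Q.obj (S i))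
    {T W : U n} (f : T ⟶ W) (z : (Σ i, (S i ⟶ T)) →₀ ℂ) :
    freeMap Q m W (freePush S f z) = (Q.map f).hom (freeMap Q m T z) := by
  have : freeMap Q m W ∘ₗ freePush S f = (Q.map f).hom ∘ₗ freeMap Q m T := by
    ext p
    simp [freePush, freeMap]
  exact LinearMap.congr_fun this z

/-- Bases of `Q(S)`, for `S` in the finite set of representatives of the support, generate:
isomorphisms carry them to the remaining nonzero values. -/
theorem exists_generators (Q : U n ⥤ Vect) (hQ : ∀ S, Module.Finite ℂ (Q.obj S))
    {s : Set (U n)} (hs : s.Finite) (hsupp : ∀ T, Nontrivial (Q.obj T) → ∃ S ∈ s, Nonempty (S ≅ T)) :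
    ∃ (k : ℕ) (S : Fin k → U n) (m : ∀ i, Q.obj (S i)),
      ∀ T, Function.Surjective (freeMap Q m T) := by
  have := hs.to_subtype
  obtain ⟨k, ⟨e⟩⟩ := Finite.exists_equiv_fin (Σ S : s, Fin (Module.finrank ℂ (Q.obj S.1)))
  refine ⟨k, fun i => (e.symm i).1.1, fun i => Module.finBasis ℂ _ (e.symm i).2, fun T => ?_⟩
  rw [← LinearMap.range_eq_top]
  by_cases hT : Nontrivial (Q.obj T)
  · obtain ⟨S, hS, ⟨φ⟩⟩ := hsupp T hT
    have key : ∀ x : Q.obj S, (Q.map φ.hom).hom x ∈ LinearMap.range (freeMap Q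
        (fun i => Module.finBasis ℂ (Q.obj (e.symm i).1.1) (e.symm i).2) T) := by
      intro x
      rw [← (Module.finBasis ℂ (Q.obj S)).sum_repr x, map_sum]
      refine Submodule.sum_mem _ fun i _ => ?_
      rw [map_smul]
      refine Submodule.smul_mem _ _ ?_
      obtain ⟨j, hj⟩ := e.symm.surjective ⟨⟨S, hS⟩, i⟩
      -- The index is replaced by a variable `p`, so that the equality of dependent pairs can be
      -- eliminated.
      have h1 : ∀ p : (Σ S : s, Fin (Module.finrank ℂ (Q.obj S.1))), p = ⟨⟨S, hS⟩, i⟩ →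
          ∃ f : p.1.1 ⟶ T, (Q.map f).hom (Module.finBasis ℂ (Q.obj p.1.1) p.2) =
            (Q.map φ.hom).hom (Module.finBasis ℂ (Q.obj S) i) := by
        rintro p rfl
        exact ⟨φ.hom, rfl⟩
      obtain ⟨f, hf⟩ := h1 _ hj
      refine ⟨Finsupp.single ⟨j, f⟩ 1, ?_⟩
      simp only [freeMap, Finsupp.linearCombination_single, one_smul]
      exact hf
    refine eq_top_iff.2 fun x _ => ?_
    have h2 := key ((Q.map φ.inv).hom x)
    rwa [map_map, Iso.inv_hom_id, Q.map_id] at h2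
  · rw [not_nontrivial_iff_subsingleton] at hT
    exact Subsingleton.elim _ _

/-- The relations between generators, as a functor. -/
noncomputable def relations (Q : U n ⥤ Vect) {k : ℕ} {S : Fin k → U n} (m : ∀ i, Q.obj (S i)) :
    U n ⥤ Vect where
  obj T := ModuleCat.of ℂ (LinearMap.ker (freeMap Q m T))
  map f := ModuleCat.ofHom ((freePush S f).restrict fun z hz => by
    rw [LinearMap.mem_ker] at hz ⊢
    rw [freeMap_push, hz, map_zero])
  map_id T := by
    refine ModuleCat.hom_ext (LinearMap.ext fun z => Subtype.ext ?_)
    exact LinearMap.congr_fun (freePush_id S T) z.1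
  map_comp f g := by
    refine ModuleCat.hom_ext (LinearMap.ext fun z => Subtype.ext ?_)
    exact LinearMap.congr_fun (freePush_comp S f g) z.1

/-- A finite presentation of a `U n`-module. -/
structure Presentation (Q : U n ⥤ Vect) where
  k : ℕ
  S : Fin k → U n
  gen : ∀ i, Q.obj (S i)
  surjective : ∀ T, Function.Surjective (freeMap Q gen T)
  l : ℕ
  R : Fin l → U n
  rel : ∀ j, (Σ i, (S i ⟶ R j)) →₀ ℂ
  rel_mem : ∀ j, freeMap Q gen (R j) (rel j) = 0
  ker_le : ∀ T, LinearMap.ker (freeMap Q gen T) ≤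
    Submodule.span ℂ (Set.range fun p : (Σ j, (R j ⟶ T)) => freePush S p.2 (rel p.1))

/-- The module of relations again has finite dimensional values and finite support up to
isomorphism, so `exists_generators` applies a second time. -/
theorem exists_presentation (Q : U n ⥤ Vect) (hQ : ∀ S, Module.Finite ℂ (Q.obj S))
    {s : Set (U n)} (hs : s.Finite) (hsupp : ∀ T, Nontrivial (Q.obj T) → ∃ S ∈ s, Nonempty (S ≅ T)) :
    Nonempty (Presentation Q) := by
  obtain ⟨k, S, m, hm⟩ := exists_generators Q hQ hs hsupp
  have h1 : ∀ T, Module.Finite ℂ ((relations Q m).obj T) := fun T =>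
    inferInstanceAs (Module.Finite ℂ (LinearMap.ker (freeMap Q m T)))
  obtain ⟨l, R, r, hr⟩ := exists_generators (relations Q m) h1
    -- A weighted set receiving a morphism from `S i` is isomorphic to the carrier of `S i` with one
    -- of finitely many weight functions.
    (s := ⋃ i, Set.range fun w : (S i).carrier → Fin n => (⟨⟨(S i).carrier, w⟩⟩ : U n))
    (Set.finite_iUnion fun i => Set.finite_range _) fun T hT => by
      have : Nonempty (Σ i, (S i ⟶ T)) := by
        by_contra h
        rw [not_nonempty_iff] at h
        obtain ⟨x, y, hxy⟩ := hT
        exact hxy (Subtype.ext (Subsingleton.elim x.1 y.1))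
      obtain ⟨i, f⟩ := this
      exact ⟨_, Set.mem_iUnion.2 ⟨i, ⟨fun x => T.weight (f.equiv x), rfl⟩⟩,
        ⟨U.mkIso f.equiv fun _ => rfl⟩⟩
  refine ⟨⟨k, S, m, hm, l, R, fun j => (r j).1, fun j => (r j).2, fun T z hz => ?_⟩⟩
  obtain ⟨c, hc⟩ := hr T ⟨z, hz⟩
  have h2 : z = (Submodule.subtype _ ∘ₗ freeMap (relations Q m) r T) c :=
    (congrArg Subtype.val hc).symm
  rw [h2]
  clear hc h2
  induction c using Finsupp.induction_linear with
  | zero => rw [map_zero]; exact Submodule.zero_mem _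
  | add a b ha hb => rw [map_add]; exact Submodule.add_mem _ ha hb
  | single p a =>
    have h3 : (Submodule.subtype _ ∘ₗ freeMap (relations Q m) r T) (Finsupp.single p a) =
        a • freePush S p.2 (r p.1).1 :=
      congrArg Subtype.val (Finsupp.linearCombination_single (M := (relations Q m).obj T)
        (v := fun p : (Σ j, (R j ⟶ T)) => ((relations Q m).map p.2).hom (r p.1)) ℂ a p)
    rw [h3]
    exact Submodule.smul_mem _ _ (Submodule.subset_span ⟨p, rfl⟩)

theorem exists_presentation_dual (N : ModD n) : Nonempty (Presentation (dual N)) := by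
  obtain ⟨hN, s, hs, hsupp⟩ := N.property
  refine exists_presentation (dual N)
    (fun S => inferInstanceAs (Module.Finite ℂ (Module.Dual ℂ (N.obj.obj S.toD))))
    (s := (fun Y : D n => (⟨Y.toWSet⟩ : U n)) '' s) (hs.image _) fun T hT => ?_
  obtain ⟨Y, hY, ⟨e⟩⟩ := hsupp T.toD fun h => by
    rw [ModuleCat.isZero_iff_subsingleton] at h
    have h' : Subsingleton (Module.Dual ℂ (N.obj.obj T.toD)) := inferInstance
    exact not_subsingleton_iff_nontrivial.2 hT h'
  -- Neither an isomorphism of `D n` nor its inverse increases weights, so it preserves them and is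
  -- also an isomorphism in `U n`.
  refine ⟨_, ⟨Y, hY, rfl⟩, ⟨U.mkIso e.symm.hom.equiv fun y => le_antisymm ?_ ?_⟩⟩
  · exact e.inv.weight_le y
  · refine (e.hom.weight_le (e.inv.equiv y)).trans_eq' ?_
    exact congrArg Y.weight (congrArg (fun f => f.equiv y) e.inv_hom_id)

end Presentation

/-! ### Universal families as kernels, and their images under left-exact functors. -/

section Universal

variable {C : Type u} [Category.{v} C] [Preadditive C] [Linear ℂ C]
variable {Q : U n ⥤ Vect} {K : U n ⥤ C}

/-- Evaluation of formal linear combinations at morphisms `X ⟶ K(S i)`. -/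
noncomputable def freeEval (K : U n ⥤ C) {X : C} {k : ℕ} {S : Fin k → U n}
    (x : ∀ i, X ⟶ K.obj (S i)) (T : U n) : ((Σ i, (S i ⟶ T)) →₀ ℂ) →ₗ[ℂ] (X ⟶ K.obj T) :=
  Finsupp.linearCombination ℂ fun p => x p.1 ≫ K.map p.2

theorem freeEval_push {X : C} {k : ℕ} {S : Fin k → U n} (x : ∀ i, X ⟶ K.obj (S i)) {T W : U n}
    (f : T ⟶ W) (z : (Σ i, (S i ⟶ T)) →₀ ℂ) :
    freeEval K x W (freePush S f z) = freeEval K x T z ≫ K.map f := by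
  have : freeEval K x W ∘ₗ freePush S f = Linear.rightComp ℂ _ (K.map f) ∘ₗ freeEval K x T := by
    ext p
    simp [freePush, freeEval]
  exact LinearMap.congr_fun this z

theorem freeEval_precomp {X X' : C} {k : ℕ} {S : Fin k → U n} (x : ∀ i, X ⟶ K.obj (S i))
    (g : X' ⟶ X) {T : U n} (z : (Σ i, (S i ⟶ T)) →₀ ℂ) :
    freeEval K (fun i => g ≫ x i) T z = g ≫ freeEval K x T z := by
  have : freeEval K (fun i => g ≫ x i) T = Linear.leftComp ℂ _ g ∘ₗ freeEval K x T := by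
    ext p
    simp [freeEval]
  exact LinearMap.congr_fun this z

theorem freeEval_app {X : C} (t : ToStructuredHom X Q K) {k : ℕ} {S : Fin k → U n}
    (m : ∀ i, Q.obj (S i)) {T : U n} (z : (Σ i, (S i ⟶ T)) →₀ ℂ) :
    freeEval K (fun i => t.app (S i) (m i)) T z = t.app T (freeMap Q m T z) := by
  have : freeEval K (fun i => t.app (S i) (m i)) T = t.app T ∘ₗ freeMap Q m T := by
    ext p
    simp [freeEval, freeMap, t.naturality]
  exact LinearMap.congr_fun this z

theorem Presentation.hom_ext (p : Presentation Q) {X : C} {t t' : ToStructuredHom X Q K}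
    (h : ∀ i, t.app (p.S i) (p.gen i) = t'.app (p.S i) (p.gen i)) : t = t' := by
  refine ToStructuredHom.ext (funext fun T => LinearMap.ext fun x => ?_)
  obtain ⟨z, rfl⟩ := p.surjective T x
  rw [← freeEval_app, ← freeEval_app, funext h]

/-- With `Presentation.hom_ext`, families on `Q` become tuples of morphisms to the `K(S_i)`
annihilated by the relations. This finite description is what exhibits the universal object as a
kernel. -/
theorem Presentation.exists_hom (p : Presentation Q) {X : C} (x : ∀ i, X ⟶ K.obj (p.S i))
    (h : ∀ j, freeEval K x (p.R j) (p.rel j) = 0) :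
    ∃ t : ToStructuredHom X Q K, ∀ i, t.app (p.S i) (p.gen i) = x i := by
  have h1 : ∀ T, LinearMap.ker (freeMap Q p.gen T) ≤ LinearMap.ker (freeEval K x T) := by
    intro T
    refine (p.ker_le T).trans (Submodule.span_le.2 ?_)
    rintro _ ⟨q, rfl⟩
    change freeEval K x T _ = 0
    rw [freeEval_push, h, zero_comp]
  have h2 : ∀ T, ∃ t : Q.obj T →ₗ[ℂ] (X ⟶ K.obj T), ∀ z, t (freeMap Q p.gen T z) =
      freeEval K x T z := by
    intro T
    -- A linear section suffices: two lifts of the same element differ by a relation, which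
    -- `freeEval K x T` kills.
    obtain ⟨g, hg⟩ := (freeMap Q p.gen T).exists_rightInverse_of_surjective
      (LinearMap.range_eq_top.2 (p.surjective T))
    refine ⟨freeEval K x T ∘ₗ g, fun z => ?_⟩
    rw [LinearMap.comp_apply, ← sub_eq_zero, ← map_sub, ← LinearMap.mem_ker]
    refine h1 T ?_
    rw [LinearMap.mem_ker, map_sub, sub_eq_zero]
    exact LinearMap.congr_fun hg _
  choose t ht using h2
  refine ⟨⟨t, fun {S T} φ m => ?_⟩, fun i => ?_⟩
  · obtain ⟨z, rfl⟩ := p.surjective S m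
    rw [← freeMap_push, ht, ht, freeEval_push]
  · have h3 := ht (p.S i) (Finsupp.single ⟨i, 𝟙 _⟩ 1)
    simpa [freeMap, freeEval] using h3

/-- A family is universal if all families are obtained from it by precomposition. -/
def ToStructuredHom.IsUniversal {P : C} (t : ToStructuredHom P Q K) : Prop :=
  ∀ (X : C) (s : ToStructuredHom X Q K), ∃! f : X ⟶ P, t.precomp f = s

namespace ToStructuredHom.IsUniversal

variable {P : C} {t : ToStructuredHom P Q K} (ht : t.IsUniversal)
include ht

theorem hom_ext {X : C} {f g : X ⟶ P}
    (h : ∀ S (m : Q.obj S), f ≫ t.app S m = g ≫ t.app S m) : f = g :=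
  (ht X (t.precomp g)).unique (ToStructuredHom.ext (funext fun S => LinearMap.ext (h S))) rfl

/-- The morphism to a universal family. -/
noncomputable def lift {X : C} (s : ToStructuredHom X Q K) : X ⟶ P := (ht X s).choose

theorem precomp_lift {X : C} (s : ToStructuredHom X Q K) : t.precomp (ht.lift s) = s :=
  (ht X s).choose_spec.1

@[simp]
theorem lift_app {X : C} (s : ToStructuredHom X Q K) (S : U n) (m : Q.obj S) :
    ht.lift s ≫ t.app S m = s.app S m :=
  LinearMap.congr_fun (congrFun (congrArg ToStructuredHom.app (ht.precomp_lift s)) S) m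

end ToStructuredHom.IsUniversal

/-- The universal object is the kernel of the map from the product of the `K(S_i)` to the product of
the `K(R_j)` given by the relations. -/
theorem exists_isUniversal {C : Type u} [Category.{v} C] [Abelian C] [Linear ℂ C] (K : U n ⥤ C)
    (p : Presentation Q) : ∃ (P : C) (t : ToStructuredHom P Q K), t.IsUniversal := by
  let f : (∏ᶜ fun i => K.obj (p.S i)) ⟶ ∏ᶜ fun j => K.obj (p.R j) :=
    Pi.lift fun j => freeEval K (fun i => Pi.π _ i) (p.R j) (p.rel j)
  have hf : ∀ {X : C} (g : X ⟶ ∏ᶜ fun i => K.obj (p.S i)) j,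
      g ≫ f ≫ Pi.π _ j = freeEval K (fun i => g ≫ Pi.π _ i) (p.R j) (p.rel j) := by
    intro X g j
    rw [freeEval_precomp, Pi.lift_π]
  obtain ⟨t, ht⟩ := p.exists_hom (K := K) (fun i => kernel.ι f ≫ Pi.π _ i) fun j => by
    rw [← hf, kernel.condition_assoc, zero_comp]
  refine ⟨kernel f, t, fun X s => ?_⟩
  refine ⟨kernel.lift f (Pi.lift fun i => s.app (p.S i) (p.gen i)) (Pi.hom_ext _ _ fun j => ?_),
    p.hom_ext fun i => ?_, fun g hg => ?_⟩
  · rw [Category.assoc, hf]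
    simp only [Pi.lift_π]
    rw [freeEval_app, p.rel_mem, map_zero, zero_comp]
  · change _ ≫ t.app _ _ = _
    rw [ht, kernel.lift_ι_assoc, Pi.lift_π]
  · rw [← cancel_mono (kernel.ι f), kernel.lift_ι]
    refine Pi.hom_ext _ _ fun i => ?_
    rw [Pi.lift_π, Category.assoc, ← ht, ← hg]
    rfl

variable {C' : Type u'} [Category.{v'} C'] [Preadditive C'] [Linear ℂ C']

/-- The image of a family under a linear functor. -/
def ToStructuredHom.mapFunctor {X : C} (t : ToStructuredHom X Q K) (L : C ⥤ C') [L.Additive]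
    [L.Linear ℂ] : ToStructuredHom (L.obj X) Q (K ⋙ L) where
  app S := L.mapLinearMap ℂ ∘ₗ t.app S
  naturality φ m := by
    change L.map _ = L.map _ ≫ L.map _
    rw [t.naturality, L.map_comp]

/-- Any universal object is the kernel of the map `f` defined by a presentation. A left-exact
functor preserves this kernel and both finite products, and a linear one takes the relations for `K`
to those for `K ⋙ L`. No kernels are assumed to exist in `C`, so that the result applies to modules
as well. -/
theorem ToStructuredHom.IsUniversal.map [HasFiniteProducts C] (p : Presentation Q) {P : C}
    {t : ToStructuredHom P Q K} (ht : t.IsUniversal) (L : C ⥤ C') [L.Additive] [L.Linear ℂ]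
    [PreservesFiniteLimits L] : (t.mapFunctor L).IsUniversal := by
  let f : (∏ᶜ fun i => K.obj (p.S i)) ⟶ ∏ᶜ fun j => K.obj (p.R j) :=
    Pi.lift fun j => freeEval K (fun i => Pi.π _ i) (p.R j) (p.rel j)
  have hf : ∀ {X : C} (g : X ⟶ ∏ᶜ fun i => K.obj (p.S i)) j,
      g ≫ f ≫ Pi.π _ j = freeEval K (fun i => g ≫ Pi.π _ i) (p.R j) (p.rel j) := by
    intro X g j
    rw [freeEval_precomp, Pi.lift_π]
  let κ : P ⟶ ∏ᶜ fun i => K.obj (p.S i) := Pi.lift fun i => t.app (p.S i) (p.gen i)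
  have hκ : κ ≫ f = 0 := Pi.hom_ext _ _ fun j => by
    rw [Category.assoc, hf]
    simp only [κ, Pi.lift_π]
    rw [freeEval_app, p.rel_mem, map_zero, zero_comp]
  -- A morphism killed by `f` is a tuple satisfying the relations, hence a family, hence factors
  -- through `P`.
  have hlift : ∀ {X : C} (g : X ⟶ ∏ᶜ fun i => K.obj (p.S i)), g ≫ f = 0 →
      ∃ g' : X ⟶ P, g' ≫ κ = g := by
    intro X g hg
    obtain ⟨s, hs⟩ := p.exists_hom (K := K) (fun i => g ≫ Pi.π _ i) fun j => by
      rw [← hf, reassoc_of% hg, zero_comp]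
    refine ⟨ht.lift s, Pi.hom_ext _ _ fun i => ?_⟩
    rw [Category.assoc, Pi.lift_π, ht.lift_app, hs]
  have huniq : ∀ {X : C} (g g' : X ⟶ P), g ≫ κ = g' ≫ κ → g = g' := by
    intro X g g' h
    refine (ht X (t.precomp g')).unique (p.hom_ext fun i => ?_) rfl
    have := congrArg (· ≫ Pi.π _ i) h
    simp only [κ, Category.assoc, Pi.lift_π] at this
    exact this
  have hker : IsLimit (KernelFork.ofι κ hκ) := KernelFork.IsLimit.ofι κ hκ
    (fun g hg => (hlift g hg).choose) (fun g hg => (hlift g hg).choose_spec)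
    (fun g hg m hm => huniq _ _ (hm.trans (hlift g hg).choose_spec.symm))
  have hLκ : L.map κ ≫ L.map f = 0 := by rw [← L.map_comp, hκ, L.map_zero]
  have hLker : IsLimit (KernelFork.ofι (L.map κ) hLκ) :=
    isLimitForkMapOfIsLimit' L hκ hker
  have hprod := isLimitOfHasProductOfPreservesLimit L fun i => K.obj (p.S i)
  have hprod' := isLimitOfHasProductOfPreservesLimit L fun j => K.obj (p.R j)
  -- Linearity of `L` identifies `L(f)` with the map defined by the same relations for `K ⋙ L`.
  have hLf : ∀ {X : C'} (g : X ⟶ L.obj (∏ᶜ fun i => K.obj (p.S i))) j,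
      g ≫ L.map f ≫ L.map (Pi.π _ j) =
        freeEval (K ⋙ L) (fun i => g ≫ L.map (Pi.π _ i)) (p.R j) (p.rel j) := by
    intro X g j
    rw [freeEval_precomp, ← L.map_comp, Pi.lift_π]
    congr 1
    have : L.mapLinearMap ℂ ∘ₗ freeEval K (fun i => Pi.π (fun i => K.obj (p.S i)) i) (p.R j) =
        freeEval (K ⋙ L) (fun i => L.map (Pi.π (fun i => K.obj (p.S i)) i)) (p.R j) := by
      ext q
      simp [freeEval]
    exact LinearMap.congr_fun this (p.rel j)
  intro Y s
  let g : Y ⟶ L.obj (∏ᶜ fun i => K.obj (p.S i)) :=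
    Fan.IsLimit.lift hprod fun i => s.app (p.S i) (p.gen i)
  have hg : ∀ i, g ≫ L.map (Pi.π _ i) = s.app (p.S i) (p.gen i) := fun i =>
    Fan.IsLimit.fac hprod _ i
  have hgf : g ≫ L.map f = 0 := Fan.IsLimit.hom_ext hprod' _ _ fun j => by
    refine (Category.assoc _ _ _).trans ((hLf g j).trans ?_)
    simp only [hg]
    rw [freeEval_app, p.rel_mem, map_zero, zero_comp]
  have hκπ : ∀ i, L.map κ ≫ L.map (Pi.π _ i) = L.map (t.app (p.S i) (p.gen i)) := fun i => by
    rw [← L.map_comp, Pi.lift_π]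
  refine ⟨hLker.lift (KernelFork.ofι g hgf), p.hom_ext fun i => ?_, fun h hh => ?_⟩
  · change hLker.lift (KernelFork.ofι g hgf) ≫ L.map (t.app _ _) = _
    rw [← hκπ, ← hg]
    exact (Category.assoc _ _ _).symm.trans
      (congrArg (· ≫ L.map (Pi.π _ i)) (Fork.IsLimit.lift_ι hLker))
  · refine Fork.IsLimit.hom_ext hLker ?_
    refine Eq.trans ?_ (Fork.IsLimit.lift_ι (t := KernelFork.ofι g hgf) hLker).symm
    refine Fan.IsLimit.hom_ext hprod _ _ fun i => ?_
    refine Eq.trans ?_ (hg i).symm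
    refine (Category.assoc _ _ _).trans ((congrArg (h ≫ ·) (hκπ i)).trans ?_)
    rw [← hh]
    rfl

end Universal

/-! ### Finite limits of modules are computed pointwise. -/

section FiniteLimits

/-- Pointwise, a limit embeds into the product of the values of the diagram. So its values are
finite dimensional, and its support lies in the finite union of the supports. -/
instance isClosedUnderLimits (J : Type) [SmallCategory J] [FinCategory J] :
    (IsModule n).IsClosedUnderLimitsOfShape J where
  limitsOfShape_le := by
    rintro M ⟨h⟩
    have hinj : ∀ X, Function.Injective fun (x : M.obj X) (j : J) => (((h.π.app j).app X).hom x) := by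
      intro X x y hxy
      exact Concrete.isLimit_ext _ (isLimitOfPreserves ((evaluation (D n) Vect).obj X) h.isLimit)
        x y fun j => congrFun hxy j
    have hfin := fun j => (h.prop_diag_obj j).1
    choose s hs hsupp using fun j => (h.prop_diag_obj j).2
    refine ⟨fun X => ?_, ⋃ j, s j, Set.finite_iUnion hs, fun X hX => ?_⟩
    · have := fun j => hfin j X
      exact Module.Finite.of_injective (LinearMap.pi fun j => ((h.π.app j).app X).hom) (hinj X)
    · by_contra! hc
      refine hX ?_
      rw [ModuleCat.isZero_iff_subsingleton]
      refine ⟨fun x y => hinj X (funext fun j => ?_)⟩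
      have hz : IsZero ((h.diag.obj j).obj X) := by
        by_contra hz
        obtain ⟨Y, hY, ⟨e⟩⟩ := hsupp j X hz
        exact (hc Y (Set.mem_iUnion.2 ⟨j, hY⟩)).elim' e
      rw [ModuleCat.isZero_iff_subsingleton] at hz
      exact Subsingleton.elim _ _

instance : HasFiniteLimits (ModD n) := ⟨fun _ _ _ => inferInstance⟩

instance : HasBinaryBiproducts (ModD n) := HasBinaryBiproducts.of_hasBinaryProducts

instance : HasZeroObject (ModD n) := hasZeroObject_of_hasTerminal_object

variable (n) in
/-- Evaluation of modules at a weighted set. -/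
abbrev evalAt (X : D n) : ModD n ⥤ Vect := (IsModule n).ι ⋙ (evaluation (D n) Vect).obj X

/-- Evaluation at `X` preserves finite limits, so a kernel of modules is a kernel of vector spaces
at each `X`. -/
theorem kernel_eval {N N₁ N₂ : ModD n} {κ : N ⟶ N₁} {f : N₁ ⟶ N₂} {w : κ ≫ f = 0}
    (h : IsLimit (KernelFork.ofι κ w)) (X : D n) :
    Function.Injective (κ.hom.app X).hom ∧
      LinearMap.ker (f.hom.app X).hom ≤ LinearMap.range (κ.hom.app X).hom := by
  have h' := isLimitForkMapOfIsLimit' (evalAt n X) w h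
  constructor
  · rw [← ModuleCat.mono_iff_injective]
    exact mono_of_isLimit_fork h'
  · intro x hx
    let g : ModuleCat.of ℂ (LinearMap.ker (f.hom.app X).hom) ⟶ (evalAt n X).obj N₁ :=
      ModuleCat.ofHom (LinearMap.ker (f.hom.app X).hom).subtype
    have hg : g ≫ (evalAt n X).map f = 0 :=
      ModuleCat.hom_ext (LinearMap.ext fun x => x.2)
    refine ⟨(h'.lift (KernelFork.ofι g hg)).hom ⟨x, hx⟩, ?_⟩
    exact ConcreteCategory.congr_hom (Fork.IsLimit.lift_ι (t := KernelFork.ofι g hg) h') ⟨x, hx⟩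

end FiniteLimits

/-! ### The functor `N ↦ N ⊙ K` and its left exactness. -/

section StructuredTensor

variable {C : Type u} [Category.{v} C] [Abelian C] [Linear ℂ C]

/-- A finite presentation of `N^∨`. -/
noncomputable def presentation (N : ModD n) : Presentation (dual N) :=
  (exists_presentation_dual N).some

/-- The structured tensor product `N ⊙ K`. -/
noncomputable def odotObj (K : U n ⥤ C) (N : ModD n) : C :=
  (exists_isUniversal K (presentation N)).choose

theorem exists_family (K : U n ⥤ C) (N : ModD n) :
    ∃ t : ToStructuredHom (odotObj K N) (dual N) K, t.IsUniversal :=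
  (exists_isUniversal K (presentation N)).choose_spec

/-- The functor `N ↦ N ⊙ K`. -/
noncomputable def odot (K : U n ⥤ C) : ModD n ⥤ C where
  obj N := odotObj K N
  map {N N'} h := (exists_family K N').choose_spec.lift
    ((exists_family K N).choose.restrict (dualMap h))
  map_id N := (exists_family K N).choose_spec.hom_ext fun S φ => by
    rw [(exists_family K N).choose_spec.lift_app, Category.id_comp]
    rfl
  map_comp f g := (exists_family K _).choose_spec.hom_ext fun S φ => by
    rw [Category.assoc, (exists_family K _).choose_spec.lift_app,
      (exists_family K _).choose_spec.lift_app]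
    exact ((exists_family K _).choose_spec.lift_app
      ((exists_family K _).choose.restrict (dualMap f)) S (((dualMap g).app S).hom φ)).symm

/-- The universal family on `N ⊙ K`. -/
noncomputable def odotEv (K : U n ⥤ C) (N : ModD n) :
    ToStructuredHom ((odot K).obj N) (dual N) K :=
  (exists_family K N).choose

theorem odotEv_isUniversal (K : U n ⥤ C) (N : ModD n) : (odotEv K N).IsUniversal :=
  (exists_family K N).choose_spec

theorem odot_hom_ext {K : U n ⥤ C} {N : ModD n} {X : C} {f g : X ⟶ (odot K).obj N}
    (h : ∀ S φ, f ≫ (odotEv K N).app S φ = g ≫ (odotEv K N).app S φ) : f = g :=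
  (odotEv_isUniversal K N).hom_ext h

theorem odot_map_ev (K : U n ⥤ C) {N N' : ModD n} (h : N ⟶ N') (S : U n) (φ : (dual N').obj S) :
    (odot K).map h ≫ (odotEv K N').app S φ = (odotEv K N).app S (((dualMap h).app S).hom φ) :=
  (odotEv_isUniversal K N').lift_app _ _ _

theorem odot_map_ev_assoc (K : U n ⥤ C) {N N' : ModD n} (h : N ⟶ N') (S : U n)
    (φ : (dual N').obj S) {Z : C} (g : K.obj S ⟶ Z) :
    (odot K).map h ≫ (odotEv K N').app S φ ≫ g =
      (odotEv K N).app S (((dualMap h).app S).hom φ) ≫ g := by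
  rw [← Category.assoc, odot_map_ev]

/-- Functoriality of `N ⊙ K` in `K`. -/
noncomputable def odotMap {K K' : U n ⥤ C} (k : K ⟶ K') : odot K ⟶ odot K' where
  app N := (odotEv_isUniversal K' N).lift ((odotEv K N).postcomp k)
  naturality N N' h := odot_hom_ext fun S φ => by
    rw [Category.assoc, Category.assoc, (odotEv_isUniversal K' _).lift_app, odot_map_ev,
      (odotEv_isUniversal K' _).lift_app]
    change _ ≫ _ ≫ _ = _ ≫ _
    rw [odot_map_ev_assoc]

theorem odotMap_ev {K K' : U n ⥤ C} (k : K ⟶ K') (N : ModD n) (S : U n) (φ : (dual N).obj S) :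
    (odotMap k).app N ≫ (odotEv K' N).app S φ = (odotEv K N).app S φ ≫ k.app S :=
  (odotEv_isUniversal K' N).lift_app _ _ _

theorem odotMap_ev_assoc {K K' : U n ⥤ C} (k : K ⟶ K') (N : ModD n) (S : U n)
    (φ : (dual N).obj S) {Z : C} (g : K'.obj S ⟶ Z) :
    (odotMap k).app N ≫ (odotEv K' N).app S φ ≫ g = (odotEv K N).app S φ ≫ k.app S ≫ g := by
  rw [← Category.assoc, odotMap_ev, Category.assoc]

instance (K : U n ⥤ C) : (odot K).Additive where
  map_add {N N' f g} := odot_hom_ext fun S φ => by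
    rw [Preadditive.add_comp, odot_map_ev, odot_map_ev, odot_map_ev, ← map_add]
    congr 1
    exact LinearMap.ext fun x => map_add (show Module.Dual ℂ (N'.obj.obj S.toD) from φ) _ _

instance (K : U n ⥤ C) : (odot K).Linear ℂ where
  map_smul {N N'} f c := odot_hom_ext fun S φ => by
    rw [Linear.smul_comp, odot_map_ev, odot_map_ev, ← map_smul]
    congr 1
    exact LinearMap.ext fun x => map_smul (show Module.Dual ℂ (N'.obj.obj S.toD) from φ) _ _

/-- Dualising the kernel pointwise presents `N^∨` as the cokernel of `N₂^∨ → N₁^∨`. A family on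
`N₁^∨` which vanishes on the image of `N₂^∨` therefore descends to `N^∨`. -/
theorem odot_exists_lift (K : U n ⥤ C) {N N₁ N₂ : ModD n} {κ : N ⟶ N₁} {f : N₁ ⟶ N₂}
    {w : κ ≫ f = 0} (h : IsLimit (KernelFork.ofι κ w)) {X : C} (g : X ⟶ (odot K).obj N₁)
    (hg : g ≫ (odot K).map f = 0) : ∃ g' : X ⟶ (odot K).obj N, g' ≫ (odot K).map κ = g := by
  have hsurj : ∀ S : U n, Function.Surjective (κ.hom.app S.toD).hom.dualMap := fun S =>
    LinearMap.dualMap_surjective_of_injective (kernel_eval h S.toD).1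
  have hker : ∀ (S : U n) (φ : (dual N₁).obj S), ((dualMap κ).app S).hom φ = 0 → g ≫ (odotEv K N₁).app S φ = 0 := by
    intro S φ hφ
    -- A functional vanishing on the image of `κ`, which contains the kernel of `f`, is pulled back
    -- along `f`.
    have : (show Module.Dual ℂ (N₁.obj.obj S.toD) from φ) ∈ LinearMap.range (f.hom.app S.toD).hom.dualMap := by
      rw [LinearMap.range_dualMap_eq_dualAnnihilator_ker, Submodule.mem_dualAnnihilator]
      intro x hx
      obtain ⟨y, rfl⟩ := (kernel_eval h S.toD).2 hx
      exact LinearMap.congr_fun hφ y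
    obtain ⟨ψ, hψ⟩ : ∃ ψ : (dual N₂).obj S, ((dualMap f).app S).hom ψ = φ := this
    rw [← hψ, ← odot_map_ev, reassoc_of% hg, zero_comp]
  have hfac : ∀ S : U n, ∃ t : (dual N).obj S →ₗ[ℂ] (X ⟶ K.obj S),
      ∀ φ : (dual N₁).obj S, t (((dualMap κ).app S).hom φ) = g ≫ (odotEv K N₁).app S φ := by
    intro S
    obtain ⟨r, hr⟩ := ((dualMap κ).app S).hom.exists_rightInverse_of_surjective
      (LinearMap.range_eq_top.2 (hsurj S))
    refine ⟨Linear.leftComp ℂ _ g ∘ₗ (odotEv K N₁).app S ∘ₗ r, fun φ => ?_⟩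
    -- The choice of the section `r` does not matter: two preimages differ by an element of the
    -- kernel of the dual of `κ`, where `hker` applies.
    have h1 := hker S (r (((dualMap κ).app S).hom φ) - φ) (by
      rw [map_sub, sub_eq_zero]
      exact LinearMap.congr_fun hr _)
    rw [map_sub, Preadditive.comp_sub, sub_eq_zero] at h1
    exact h1
  choose t ht using hfac
  refine ⟨(odotEv_isUniversal K N).lift ⟨t, fun {S T} u φ => ?_⟩, odot_hom_ext fun S φ => ?_⟩
  · obtain ⟨φ, rfl⟩ : ∃ φ' : (dual N₁).obj S, ((dualMap κ).app S).hom φ' = φ := hsurj S φ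
    have h1 : ((dual N).map u).hom (((dualMap κ).app S).hom φ) =
        ((dualMap κ).app T).hom (((dual N₁).map u).hom φ) :=
      (ConcreteCategory.congr_hom ((dualMap κ).naturality u) φ).symm
    rw [h1, ht, ht, (odotEv K N₁).naturality, Category.assoc]
  · rw [Category.assoc, odot_map_ev, (odotEv_isUniversal K N).lift_app, ht]

/-- The map `N₁^∨ → N^∨` is surjective, so a family on `N^∨` is determined by its restriction to
`N₁^∨`. -/
theorem odot_map_mono (K : U n ⥤ C) {N N₁ N₂ : ModD n} {κ : N ⟶ N₁} {f : N₁ ⟶ N₂}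
    {w : κ ≫ f = 0} (h : IsLimit (KernelFork.ofι κ w)) {X : C} (g g' : X ⟶ (odot K).obj N)
    (hg : g ≫ (odot K).map κ = g' ≫ (odot K).map κ) : g = g' := by
  refine odot_hom_ext fun S φ => ?_
  obtain ⟨φ, rfl⟩ : ∃ φ' : (dual N₁).obj S, ((dualMap κ).app S).hom φ' = φ :=
    LinearMap.dualMap_surjective_of_injective (kernel_eval h S.toD).1 φ
  rw [← odot_map_ev]
  exact (reassoc_of% hg) _

instance (K : U n ⥤ C) {N₁ N₂ : ModD n} (f : N₁ ⟶ N₂) :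
    PreservesLimit (parallelPair f 0) (odot K) := by
  have h : IsLimit (KernelFork.ofι (kernel.ι f) (kernel.condition f)) := kernelIsKernel f
  refine preservesLimit_of_preserves_limit_cone h ?_
  refine (isLimitMapConeForkEquiv' (odot K) (kernel.condition f)).symm ?_
  exact KernelFork.IsLimit.ofι _ _ (fun g hg => (odot_exists_lift K h g hg).choose)
    (fun g hg => (odot_exists_lift K h g hg).choose_spec)
    (fun g hg m hm => odot_map_mono K h _ _
      (hm.trans (odot_exists_lift K h g hg).choose_spec.symm))

instance (K : U n ⥤ C) : PreservesFiniteLimits (odot K) :=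
  Functor.preservesFiniteLimits_of_preservesKernels (odot K)

end StructuredTensor

/-! ### Modules isomorphic to a principal injective, recognised by one functional. -/

section Free

/-- A downwards bijection, regarded as an upwards bijection in the other direction. -/
def U.ofD {S T : U n} (f : S.toD ⟶ T.toD) : T ⟶ S :=
  ⟨f.equiv.symm, fun t => by
    obtain ⟨s, rfl⟩ := f.equiv.surjective t
    simpa using f.weight_le s⟩

theorem U.ofD_comp {S T W : U n} (f : S.toD ⟶ T.toD) (g : T.toD ⟶ W.toD) :
    U.ofD (f ≫ g) = U.ofD g ≫ U.ofD f := rfl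

/-- A functional `e` on `N(A)` is free if it induces an isomorphism
`N(X) ⟶ ℂ^Hom(X, A)` for all `X`, i.e. an isomorphism of `N` with the principal injective at `A`. -/
def IsFree (N : ModD n) (A : U n) (e : Module.Dual ℂ (N.obj.obj A.toD)) : Prop :=
  ∀ X : D n, Function.Bijective fun (x : N.obj.obj X) (f : X ⟶ A.toD) =>
    e ((N.obj.map f).hom x)

noncomputable local instance (X Y : D n) : Fintype (X ⟶ Y) := Fintype.ofFinite _

open scoped Classical in
theorem IsFree.of_basis {N : ModD n} {A : U n} {e : Module.Dual ℂ (N.obj.obj A.toD)}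
    (b : ∀ {X : D n}, (X ⟶ A.toD) → N.obj.obj X)
    (hb : ∀ {X : D n} (f g : X ⟶ A.toD), e ((N.obj.map g).hom (b f)) = if f = g then 1 else 0)
    (hinj : ∀ {X : D n} (x : N.obj.obj X), (∀ f : X ⟶ A.toD, e ((N.obj.map f).hom x) = 0) → x = 0) :
    IsFree N A e := by
  intro X
  constructor
  · intro x y hxy
    rw [← sub_eq_zero]
    refine hinj _ fun f => ?_
    rw [map_sub, map_sub, sub_eq_zero]
    exact congrFun hxy f
  · intro c
    refine ⟨∑ f, c f • b f, funext fun g => ?_⟩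
    simp only [map_sum, map_smul, hb, smul_eq_mul, mul_ite, mul_one, mul_zero,
      Finset.sum_ite_eq', Finset.mem_univ, if_true]

namespace IsFree

variable {N : ModD n} {A : U n} {e : Module.Dual ℂ (N.obj.obj A.toD)} (h : IsFree N A e)
include h

open scoped Classical in
/-- The basis of `N(X)` indexed by `Hom(X, A)`. -/
noncomputable def basis {X : D n} (f : X ⟶ A.toD) : N.obj.obj X :=
  ((h X).2 (Pi.single f 1)).choose

open scoped Classical in
theorem basis_spec {X : D n} (f g : X ⟶ A.toD) :
    e ((N.obj.map g).hom (h.basis f)) = if f = g then 1 else 0 := by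
  refine (congrFun ((h X).2 (Pi.single f 1)).choose_spec g).trans ?_
  rw [Pi.single_apply]
  exact if_congr eq_comm rfl rfl

theorem ext {X : D n} {x y : N.obj.obj X}
    (hxy : ∀ f : X ⟶ A.toD, e ((N.obj.map f).hom x) = e ((N.obj.map f).hom y)) : x = y :=
  (h X).1 (funext hxy)

theorem eq_sum {X : D n} (x : N.obj.obj X) :
    x = ∑ f : X ⟶ A.toD, e ((N.obj.map f).hom x) • h.basis f := by
  classical
  refine h.ext fun g => ?_
  simp only [map_sum, map_smul, h.basis_spec, smul_eq_mul, mul_ite, mul_one, mul_zero,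
      Finset.sum_ite_eq', Finset.mem_univ, if_true]

theorem dual_apply_eq_sum {X : D n} (ℓ : Module.Dual ℂ (N.obj.obj X)) (x : N.obj.obj X) :
    ℓ x = ∑ f : X ⟶ A.toD, ℓ (h.basis f) * e ((N.obj.map f).hom x) := by
  conv_lhs => rw [h.eq_sum x, map_sum]
  refine Finset.sum_congr rfl fun f _ => ?_
  rw [map_smul]
  exact mul_comm _ _

/-- The translates of `e` form the basis dual to `h.basis`, so `e` generates `N^∨`. Hence families
on `N^∨` are determined by their value at `e`, and `family` shows that this value is arbitrary. -/
theorem dual_eq_sum {S : U n} (ℓ : (dual N).obj S) :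
    ℓ = ∑ f : S.toD ⟶ A.toD, (show Module.Dual ℂ (N.obj.obj S.toD) from ℓ) (h.basis f) •
      ((dual N).map (U.ofD f)).hom e := by
  refine LinearMap.ext fun (x : N.obj.obj S.toD) => ?_
  refine (h.dual_apply_eq_sum ℓ x).trans ?_
  refine Eq.trans ?_ (LinearMap.sum_apply (M := N.obj.obj S.toD) (M₂ := ℂ) Finset.univ
    (fun f : S.toD ⟶ A.toD => (show Module.Dual ℂ (N.obj.obj S.toD) from
      (show Module.Dual ℂ (N.obj.obj S.toD) from ℓ) (h.basis f) •
      ((dual N).map (U.ofD f)).hom e)) x).symm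
  rfl

variable {C : Type u} [Category.{v} C] [Preadditive C] [Linear ℂ C] {K : U n ⥤ C} {X : C}

theorem hom_ext {t t' : ToStructuredHom X (dual N) K} (ht : t.app A e = t'.app A e) : t = t' := by
  refine ToStructuredHom.ext (funext fun S => LinearMap.ext fun ℓ => ?_)
  rw [h.dual_eq_sum ℓ, map_sum, map_sum]
  refine Finset.sum_congr rfl fun f _ => ?_
  rw [map_smul, map_smul]
  refine congrArg (_ • ·) ((t.naturality (U.ofD f) e).trans (Eq.trans ?_
    (t'.naturality (U.ofD f) e).symm))
  exact congrArg (· ≫ _) ht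

/-- The family with prescribed value at a free functional. -/
noncomputable def family (x : X ⟶ K.obj A) : ToStructuredHom X (dual N) K where
  app S := ∑ f : S.toD ⟶ A.toD, LinearMap.toSpanSingleton ℂ _ (x ≫ K.map (U.ofD f)) ∘ₗ
    Module.Dual.eval ℂ (N.obj.obj S.toD) (h.basis f)
  naturality {S T} φ ℓ := by
    classical
    rw [LinearMap.sum_apply, LinearMap.sum_apply, Preadditive.sum_comp]
    -- The bijections under `φ` and `g` determine `f`, so this sum has at most one nonzero term; it
    -- has none when that bijection would increase a weight.
    have h1 : ∀ g : T.toD ⟶ A.toD, (N.obj.map (U.invD φ)).hom (h.basis g) =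
        ∑ f : S.toD ⟶ A.toD, if U.invD φ ≫ f = g then h.basis f else 0 := by
      intro g
      rw [h.eq_sum ((N.obj.map (U.invD φ)).hom (h.basis g))]
      refine Finset.sum_congr rfl fun f _ => ?_
      rw [map_map, h.basis_spec, ite_smul, one_smul, zero_smul]
      exact if_congr eq_comm rfl rfl
    have h2 : ∀ g : T.toD ⟶ A.toD, (LinearMap.toSpanSingleton ℂ _ (x ≫ K.map (U.ofD g)) ∘ₗ
        Module.Dual.eval ℂ (N.obj.obj T.toD) (h.basis g)) (((dual N).map φ).hom ℓ) =
        ∑ f : S.toD ⟶ A.toD, if U.invD φ ≫ f = g then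
          (show Module.Dual ℂ (N.obj.obj S.toD) from ℓ) (h.basis f) • (x ≫ K.map (U.ofD g))
        else 0 := by
      intro g
      change (show Module.Dual ℂ (N.obj.obj S.toD) from ℓ)
        ((N.obj.map (U.invD φ)).hom (h.basis g)) • (x ≫ K.map (U.ofD g)) = _
      rw [h1, map_sum, Finset.sum_smul]
      refine Finset.sum_congr rfl fun f _ => ?_
      split_ifs
      · rfl
      · rw [map_zero, zero_smul]
    refine (Finset.sum_congr rfl fun g _ => h2 g).trans ?_
    -- After the exchange, each `f` meets exactly one index `g`, namely `U.invD φ ≫ f`.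
    rw [Finset.sum_comm]
    refine Finset.sum_congr rfl fun f _ => ?_
    rw [Finset.sum_ite_eq, if_pos (Finset.mem_univ _)]
    change _ = ((show Module.Dual ℂ (N.obj.obj S.toD) from ℓ) (h.basis f) •
      (x ≫ K.map (U.ofD f))) ≫ K.map φ
    rw [Linear.smul_comp, Category.assoc, ← K.map_comp, U.ofD_comp (S := T) (T := S) (W := A)]
    rfl

theorem family_app (x : X ⟶ K.obj A) : (h.family x).app A e = x := by
  classical
  change (∑ f : A.toD ⟶ A.toD, LinearMap.toSpanSingleton ℂ _ (x ≫ K.map (U.ofD f)) ∘ₗ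
    Module.Dual.eval ℂ (N.obj.obj A.toD) (h.basis f)) e = x
  rw [LinearMap.sum_apply]
  have h1 : ∀ f : A.toD ⟶ A.toD, (LinearMap.toSpanSingleton ℂ _ (x ≫ K.map (U.ofD f)) ∘ₗ
    Module.Dual.eval ℂ (N.obj.obj A.toD) (h.basis f)) e =
      if f = 𝟙 _ then x ≫ K.map (U.ofD f) else 0 := by
    intro f
    have h2 := h.basis_spec f (𝟙 _)
    rw [N.obj.map_id] at h2
    change e (h.basis f) • (x ≫ K.map (U.ofD f)) = _
    refine (congrArg (· • (x ≫ K.map (U.ofD f))) h2).trans ?_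
    rw [ite_smul, one_smul, zero_smul]
  refine (Finset.sum_congr rfl fun g _ => h1 g).trans ?_
  rw [Finset.sum_ite_eq', if_pos (Finset.mem_univ _)]
  exact (congrArg (x ≫ ·) (K.map_id A)).trans (Category.comp_id x)

end IsFree

theorem D.unit_hom_subsingleton {X : D n} (f g : X ⟶ 𝟙_ (D n)) : f = g :=
  D.hom_ext fun x => (f.equiv x).elim

theorem D.unit_hom_subsingleton' {X : D n} (f g : 𝟙_ (D n) ⟶ X) : f = g :=
  D.hom_ext fun x => Empty.elim x

/-- The inverse of a map to the empty set. -/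
def D.invUnit {X : D n} (f : X ⟶ 𝟙_ (D n)) : 𝟙_ (D n) ⟶ X :=
  ⟨f.equiv.symm, fun x => Empty.elim x⟩

/-- The inverse of a map from the empty set. -/
def D.invUnit' {X : D n} (f : 𝟙_ (D n) ⟶ X) : X ⟶ 𝟙_ (D n) :=
  ⟨f.equiv.symm, fun x => Empty.elim (f.equiv.symm x)⟩

/-- The unit module is the principal injective of the empty set, so every unit condition can be
tested on the single functional `unitFun`. -/
theorem isFree_unit : IsFree (𝟙_ (ModD n)) (𝟙_ (U n)) (unitFun n) := by
  classical
  refine IsFree.of_basis (fun {X} f => ((𝟙_ (ModD n)).obj.map (D.invUnit f)).hom unitElt)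
    (fun {X} f g => ?_) fun {X} x hx => ?_
  · rw [map_map, unitFun_map, if_pos (D.unit_hom_subsingleton f g)]
  · by_cases hX : Nonempty (𝟙_ (D n) ⟶ X)
    · obtain ⟨u⟩ := hX
      have key : (LinearMap.id : (𝟙_ (ModD n)).obj.obj X →ₗ[ℂ] _) =
          LinearMap.toSpanSingleton ℂ _ (((𝟙_ (ModD n)).obj.map u).hom unitElt) ∘ₗ
            unitFun n ∘ₗ ((𝟙_ (ModD n)).obj.map (D.invUnit' u)).hom := by
        refine unit_linear_ext fun v => ?_
        rw [LinearMap.comp_apply, LinearMap.comp_apply, map_map, unitFun_map,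
          LinearMap.toSpanSingleton_apply, one_smul, D.unit_hom_subsingleton' u v]
        rfl
      refine (LinearMap.congr_fun key x).trans ?_
      rw [LinearMap.comp_apply, LinearMap.comp_apply]
      exact (congrArg _ (hx (D.invUnit' u))).trans (map_zero _)
    · have key : (LinearMap.id : (𝟙_ (ModD n)).obj.obj X →ₗ[ℂ] _) = 0 :=
        unit_linear_ext fun v => (hX ⟨v⟩).elim
      exact LinearMap.congr_fun key x

/-- The canonical functional on `J_A(A)`. -/
noncomputable def injFun (A : U n) :
    Module.Dual ℂ (((principalInjective n).obj A).obj.obj A.toD) :=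
  Module.Dual.eval ℂ ((A.toD ⟶ A.toD) →₀ ℂ) (Finsupp.single (𝟙 _) 1)

theorem injFun_map (A : U n) {X : D n} (f : X ⟶ A.toD)
    (x : Module.Dual ℂ ((X ⟶ A.toD) →₀ ℂ)) :
    injFun A ((((principalInjective n).obj A).obj.map f).hom x) = x (Finsupp.single f 1) := by
  change x (Finsupp.mapDomain (f ≫ ·) (Finsupp.single (𝟙 _) 1)) = _
  rw [Finsupp.mapDomain_single, Category.comp_id]

theorem isFree_inj (A : U n) : IsFree ((principalInjective n).obj A) A (injFun A) := by
  intro X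
  have : (fun (x : ((principalInjective n).obj A).obj.obj X) (f : X ⟶ A.toD) =>
      injFun A ((((principalInjective n).obj A).obj.map f).hom x)) =
      fun (x : Module.Dual ℂ ((X ⟶ A.toD) →₀ ℂ)) f => x (Finsupp.single f 1) :=
    funext fun x => funext fun f => injFun_map A f x
  rw [this]
  refine ⟨fun x y hxy => Finsupp.lhom_ext' fun f => LinearMap.ext_ring (congrFun hxy f),
    fun c => ⟨Finsupp.lift ℂ ℂ _ c, funext fun f => ?_⟩⟩
  simp

-- A morphism `u` from `X` to `A ⊔ B` cuts `X` into two preimages and restricts to morphisms `l u`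
-- and `r u`. The products of the corresponding basis elements, placed in the summand of this
-- decomposition, form a basis dual to the translates of `pair e e'`. This is the isomorphism of
-- `J_A ⊗ J_B` with `J_{A ⊔ B}`.
open scoped Classical in
theorem IsFree.tensor {M N : ModD n} {A B : U n} {e : Module.Dual ℂ (M.obj.obj A.toD)}
    {e' : Module.Dual ℂ (N.obj.obj B.toD)} (h : IsFree M A e) (h' : IsFree N B e') :
    IsFree (M ⊗ N) (A ⊗ B) (pair (S := A.toD) (T := B.toD) e e') := by
  have hl : ∀ {X : D n} (u : X ⟶ A.toD ⊗ B.toD),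
      ∃ (f : X.sub (u.equiv ⁻¹' D.left A.toD B.toD) ⟶ A.toD)
        (g : X.sub (u.equiv ⁻¹' D.left A.toD B.toD)ᶜ ⟶ B.toD),
        (D.glue X _).hom ≫ u = f ⊗ₘ g := by
    intro X u
    refine (D.exists_tensorHom_iff _).2 ?_
    rintro (⟨x, hx⟩ | ⟨x, hx⟩)
    · exact hx
    · exact Bool.eq_false_of_not_eq_true hx
  choose l r hlr using @hl
  have hb : ∀ {X : D n} (u w : X ⟶ A.toD ⊗ B.toD),
      pair (S := A.toD) (T := B.toD) e e' (((M ⊗ N).obj.map w).hom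
        (summand _ (h.basis (l u)) (h'.basis (r u)))) = if u = w then 1 else 0 := by
    intro X u w
    rw [summand_eq, map_map]
    by_cases huw : u = w
    · subst huw
      rw [hlr, pair_map_tensorHom, h.basis_spec, h'.basis_spec, if_pos rfl, if_pos rfl, if_pos rfl,
        mul_one]
    · rw [if_neg huw]
      by_cases hw : ∃ (f : X.sub (u.equiv ⁻¹' D.left A.toD B.toD) ⟶ A.toD)
        (g : X.sub (u.equiv ⁻¹' D.left A.toD B.toD)ᶜ ⟶ B.toD), (D.glue X _).hom ≫ w = f ⊗ₘ g
      · obtain ⟨f, g, hfg⟩ := hw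
        rw [hfg, pair_map_tensorHom, h.basis_spec, h'.basis_spec]
        by_cases hf : l u = f
        · have hr : r u ≠ g := by
            rintro rfl
            rw [← hf, ← hlr, cancel_epi] at hfg
            exact huw hfg.symm
          rw [if_neg hr, mul_zero]
        · rw [if_neg hf, zero_mul]
      · exact pair_map_eq_zero (S := A.toD) (T := B.toD) _ _ _ hw _ _
  refine IsFree.of_basis (fun {X} u => summand _ (h.basis (l u)) (h'.basis (r u)))
    (fun {X} u w => hb u w) fun {X} x hx => ?_
  -- The functionals killing all elements annihilated by the translates of `pair e e'` form a
  -- submodule stable under `U n`. It contains every pairing, since `φ` and `ψ` are combinations of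
  -- translates of `e` and `e'`; so it is everything.
  · have key : ∀ (S : U n) (ℓ : (dual (M ⊗ N)).obj S) (y : (M ⊗ N).obj.obj S.toD),
        (∀ u : S.toD ⟶ A.toD ⊗ B.toD, pair (S := A.toD) (T := B.toD) e e'
            (((M ⊗ N).obj.map u).hom y) = 0) →
          (show Module.Dual ℂ ((M ⊗ N).obj.obj S.toD) from ℓ) y = 0 := by
      intro S ℓ
      refine mem_of_dualPair_mem (M := M) (N := N) (fun S =>
        { carrier := {ℓ | ∀ y : (M ⊗ N).obj.obj S.toD,
            (∀ u : S.toD ⟶ A.toD ⊗ B.toD, pair (S := A.toD) (T := B.toD) e e'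
              (((M ⊗ N).obj.map u).hom y) = 0) →
            (show Module.Dual ℂ ((M ⊗ N).obj.obj S.toD) from ℓ) y = 0}
          add_mem' := fun {a b} ha hb y hy => (congrArg₂ (· + ·) (ha y hy) (hb y hy)).trans
            (add_zero _)
          zero_mem' := fun y hy => rfl
          smul_mem' := fun c a ha y hy => (congrArg (c * ·) (ha y hy)).trans (mul_zero _) })
        (fun {S T} f ℓ hℓ y hy => hℓ _ fun u => by rw [map_map]; exact hy _) ?_ ℓ
      intro S T φ ψ
      rw [h.dual_eq_sum φ, h'.dual_eq_sum ψ]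
      simp only [map_sum, LinearMap.sum_apply, map_smul, LinearMap.smul_apply]
      refine Submodule.sum_mem _ fun f _ => Submodule.smul_mem _ _
        (Submodule.sum_mem _ fun g _ => Submodule.smul_mem _ _ ?_)
      intro y hy
      exact (LinearMap.congr_fun (show pair _ _ = _ from
        dualPair_map (U.ofD g) (U.ofD f) e e') y).trans (hy (U.invD (U.ofD g ⊗ₘ U.ofD f)))
    rw [← Module.forall_dual_apply_eq_zero_iff ℂ]
    exact fun ℓ => key ⟨X.toWSet⟩ ℓ x hx

end Free

/-! ### Coherence of the pairing, stated for the functors `dual`. -/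

section DualTensor

variable {M N P : ModD n} {S T W : U n}

variable (n) in
/-- The canonical functional on the unit, as an element of its dual. -/
noncomputable def dualUnit : (dual (𝟙_ (ModD n))).obj (𝟙_ (U n)) := unitFun n

theorem dualMap_tensorHom {M' N' : ModD n} (f : M ⟶ M') (g : N ⟶ N') (φ : (dual M').obj S)
    (ψ : (dual N').obj T) :
    ((dualMap (f ⊗ₘ g)).app (S ⊗ T)).hom (dualPair M' N' S T φ ψ) =
      dualPair M N S T (((dualMap f).app S).hom φ) (((dualMap g).app T).hom ψ) :=
  pair_comp_tensorHom (S := S.toD) (T := T.toD) φ ψ f g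

theorem dualMap_associator (φ : (dual M).obj S) (ψ : (dual N).obj T) (χ : (dual P).obj W) :
    ((dualMap (α_ M N P).hom).app (S ⊗ T ⊗ W)).hom
        (dualPair M (N ⊗ P) S (T ⊗ W) φ (dualPair N P T W ψ χ)) =
      ((dual ((M ⊗ N) ⊗ P)).map (α_ S T W).hom).hom
        (dualPair (M ⊗ N) P (S ⊗ T) W (dualPair M N S T φ ψ) χ) :=
  pair_associator (S := S.toD) (T := T.toD) (W := W.toD) φ ψ χ

theorem dualMap_braiding (φ : (dual M).obj S) (ψ : (dual N).obj T) :
    ((dualMap (β_ M N).hom).app (T ⊗ S)).hom (dualPair N M T S ψ φ) =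
      ((dual (M ⊗ N)).map (β_ S T).hom).hom (dualPair M N S T φ ψ) :=
  pair_braiding (S := S.toD) (T := T.toD) φ ψ

theorem dualMap_leftUnitor (φ : (dual M).obj S) :
    ((dualMap (λ_ M).hom).app S).hom φ =
      ((dual (𝟙_ (ModD n) ⊗ M)).map (λ_ S).hom).hom
        (dualPair (𝟙_ (ModD n)) M (𝟙_ (U n)) S (dualUnit n) φ) :=
  pair_leftUnitor (S := S.toD) φ

end DualTensor

/-! ### Tensor products of universal families. -/

section Biuniversal

variable {C : Type u} [Category.{v} C] [Abelian C] [Linear ℂ C]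
  [MonoidalCategory C] [SymmetricCategory C] [MonoidalPreadditive C] [MonoidalLinear ℂ C]

/-- The functor `(S, T) ↦ K(S) ⊗ K'(T)`. -/
abbrev tensorBifunctor (K K' : U n ⥤ C) : U n ⥤ U n ⥤ C :=
  K ⋙ curriedTensor C ⋙ (Functor.whiskeringLeft _ _ _).obj K'

variable [∀ X : C, PreservesFiniteLimits (tensorLeft X)]

instance (X : C) : PreservesFiniteLimits (tensorRight X) :=
  preservesFiniteLimits_of_natIso (BraidedCategory.tensorLeftIsoTensorRight X)

variable {Q Q' : U n ⥤ Vect} {K K' : U n ⥤ C} {P P' : C} {t : ToStructuredHom P Q K}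
  {t' : ToStructuredHom P' Q' K'}

/-- Left exactness of the tensor product in each variable makes `P ⊗ P'` universal over the `P ⊗
K'(T)`, and each of these universal over the `K(S) ⊗ K'(T)`. -/
theorem ToStructuredHom.IsUniversal.tensor_hom_ext (ht : t.IsUniversal) (ht' : t'.IsUniversal)
    (p : Presentation Q) (p' : Presentation Q') {X : C} {f g : X ⟶ P ⊗ P'}
    (h : ∀ S T m m', f ≫ (t.app S m ⊗ₘ t'.app T m') = g ≫ (t.app S m ⊗ₘ t'.app T m')) :
    f = g := by
  refine (ht'.map p' (tensorLeft P)).hom_ext fun T m' => ?_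
  refine (ht.map p (tensorRight (K'.obj T))).hom_ext fun S m => ?_
  have := h S T m m'
  rw [tensorHom_def'] at this
  refine (Category.assoc _ _ _).trans (Eq.trans (show (f ≫ P ◁ t'.app T m' ≫ t.app S m ▷ K'.obj T =
    g ≫ P ◁ t'.app T m' ≫ t.app S m ▷ K'.obj T) from this)
    (Category.assoc _ _ _).symm)

/-- One variable at a time: for fixed `m'` the bifamily lifts to a morphism to `P ⊗ K'(T)`, and
these lifts form a family in `m'`, which lifts to `P ⊗ P'`. With `tensor_hom_ext` this gives the
mapping property of `P ⊗ P'`. -/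
theorem ToStructuredHom.IsUniversal.exists_tensor_lift (ht : t.IsUniversal)
    (ht' : t'.IsUniversal) (p : Presentation Q) (p' : Presentation Q') {X : C}
    (b : Bifamily X Q Q' (tensorBifunctor K K')) :
    ∃ f : X ⟶ P ⊗ P', ∀ S T m m', f ≫ (t.app S m ⊗ₘ t'.app T m') = b.app S T m m' := by
  have hT := fun T => ht.map p (tensorRight (K'.obj T))
  let b₁ (T : U n) (m' : Q'.obj T) : ToStructuredHom X Q (K ⋙ tensorRight (K'.obj T)) :=
    { app := fun S => (b.app S T).flip m'
      naturality := fun {S S'} f m => by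
        have := b.naturality f (𝟙 T) m m'
        rw [Q'.map_id] at this
        refine this.trans ?_
        change b.app S T m m' ≫ K.map f ▷ K'.obj T ≫ K.obj S' ◁ K'.map (𝟙 T) = _
        rw [K'.map_id, MonoidalCategory.whiskerLeft_id, Category.comp_id]
        rfl }
  have hg : ∀ T m' S m, (hT T).lift (b₁ T m') ≫ t.app S m ▷ K'.obj T = b.app S T m m' :=
    fun T m' S m => (hT T).lift_app (b₁ T m') S m
  let s : ToStructuredHom X Q' (K' ⋙ tensorLeft P) :=
    { app := fun T =>
        { toFun := fun m' => (hT T).lift (b₁ T m')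
          map_add' := fun x y => (hT T).hom_ext fun S m => by
            refine (hg T _ S m).trans ?_
            rw [map_add, Preadditive.add_comp]
            exact congrArg₂ (· + ·) (hg T x S m).symm (hg T y S m).symm
          map_smul' := fun c x => (hT T).hom_ext fun S m => by
            refine (hg T _ S m).trans ?_
            rw [map_smul, Linear.smul_comp]
            exact congrArg (c • ·) (hg T x S m).symm }
      naturality := fun {T T'} f m' => (hT T').hom_ext fun S m => by
        refine (hg T' _ S m).trans ?_
        have := b.naturality (𝟙 S) f m m'
        rw [Q.map_id] at this
        refine this.trans ?_
        change b.app S T m m' ≫ K.map (𝟙 S) ▷ K'.obj T ≫ K.obj S ◁ K'.map f =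
          ((hT T).lift (b₁ T m') ≫ P ◁ K'.map f) ≫ t.app S m ▷ K'.obj T'
        rw [Category.assoc, whisker_exchange, ← Category.assoc _ (t.app S m ▷ _), hg, K.map_id,
          id_whiskerRight]
        exact congrArg (_ ≫ ·) (Category.id_comp _) }
  refine ⟨(ht'.map p' (tensorLeft P)).lift s, fun S T m m' => ?_⟩
  rw [tensorHom_def']
  have h1 : (ht'.map p' (tensorLeft P)).lift s ≫ P ◁ t'.app T m' = (hT T).lift (b₁ T m') :=
    (ht'.map p' (tensorLeft P)).lift_app s T m'
  rw [reassoc_of% h1, hg]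

end Biuniversal

/-! ### The lax symmetric monoidal structure on `N ↦ N ⊙ K`. -/

section OdotLax

open Functor.LaxMonoidal Functor.OplaxMonoidal

variable {C : Type u} [Category.{v} C] [Abelian C] [Linear ℂ C]
  [MonoidalCategory C] [SymmetricCategory C] [MonoidalPreadditive C] [MonoidalLinear ℂ C]

theorem odot_tensor_hom_ext {K : U n ⥤ C} {M N : ModD n} {X : C} {f g : X ⟶ (odot K).obj (M ⊗ N)}
    (h : ∀ S T φ ψ, f ≫ (odotEv K (M ⊗ N)).app (S ⊗ T) (dualPair M N S T φ ψ) =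
      g ≫ (odotEv K (M ⊗ N)).app (S ⊗ T) (dualPair M N S T φ ψ)) : f = g := by
  have key : (odotEv K (M ⊗ N)).precomp f = (odotEv K (M ⊗ N)).precomp g :=
    ToStructuredHom.tensor_ext h
  exact odot_hom_ext fun S φ =>
    LinearMap.congr_fun (congrFun (congrArg ToStructuredHom.app key) S) φ

variable (K : U n ⥤ C) [K.LaxBraided] (M N P : ModD n)

/-- The pairing of the universal families on `M ⊙ K` and `N ⊙ K`. -/
noncomputable def evPair :
    Bifamily ((odot K).obj M ⊗ (odot K).obj N) (dual M) (dual N) (unionBifunctor K) where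
  app S T := LinearMap.mk₂ ℂ
    (fun φ ψ => ((odotEv K M).app S φ ⊗ₘ (odotEv K N).app T ψ) ≫ μ K S T)
    (fun φ φ' ψ => by
      rw [map_add, MonoidalPreadditive.add_tensor, Preadditive.add_comp])
    (fun c φ ψ => by
      rw [map_smul, MonoidalCategory.tensorHom_def, MonoidalLinear.smul_whiskerRight, Linear.smul_comp,
        Linear.smul_comp, ← MonoidalCategory.tensorHom_def])
    (fun φ ψ ψ' => by
      rw [map_add, MonoidalPreadditive.tensor_add, Preadditive.add_comp])
    (fun c φ ψ => by
      rw [map_smul, MonoidalCategory.tensorHom_def, MonoidalLinear.whiskerLeft_smul, Linear.comp_smul,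
        Linear.smul_comp, ← MonoidalCategory.tensorHom_def])
  naturality {S S' T T'} f g φ ψ := by
    change ((odotEv K M).app S' _ ⊗ₘ (odotEv K N).app T' _) ≫ μ K S' T' =
      (((odotEv K M).app S φ ⊗ₘ (odotEv K N).app T ψ) ≫ μ K S T) ≫ K.map (f ▷ T) ≫ K.map (S' ◁ g)
    rw [(odotEv K M).naturality, (odotEv K N).naturality, ← K.map_comp,
      ← MonoidalCategory.tensorHom_def, ← tensorHom_comp_tensorHom, Category.assoc, Category.assoc,
      μ_natural]

/-- The lax structure on `N ↦ N ⊙ K`. -/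
noncomputable def odotMu : (odot K).obj M ⊗ (odot K).obj N ⟶ (odot K).obj (M ⊗ N) :=
  (odotEv_isUniversal K (M ⊗ N)).lift (evPair K M N).union

variable {M N P}

theorem odotMu_ev {S T : U n} (φ : (dual M).obj S) (ψ : (dual N).obj T) :
    odotMu K M N ≫ (odotEv K (M ⊗ N)).app (S ⊗ T) (dualPair M N S T φ ψ) =
      ((odotEv K M).app S φ ⊗ₘ (odotEv K N).app T ψ) ≫ μ K S T :=
  ((odotEv_isUniversal K (M ⊗ N)).lift_app _ _ _).trans ((evPair K M N).union_pair S T φ ψ)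

theorem odotMu_ev_assoc {S T : U n} (φ : (dual M).obj S) (ψ : (dual N).obj T) {Z : C}
    (g : K.obj (S ⊗ T) ⟶ Z) :
    odotMu K M N ≫ (odotEv K (M ⊗ N)).app (S ⊗ T) (dualPair M N S T φ ψ) ≫ g =
      ((odotEv K M).app S φ ⊗ₘ (odotEv K N).app T ψ) ≫ μ K S T ≫ g := by
  rw [← Category.assoc, odotMu_ev, Category.assoc]

/-- The unit of the lax structure on `N ↦ N ⊙ K`. -/
noncomputable def odotEps : 𝟙_ C ⟶ (odot K).obj (𝟙_ (ModD n)) :=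
  (odotEv_isUniversal K (𝟙_ (ModD n))).lift (isFree_unit.family (ε K))

theorem odotEps_ev : odotEps K ≫ (odotEv K (𝟙_ (ModD n))).app (𝟙_ (U n)) (dualUnit n) = ε K :=
  ((odotEv_isUniversal K (𝟙_ (ModD n))).lift_app _ _ _).trans (isFree_unit.family_app (ε K))

theorem odotEps_ev_assoc {Z : C} (g : K.obj (𝟙_ (U n)) ⟶ Z) :
    odotEps K ≫ (odotEv K (𝟙_ (ModD n))).app (𝟙_ (U n)) (dualUnit n) ≫ g = ε K ≫ g := by
  rw [← Category.assoc, odotEps_ev]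

/-- Here, as for the braiding and associativity below, a morphism to the value at a tensor product
is tested on pairings. The claim then reduces to the same property of `K` and of `dualPair`. -/
theorem odotMu_natural {M' N' : ModD n} (f : M ⟶ M') (g : N ⟶ N') :
    ((odot K).map f ⊗ₘ (odot K).map g) ≫ odotMu K M' N' =
      odotMu K M N ≫ (odot K).map (f ⊗ₘ g) := by
  refine odot_tensor_hom_ext fun S T φ ψ => ?_
  rw [Category.assoc, Category.assoc, odotMu_ev, odot_map_ev, dualMap_tensorHom, odotMu_ev,
    tensorHom_comp_tensorHom_assoc, odot_map_ev, odot_map_ev]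

theorem odot_braided : odotMu K M N ≫ (odot K).map (β_ M N).hom =
    (β_ ((odot K).obj M) ((odot K).obj N)).hom ≫ odotMu K N M := by
  refine odot_tensor_hom_ext fun T S ψ φ => ?_
  rw [Category.assoc, Category.assoc, odotMu_ev, odot_map_ev, dualMap_braiding,
    (odotEv K _).naturality, odotMu_ev_assoc, Functor.LaxBraided.braided,
    BraidedCategory.braiding_naturality_assoc]

theorem odot_left_unitality : (λ_ ((odot K).obj M)).hom =
    (odotEps K ⊗ₘ 𝟙 ((odot K).obj M)) ≫ odotMu K (𝟙_ _) M ≫ (odot K).map (λ_ M).hom := by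
  refine odot_hom_ext fun S φ => ?_
  rw [Category.assoc, Category.assoc, odot_map_ev, dualMap_leftUnitor, (odotEv K _).naturality,
    odotMu_ev_assoc, tensorHom_comp_tensorHom_assoc, odotEps_ev, Category.id_comp,
    ← leftUnitor_naturality, Functor.LaxMonoidal.left_unitality, tensorHom_def', Category.assoc]

theorem odot_tensor_hom_ext₃ {X : C} {f g : X ⟶ (odot K).obj (M ⊗ N ⊗ P)}
    (h : ∀ S T W φ ψ χ, f ≫ (odotEv K (M ⊗ N ⊗ P)).app (S ⊗ T ⊗ W)
        (dualPair M (N ⊗ P) S (T ⊗ W) φ (dualPair N P T W ψ χ)) =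
      g ≫ (odotEv K (M ⊗ N ⊗ P)).app (S ⊗ T ⊗ W)
        (dualPair M (N ⊗ P) S (T ⊗ W) φ (dualPair N P T W ψ χ))) : f = g := by
  have key : (odotEv K (M ⊗ N ⊗ P)).precomp f = (odotEv K (M ⊗ N ⊗ P)).precomp g :=
    ToStructuredHom.tensor_ext₃ h
  exact odot_hom_ext fun S φ =>
    LinearMap.congr_fun (congrFun (congrArg ToStructuredHom.app key) S) φ

theorem odot_associativity :
    (odotMu K M N ⊗ₘ 𝟙 ((odot K).obj P)) ≫ odotMu K (M ⊗ N) P ≫ (odot K).map (α_ M N P).hom =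
      (α_ _ _ _).hom ≫ (𝟙 ((odot K).obj M) ⊗ₘ odotMu K N P) ≫ odotMu K M (N ⊗ P) := by
  refine odot_tensor_hom_ext₃ K fun S T W φ ψ χ => ?_
  simp only [Category.assoc]
  rw [odotMu_ev, odot_map_ev, dualMap_associator, (odotEv K _).naturality, odotMu_ev_assoc,
    tensorHom_comp_tensorHom_assoc, tensorHom_comp_tensorHom_assoc, odotMu_ev, odotMu_ev,
    Category.id_comp, Category.id_comp]
  have h1 : (((odotEv K M).app S φ ⊗ₘ (odotEv K N).app T ψ) ≫ μ K S T ⊗ₘ (odotEv K P).app W χ) =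
      (((odotEv K M).app S φ ⊗ₘ (odotEv K N).app T ψ) ⊗ₘ (odotEv K P).app W χ) ≫
        μ K S T ▷ K.obj W := by
    rw [← tensorHom_id, tensorHom_comp_tensorHom, Category.comp_id]
  have h2 : ((odotEv K M).app S φ ⊗ₘ ((odotEv K N).app T ψ ⊗ₘ (odotEv K P).app W χ) ≫ μ K T W) =
      ((odotEv K M).app S φ ⊗ₘ ((odotEv K N).app T ψ ⊗ₘ (odotEv K P).app W χ)) ≫
        K.obj S ◁ μ K T W := by
    rw [← id_tensorHom, tensorHom_comp_tensorHom, Category.comp_id]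
  rw [h1, h2, Category.assoc, Functor.LaxMonoidal.associativity, Category.assoc, associator_naturality_assoc]

noncomputable instance odotLaxBraided : (odot K).LaxBraided where
  toLaxMonoidal := Functor.LaxMonoidal.ofTensorHom (odotEps K) (odotMu K)
    (fun f g => odotMu_natural K f g) (fun M N P => odot_associativity K)
    (fun M => odot_left_unitality K) (fun M => by
      -- Right unitality follows from left unitality by the symmetry.
      rw [← braiding_leftUnitor, odot_left_unitality K (M := M), ← braiding_leftUnitor M,
        ← BraidedCategory.braiding_naturality_assoc, (odot K).map_comp,
        reassoc_of% (odot_braided K (M := M) (N := 𝟙_ (ModD n)))])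
  braided M N := odot_braided K

theorem odot_μ : μ (odot K) M N = odotMu K M N := rfl

theorem odot_ε : ε (odot K) = odotEps (n := n) K := rfl

end OdotLax

/-! ### The monoidal structure on `N ↦ N ⊙ K` is strong when that of `K` is. -/

section OdotStrong

open Functor.LaxMonoidal Functor.OplaxMonoidal

variable {C : Type u} [Category.{v} C] [Abelian C] [Linear ℂ C]
  [MonoidalCategory C] [SymmetricCategory C] [MonoidalPreadditive C] [MonoidalLinear ℂ C]
  [∀ X : C, PreservesFiniteLimits (tensorLeft X)]

variable (K : U n ⥤ C) [K.Braided] (M N : ModD n)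

/-- The splitting of the universal family on `(M ⊗ N) ⊙ K`. -/
noncomputable def evSplit :
    Bifamily ((odot K).obj (M ⊗ N)) (dual M) (dual N) (tensorBifunctor K K) where
  app S T := (dualPair M N S T).compr₂
    (Linear.rightComp ℂ _ (δ K S T) ∘ₗ (odotEv K (M ⊗ N)).app (S ⊗ T))
  naturality {S S' T T'} f g φ ψ := by
    change (odotEv K (M ⊗ N)).app (S' ⊗ T') (dualPair M N S' T' _ _) ≫ δ K S' T' =
      ((odotEv K (M ⊗ N)).app (S ⊗ T) (dualPair M N S T φ ψ) ≫ δ K S T) ≫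
        K.map f ▷ K.obj T ≫ K.obj S' ◁ K.map g
    rw [dualPair_map, (odotEv K _).naturality, Category.assoc, Category.assoc,
      ← MonoidalCategory.tensorHom_def, δ_natural]

/-- The inverse comes from the mapping property of `(M ⊙ K) ⊗ (N ⊙ K)`, applied to the universal
family on `(M ⊗ N) ⊙ K` split by `δ` of `K`. -/
instance : IsIso (μ (odot K) M N) := by
  obtain ⟨f, hf⟩ := (odotEv_isUniversal K M).exists_tensor_lift (odotEv_isUniversal K N)
    (presentation M) (presentation N) (evSplit K M N)
  have hf' : ∀ S T φ ψ, f ≫ ((odotEv K M).app S φ ⊗ₘ (odotEv K N).app T ψ) =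
    (odotEv K (M ⊗ N)).app (S ⊗ T) (dualPair M N S T φ ψ) ≫ δ K S T := hf
  rw [odot_μ]
  refine ⟨f, (odotEv_isUniversal K M).tensor_hom_ext (odotEv_isUniversal K N)
    (presentation M) (presentation N) fun S T φ ψ => ?_, odot_tensor_hom_ext fun S T φ ψ => ?_⟩
  · rw [Category.assoc, hf', odotMu_ev_assoc, Functor.Monoidal.μ_δ, Category.comp_id,
      Category.id_comp]
  · rw [Category.assoc, odotMu_ev, reassoc_of% (hf' S T φ ψ), Functor.Monoidal.δ_μ,
      Category.comp_id, Category.id_comp]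

/-- The dual of the unit is free on `dualUnit`, so evaluation there identifies its structured tensor
product with `K(∅)`, and `η` of `K` goes on to the unit of `C`. -/
instance : IsIso (ε (odot (n := n) K)) := by
  rw [odot_ε]
  refine ⟨(odotEv K (𝟙_ (ModD n))).app (𝟙_ (U n)) (dualUnit n) ≫ η K, ?_, ?_⟩
  · rw [odotEps_ev_assoc, Functor.Monoidal.ε_η]
  · have key : (odotEv K (𝟙_ (ModD n))).precomp
        (((odotEv K (𝟙_ (ModD n))).app (𝟙_ (U n)) (dualUnit n) ≫ η K) ≫ odotEps K) =
        (odotEv K (𝟙_ (ModD n))).precomp (𝟙 _) := by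
      refine isFree_unit.hom_ext ?_
      change (((odotEv K (𝟙_ (ModD n))).app (𝟙_ (U n)) (dualUnit n) ≫ η K) ≫ odotEps K) ≫
        (odotEv K (𝟙_ (ModD n))).app (𝟙_ (U n)) (dualUnit n) = 𝟙 _ ≫
        (odotEv K (𝟙_ (ModD n))).app (𝟙_ (U n)) (dualUnit n)
      rw [Category.assoc, odotEps_ev, Category.assoc, Functor.Monoidal.η_ε, Category.comp_id,
        Category.id_comp]
    exact odot_hom_ext fun S φ =>
      LinearMap.congr_fun (congrFun (congrArg ToStructuredHom.app key) S) φ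

noncomputable instance odotBraided : (odot (n := n) K).Braided where
  toMonoidal := Functor.Monoidal.ofLaxMonoidal _
  braided _ _ := odot_braided K

end OdotStrong

/-! ### Monoidal transformations of `K` induce monoidal transformations. -/

section OdotMap

open Functor.LaxMonoidal

variable {C : Type u} [Category.{v} C] [Abelian C] [Linear ℂ C]
  [MonoidalCategory C] [SymmetricCategory C] [MonoidalPreadditive C] [MonoidalLinear ℂ C]
  [∀ X : C, PreservesFiniteLimits (tensorLeft X)]

instance odotMap_isMonoidal {K K' : U n ⥤ C} [K.Braided] [K'.Braided] (k : K ⟶ K')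
    [NatTrans.IsMonoidal k] : NatTrans.IsMonoidal (odotMap k) where
  unit := by
    change odotEps K ≫ _ = odotEps K'
    have key : (odotEv K' (𝟙_ (ModD n))).precomp (odotEps K ≫ (odotMap k).app _) =
        (odotEv K' (𝟙_ (ModD n))).precomp (odotEps K') := by
      refine isFree_unit.hom_ext ?_
      change (odotEps K ≫ (odotMap k).app _) ≫
        (odotEv K' (𝟙_ (ModD n))).app (𝟙_ (U n)) (dualUnit n) = odotEps K' ≫
        (odotEv K' (𝟙_ (ModD n))).app (𝟙_ (U n)) (dualUnit n)
      rw [Category.assoc, odotMap_ev, odotEps_ev_assoc, odotEps_ev, NatTrans.IsMonoidal.unit]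
    exact odot_hom_ext fun S φ =>
      LinearMap.congr_fun (congrFun (congrArg ToStructuredHom.app key) S) φ
  tensor M N := by
    change odotMu K M N ≫ _ = _ ≫ odotMu K' M N
    refine odot_tensor_hom_ext fun S T φ ψ => ?_
    rw [Category.assoc, Category.assoc, odotMap_ev, odotMu_ev_assoc, odotMu_ev,
      NatTrans.IsMonoidal.tensor, tensorHom_comp_tensorHom_assoc, tensorHom_comp_tensorHom_assoc,
      odotMap_ev, odotMap_ev]

end OdotMap

/-! ### The principal injectives: Yoneda, universality and tensor structure. -/

section Injectives

open Functor.LaxMonoidal Functor.OplaxMonoidal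

variable {M N : ModD n}

theorem dualMap_comp {N N' N'' : ModD n} (f : N ⟶ N') (g : N' ⟶ N'') (S : U n)
    (φ : (dual N'').obj S) : ((dualMap (f ≫ g)).app S).hom φ =
      ((dualMap f).app S).hom (((dualMap g).app S).hom φ) := rfl

theorem dualMap_map {N N' : ModD n} (f : N ⟶ N') {S T : U n} (u : S ⟶ T)
    (φ : (dual N').obj S) : ((dualMap f).app T).hom (((dual N').map u).hom φ) =
      ((dual N).map u).hom (((dualMap f).app S).hom φ) :=
  ConcreteCategory.congr_hom ((dualMap f).naturality u) φ

theorem dualMap_add {N N' : ModD n} (f g : N ⟶ N') (S : U n) (φ : (dual N').obj S) :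
    ((dualMap (f + g)).app S).hom φ = ((dualMap f).app S).hom φ + ((dualMap g).app S).hom φ :=
  LinearMap.ext fun _ => map_add (show Module.Dual ℂ (N'.obj.obj S.toD) from φ) _ _

theorem dualMap_smul {N N' : ModD n} (c : ℂ) (f : N ⟶ N') (S : U n) (φ : (dual N').obj S) :
    ((dualMap (c • f)).app S).hom φ = c • ((dualMap f).app S).hom φ :=
  LinearMap.ext fun _ => map_smul (show Module.Dual ℂ (N'.obj.obj S.toD) from φ) _ _

/-- The canonical functional on `J_A(A)`, as an element of the dual of `J_A`. -/
noncomputable def injElt (A : U n) : (dual ((principalInjective n).obj A)).obj A := injFun A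

/-- The morphism `N ⟶ J_A` corresponding to a functional on `N(A)`. -/
noncomputable def toInj {A : U n} (φ : (dual N).obj A) : N ⟶ (principalInjective n).obj A :=
  ObjectProperty.homMk
    { app X := ModuleCat.ofHom (Finsupp.lift (N.obj.obj X →ₗ[ℂ] ℂ) ℂ (X ⟶ A.toD) fun f =>
        (show Module.Dual ℂ (N.obj.obj A.toD) from φ) ∘ₗ (N.obj.map f).hom).flip
      naturality X Y f := by
        refine ModuleCat.hom_ext (LinearMap.ext fun (x : N.obj.obj X) =>
          Finsupp.lhom_ext' (α := Y ⟶ A.toD) (M := ℂ) fun g => LinearMap.ext_ring ?_)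
        change (Finsupp.lift (N.obj.obj Y →ₗ[ℂ] ℂ) ℂ (Y ⟶ A.toD) fun f =>
            (show Module.Dual ℂ (N.obj.obj A.toD) from φ) ∘ₗ (N.obj.map f).hom)
            (Finsupp.single g 1) ((N.obj.map f).hom x) =
          (Finsupp.lift (N.obj.obj X →ₗ[ℂ] ℂ) ℂ (X ⟶ A.toD) fun f =>
            (show Module.Dual ℂ (N.obj.obj A.toD) from φ) ∘ₗ (N.obj.map f).hom)
            (Finsupp.mapDomain (f ≫ ·) (Finsupp.single g 1)) x
        rw [Finsupp.mapDomain_single]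
        simp only [Finsupp.lift_apply, Finsupp.sum_single_index, zero_smul, one_smul]
        exact congrArg (show Module.Dual ℂ (N.obj.obj A.toD) from φ) (map_map f g x) }

/-- With `toInj_hom_ext`, this is the Yoneda lemma: morphisms from `N` to `J_A` are functionals on
`N(A)`. Identities between morphisms to `J_A` are proved below by evaluating at `injElt A`. -/
theorem dualMap_toInj {A : U n} (φ : (dual N).obj A) :
    ((dualMap (toInj φ)).app A).hom (injElt A) = φ := by
  refine LinearMap.ext fun (x : N.obj.obj A.toD) => ?_
  change (Finsupp.lift (N.obj.obj A.toD →ₗ[ℂ] ℂ) ℂ (A.toD ⟶ A.toD) fun f =>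
    (show Module.Dual ℂ (N.obj.obj A.toD) from φ) ∘ₗ (N.obj.map f).hom)
    (Finsupp.single (𝟙 _) 1) x = (show Module.Dual ℂ (N.obj.obj A.toD) from φ) x
  simp only [Finsupp.lift_apply, Finsupp.sum_single_index, zero_smul, one_smul]
  rw [N.obj.map_id]
  rfl

theorem IsFree.mod_hom_ext {A : U n} {e : Module.Dual ℂ (M.obj.obj A.toD)} (h : IsFree M A e)
    {f g : N ⟶ M} (hfg : ∀ x, e ((f.hom.app A.toD).hom x) = e ((g.hom.app A.toD).hom x)) :
    f = g := by
  refine ObjectProperty.hom_ext _ (NatTrans.ext (funext fun X => ModuleCat.hom_ext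
    (LinearMap.ext fun x => h.ext fun u => ?_)))
  rw [← naturality_apply, ← naturality_apply, hfg]

theorem toInj_hom_ext {A : U n} {f g : N ⟶ (principalInjective n).obj A}
    (h : ((dualMap f).app A).hom (injElt A) = ((dualMap g).app A).hom (injElt A)) : f = g :=
  (isFree_inj A).mod_hom_ext (LinearMap.congr_fun h)

/-- Both modules are identified at `X` with the functions on `Hom(X, A)`, and `f` is compatible with
these identifications. -/
theorem IsFree.isIso {A : U n} {e e'} (h : IsFree M A e) (h' : IsFree N A e') (f : N ⟶ M)
    (hf : ∀ x, e ((f.hom.app A.toD).hom x) = e' x) : IsIso f := by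
  have hbij : ∀ X, Function.Bijective (f.hom.app X).hom := by
    intro X
    refine (Function.Bijective.of_comp_iff' (h X) _).1 ?_
    convert h' X using 1
    refine funext fun x => funext fun u => ?_
    refine Eq.trans ?_ (hf _)
    exact congrArg e (naturality_apply f u x).symm
  have : ∀ X, IsIso (f.hom.app X) := fun X => (ConcreteCategory.isIso_iff_bijective _).2 (hbij X)
  have : IsIso f.hom := NatIso.isIso_of_isIso_app _
  have : IsIso ((IsModule n).ι.map f) := this
  exact isIso_of_reflects_iso f (IsModule n).ι

theorem dualMap_injMap {A B : U n} (f : A ⟶ B) :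
    ((dualMap ((principalInjective n).map f)).app B).hom (injElt B) =
      ((dual ((principalInjective n).obj A)).map f).hom (injElt A) := by
  refine LinearMap.ext fun (x : Module.Dual ℂ ((B.toD ⟶ A.toD) →₀ ℂ)) => ?_
  refine Eq.trans ?_ (injFun_map A (U.invD f) x).symm
  change x (Finsupp.mapDomain (· ≫ U.invD f) (Finsupp.single (𝟙 _) 1)) = _
  rw [Finsupp.mapDomain_single, Category.id_comp]

theorem toInj_map {A B : U n} (f : A ⟶ B) (φ : (dual N).obj A) :
    toInj (((dual N).map f).hom φ) = toInj φ ≫ (principalInjective n).map f := by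
  refine toInj_hom_ext ?_
  rw [dualMap_toInj, dualMap_comp, dualMap_injMap, dualMap_map, dualMap_toInj]

variable (N) in
/-- The family of all morphisms from `N` to the principal injectives. -/
noncomputable def injFamily : ToStructuredHom N (dual N) (principalInjective n) where
  app S :=
    { toFun := toInj
      map_add' := fun φ ψ => toInj_hom_ext (by
        rw [dualMap_toInj, dualMap_add, dualMap_toInj, dualMap_toInj])
      map_smul' := fun c φ => toInj_hom_ext (by
        rw [dualMap_toInj, RingHom.id_apply, dualMap_smul, dualMap_toInj]) }
  naturality f φ := toInj_map f φ

-- By Yoneda, a family from `X` with values in the principal injectives is a natural map `N^∨ →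
-- X^∨`. Its transpose, composed with biduality of the finite dimensional `N(S)`, is a morphism `X ⟶
-- N`. Thus `N` is the structured tensor product of `N` with `J`.
variable (N) in
theorem injFamily_isUniversal : (injFamily N).IsUniversal := by
  intro X s
  -- The map `N^∨ → X^∨` sends `φ` to the functional corresponding to the morphism from `X` to `J_S`
  -- given by `s`.
  let σ (S : U n) : (dual N).obj S →ₗ[ℂ] (dual X).obj S :=
    { toFun := fun φ => ((dualMap (s.app S φ)).app S).hom (injElt S)
      map_add' := fun φ ψ => by rw [map_add, dualMap_add]
      map_smul' := fun c φ => by rw [map_smul, dualMap_smul, RingHom.id_apply] }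
  have hσ : ∀ {S T : U n} (f : S ⟶ T) (φ : (dual N).obj S),
      σ T (((dual N).map f).hom φ) = ((dual X).map f).hom (σ S φ) := by
    intro S T f φ
    change ((dualMap (s.app T _)).app T).hom (injElt T) = _
    rw [s.naturality, dualMap_comp, dualMap_injMap, dualMap_map]
    rfl
  let f₀ (S : D n) : X.obj.obj S →ₗ[ℂ] N.obj.obj S :=
    (Module.evalEquiv ℂ (N.obj.obj S)).symm.toLinearMap ∘ₗ
      (show Module.Dual ℂ (N.obj.obj S) →ₗ[ℂ] Module.Dual ℂ (X.obj.obj S) from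
        σ ⟨S.toWSet⟩).dualMap ∘ₗ Module.Dual.eval ℂ (X.obj.obj S)
  have hf₀ : ∀ (S : D n) (φ : Module.Dual ℂ (N.obj.obj S)) (x : X.obj.obj S),
      φ (f₀ S x) = (show Module.Dual ℂ (X.obj.obj S) from σ ⟨S.toWSet⟩ φ) x := fun S φ x =>
    LinearMap.congr_fun ((Module.evalEquiv ℂ (N.obj.obj S)).apply_symm_apply _) φ
  have hsep : ∀ {S : D n} {x y : N.obj.obj S},
      (∀ φ : Module.Dual ℂ (N.obj.obj S), φ x = φ y) → x = y := fun {S x y} h =>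
    (Module.evalEquiv ℂ (N.obj.obj S)).injective (LinearMap.ext h)
  let f : X ⟶ N := ObjectProperty.homMk
    { app := fun S => ModuleCat.ofHom (f₀ S)
      naturality := fun S T u => ModuleCat.hom_ext (LinearMap.ext fun x => hsep fun φ => by
        refine (hf₀ T φ ((X.obj.map u).hom x)).trans ?_
        exact (LinearMap.congr_fun (show (show Module.Dual ℂ (X.obj.obj S) from _) = _ from
          hσ (S := ⟨T.toWSet⟩) (T := ⟨S.toWSet⟩) (U.ofD (S := ⟨S.toWSet⟩) (T := ⟨T.toWSet⟩) u) φ)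
          x).symm.trans (hf₀ S (φ ∘ₗ (N.obj.map u).hom) x).symm) }
  have hf : ∀ (S : U n) (φ : (dual N).obj S), ((dualMap f).app S).hom φ = σ S φ := fun S φ =>
    LinearMap.ext fun x => hf₀ S.toD φ x
  refine ⟨f, ToStructuredHom.ext (funext fun S => LinearMap.ext fun φ => toInj_hom_ext ?_),
    fun g hg => ?_⟩
  · change ((dualMap (f ≫ toInj φ)).app S).hom (injElt S) = σ S φ
    rw [dualMap_comp, dualMap_toInj, hf]
  · refine ObjectProperty.hom_ext _ (NatTrans.ext (funext fun S => ModuleCat.hom_ext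
      (LinearMap.ext fun x => hsep fun φ => ?_)))
    have h1 : ∀ (S : U n) (φ : (dual N).obj S),
        ((dualMap g).app S).hom φ = ((dualMap f).app S).hom φ := by
      intro S φ
      rw [hf]
      change _ = ((dualMap (s.app _ φ)).app _).hom (injElt _)
      rw [← hg]
      change _ = ((dualMap (g ≫ toInj _)).app _).hom (injElt _)
      rw [dualMap_comp, dualMap_toInj]
    exact LinearMap.congr_fun (h1 ⟨S.toWSet⟩ φ) x

variable (A B : U n)

/-- The map `J_A ⊗ J_B ⟶ J_{A ⊔ B}`. -/
noncomputable def injMu : (principalInjective n).obj A ⊗ (principalInjective n).obj B ⟶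
    (principalInjective n).obj (A ⊗ B) :=
  toInj (dualPair _ _ A B (injElt A) (injElt B))

variable {A B} in
-- A morphism given by a pairing factors through a tensor product of morphisms. This reduces
-- monoidality of `fromOdot` to that of `chainCounit`.
theorem dualPair_toInj (φ : (dual M).obj A) (ψ : (dual N).obj B) :
    toInj (dualPair M N A B φ ψ) = (toInj φ ⊗ₘ toInj ψ) ≫ injMu A B := by
  refine toInj_hom_ext ?_
  rw [dualMap_toInj, dualMap_comp, injMu, dualMap_toInj, dualMap_tensorHom, dualMap_toInj,
    dualMap_toInj]

theorem injMu_natural {A B A' B' : U n} (f : A ⟶ A') (g : B ⟶ B') :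
    ((principalInjective n).map f ⊗ₘ (principalInjective n).map g) ≫ injMu A' B' =
      injMu A B ≫ (principalInjective n).map (f ⊗ₘ g) := by
  refine toInj_hom_ext ?_
  rw [dualMap_comp, injMu, dualMap_toInj, dualMap_tensorHom, dualMap_injMap, dualMap_injMap,
    dualMap_comp, dualMap_injMap, dualMap_map, injMu, dualMap_toInj, dualPair_map]

theorem injMu_braided : injMu A B ≫ (principalInjective n).map (β_ A B).hom =
    (β_ _ _).hom ≫ injMu B A := by
  refine toInj_hom_ext ?_
  rw [dualMap_comp, dualMap_injMap, dualMap_map, dualMap_comp, injMu, injMu, dualMap_toInj,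
    dualMap_toInj, dualMap_braiding]

theorem injMu_left_unitality : (λ_ ((principalInjective n).obj A)).hom =
    (toInj (dualUnit n) ⊗ₘ 𝟙 _) ≫ injMu (𝟙_ _) A ≫ (principalInjective n).map (λ_ A).hom := by
  refine toInj_hom_ext ?_
  rw [dualMap_leftUnitor, dualMap_comp, dualMap_comp, dualMap_injMap, dualMap_map, dualMap_map,
    injMu, dualMap_toInj, dualMap_tensorHom, dualMap_toInj]
  rfl

theorem injMu_associativity (C : U n) :
    (injMu A B ⊗ₘ 𝟙 ((principalInjective n).obj C)) ≫ injMu (A ⊗ B) C ≫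
        (principalInjective n).map (α_ A B C).hom =
      (α_ _ _ _).hom ≫ (𝟙 ((principalInjective n).obj A) ⊗ₘ injMu B C) ≫ injMu A (B ⊗ C) := by
  refine toInj_hom_ext ?_
  have h : ∀ A : U n, ((dualMap (𝟙 ((principalInjective n).obj A))).app A).hom (injElt A) =
    injElt A := fun _ => rfl
  have h1 : ((dualMap (injMu A B)).app (A ⊗ B)).hom (injElt (A ⊗ B)) = _ := dualMap_toInj _
  have h2 : ((dualMap (injMu B C)).app (B ⊗ C)).hom (injElt (B ⊗ C)) = _ := dualMap_toInj _
  have h3 : ((dualMap (injMu (A ⊗ B) C)).app ((A ⊗ B) ⊗ C)).hom (injElt _) = _ := dualMap_toInj _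
  have h4 : ((dualMap (injMu A (B ⊗ C))).app (A ⊗ B ⊗ C)).hom (injElt _) = _ := dualMap_toInj _
  rw [dualMap_comp, dualMap_comp, dualMap_injMap, dualMap_map, dualMap_map, h3, dualMap_tensorHom,
    h1, h, dualMap_comp, dualMap_comp, h4, dualMap_tensorHom, h2, h, dualMap_associator]

noncomputable instance : (principalInjective n).LaxBraided where
  toLaxMonoidal := Functor.LaxMonoidal.ofTensorHom (toInj (dualUnit n)) injMu
    (fun f g => injMu_natural f g) injMu_associativity injMu_left_unitality (fun A => by
      rw [← braiding_leftUnitor, injMu_left_unitality, ← braiding_leftUnitor A,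
        ← BraidedCategory.braiding_naturality_assoc, (principalInjective n).map_comp,
        reassoc_of% (injMu_braided A (𝟙_ _))])
  braided A B := injMu_braided A B

instance : IsIso (ε (principalInjective n)) :=
  (isFree_inj (𝟙_ (U n))).isIso isFree_unit _ (LinearMap.congr_fun (dualMap_toInj (dualUnit n)))

/-- Source and target are both free at `A ⊔ B`, and the tensorator matches their functionals. -/
instance : IsIso (μ (principalInjective n) A B) :=
  (isFree_inj (A ⊗ B)).isIso ((isFree_inj A).tensor (isFree_inj B)) _
    (LinearMap.congr_fun (dualMap_toInj (dualPair _ _ A B (injElt A) (injElt B))))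

noncomputable instance : (principalInjective n).Braided where
  toMonoidal := Functor.Monoidal.ofLaxMonoidal _
  braided A B := injMu_braided A B

end Injectives

/-! ### Tensor products of concatenated lists. -/

section Append

variable {ι : Type} {C : Type u} [Category.{v} C] [MonoidalCategory C]

/-- The lemmas ending in `_step` are inductive steps of statements about lists, with the tensor
products over sublists replaced by arbitrary objects. -/
theorem append_nat_step {a a' t t' s s' l l' : C} (f : a ⟶ a') (k : t ⟶ t') (m : s ⟶ s')
    (q : t ⊗ s ⟶ l) (q' : t' ⊗ s' ⟶ l') (k' : l ⟶ l') (h : (k ⊗ₘ m) ≫ q' = q ≫ k') :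
    ((f ⊗ₘ k) ⊗ₘ m) ≫ ((α_ a' t' s').hom ≫ a' ◁ q') = ((α_ a t s).hom ≫ a ◁ q) ≫ (f ⊗ₘ k') := by
  rw [associator_naturality_assoc, Category.assoc, ← id_tensorHom, ← id_tensorHom,
    tensorHom_comp_tensorHom, tensorHom_comp_tensorHom, h, Category.comp_id, Category.id_comp]

theorem append_arr_step {b t t' s s' l l' l'' : C} (k : t ⟶ t') (m : s ⟶ s')
    (q : t ⊗ s ⟶ l) (q' : t' ⊗ s' ⟶ l') (k' : l ⟶ l'') (r : l' ⟶ l'')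
    (h : (k ⊗ₘ m) ≫ q' ≫ r = q ≫ k') :
    (b ◁ k ⊗ₘ m) ≫ ((α_ b t' s').hom ≫ b ◁ q') ≫ (b ◁ r ≫ 𝟙 _) =
      ((α_ b t s).hom ≫ b ◁ q) ≫ b ◁ k' := by
  rw [Category.comp_id, ← id_tensorHom b k, Category.assoc, ← whiskerLeft_comp,
    append_nat_step (𝟙 b) k m q (q' ≫ r) k' h, id_tensorHom]

theorem append_assoc_step {a t y z ty l yz L : C} (q : t ⊗ y ⟶ ty) (q' : ty ⊗ z ⟶ l)
    (r : l ⟶ L) (k : y ⊗ z ⟶ yz) (k' : t ⊗ yz ⟶ L)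
    (h : q ▷ z ≫ q' ≫ r = (α_ t y z).hom ≫ t ◁ k ≫ k') :
    ((α_ a t y).hom ≫ a ◁ q) ▷ z ≫ ((α_ a ty z).hom ≫ a ◁ q') ≫ (a ◁ r ≫ 𝟙 _) =
      (α_ (a ⊗ t) y z).hom ≫ (a ⊗ t) ◁ k ≫ ((α_ a t yz).hom ≫ a ◁ k') := by
  have h' := congrArg (fun f => a ◁ f) h
  simp only [whiskerLeft_comp] at h'
  simp only [comp_whiskerRight, Category.assoc, Category.comp_id, associator_naturality_middle_assoc,
    h', tensor_whiskerLeft, Iso.inv_hom_id_assoc, pentagon_assoc]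

theorem append_nil_step {a t l : C} (q : t ⊗ 𝟙_ C ⟶ l) (r : t ⟶ l) (h : (ρ_ t).hom ≫ r = q) :
    (ρ_ (a ⊗ t)).hom ≫ (a ◁ r ≫ 𝟙 _) = (α_ a t (𝟙_ C)).hom ≫ a ◁ q := by
  rw [← h]
  simp

variable [SymmetricCategory C]

theorem put_append_step {a b t m tm l lm bl : C} (P : a ⊗ t ⟶ l) (q : t ⊗ m ⟶ tm) (q' : l ⊗ m ⟶ lm)
    (P' : a ⊗ tm ⟶ lm) (h : P ▷ m ≫ q' = (α_ a t m).hom ≫ a ◁ q ≫ P') (e : b ⊗ lm ⟶ bl) :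
    (swap a b t ≫ b ◁ P) ▷ m ≫ ((α_ b l m).hom ≫ b ◁ q') ≫ e =
      (α_ a (b ⊗ t) m).hom ≫ a ◁ ((α_ b t m).hom ≫ b ◁ q) ≫ (swap a b tm ≫ b ◁ P') ≫ e := by
  have h' := congrArg (fun f => b ◁ f) h
  simp only [whiskerLeft_comp] at h'
  have hs := swap_naturality (𝟙 a) (𝟙 b) q
  simp only [id_tensorHom] at hs
  simp only [comp_whiskerRight, Category.assoc, associator_naturality_middle_assoc,
    reassoc_of% h', whiskerLeft_comp, reassoc_of% hs]
  dsimp only [swap]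
  monoidal

theorem put_middle_step {a b s t l L L' : C} (q : s ⊗ t ⟶ l) (P : a ⊗ l ⟶ L)
    (q' : s ⊗ a ⊗ t ⟶ L) (h : a ◁ q ≫ P = swap a s t ≫ q') (e : b ⊗ L ⟶ L') :
    a ◁ ((α_ b s t).hom ≫ b ◁ q) ≫ (swap a b l ≫ b ◁ P) ≫ e =
      swap a (b ⊗ s) t ≫ ((α_ b s (a ⊗ t)).hom ≫ b ◁ q') ≫ e := by
  have h' := congrArg (fun f => b ◁ f) h
  simp only [whiskerLeft_comp] at h'
  have hs := swap_naturality (𝟙 a) (𝟙 b) q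
  simp only [id_tensorHom] at hs
  simp only [whiskerLeft_comp, Category.assoc, reassoc_of% hs, reassoc_of% h']
  simp only [swap, BraidedCategory.braiding_tensor_right_hom]
  monoidal

theorem put_middle_nil (a t : C) : a ◁ (λ_ t).hom ≫ 𝟙 _ = swap a (𝟙_ C) t ≫ (λ_ (a ⊗ t)).hom := by
  simp only [swap, braiding_tensorUnit_right]
  monoidal

theorem append_braid_step {a t s l l' L : C} (q : t ⊗ s ⟶ l) (r : l ⟶ l') (q' : s ⊗ t ⟶ l')
    (P : a ⊗ l' ⟶ L) (k : s ⊗ a ⊗ t ⟶ L) (h : q ≫ r = (β_ t s).hom ≫ q')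
    (h' : a ◁ q' ≫ P = swap a s t ≫ k) :
    ((α_ a t s).hom ≫ a ◁ q) ≫ (a ◁ r ≫ P) = (β_ (a ⊗ t) s).hom ≫ k := by
  have h2 := congrArg (fun f => a ◁ f) h
  simp only [whiskerLeft_comp] at h2
  simp only [Category.assoc, reassoc_of% h2, h']
  simp only [swap, BraidedCategory.braiding_tensor_left_hom, Category.assoc]

theorem arrange_append_step {a t t' l m tm tm' lm : C} (p : t ⟶ t') (P : a ⊗ t' ⟶ l)
    (q : t ⊗ m ⟶ tm) (q' : t' ⊗ m ⟶ tm') (k : l ⊗ m ⟶ lm) (P' : a ⊗ tm' ⟶ lm) (r : tm ⟶ tm')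
    (h : p ▷ m ≫ q' = q ≫ r) (h' : P ▷ m ≫ k = (α_ a t' m).hom ≫ a ◁ q' ≫ P') :
    (a ◁ p ≫ P) ▷ m ≫ k = ((α_ a t m).hom ≫ a ◁ q) ≫ (a ◁ r ≫ P') := by
  have h2 := congrArg (fun f => a ◁ f) h
  simp only [whiskerLeft_comp] at h2
  simp only [comp_whiskerRight, Category.assoc, h', associator_naturality_middle_assoc,
    reassoc_of% h2]

/-- The tensor product of a concatenation of lists. -/
def append (A : ι → C) : ∀ l l' : List ι, tens A l ⊗ tens A l' ⟶ tens A (l ++ l')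
  | [], l' => (λ_ (tens A l')).hom
  | a :: t, l' => (α_ (A a) (tens A t) (tens A l')).hom ≫ A a ◁ append A t l'

theorem append_tensMap {A B : ι → C} (f : ∀ a, A a ⟶ B a) : ∀ l l' : List ι,
    (tensMap f l ⊗ₘ tensMap f l') ≫ append B l l' = append A l l' ≫ tensMap f (l ++ l')
  | [], l' => by
    refine (congrArg (· ≫ (λ_ (tens B l')).hom) (id_tensorHom (𝟙_ C) (tensMap f l'))).trans ?_
    exact leftUnitor_naturality _
  | a :: t, l' => append_nat_step _ _ _ _ _ _ (append_tensMap f t l')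

/-- The two lists are equal, but not by definition; a rearrangement takes the place of a transport,
here and in `append_assoc` and `append_nil`. -/
theorem append_relabel {κ : Type} (φ : ι → κ) (B : κ → C) : ∀ l l' : List ι,
    ∃ p : Arr (l.map φ ++ l'.map φ) ((l ++ l').map φ),
      (relabel φ B l ⊗ₘ relabel φ B l') ≫ append B (l.map φ) (l'.map φ) ≫ arrange B p =
        append (fun a => B (φ a)) l l' ≫ relabel φ B (l ++ l')
  | [], l' => by
    refine ⟨Arr.id _, ?_⟩
    rw [arrange_id, Category.comp_id]
    refine (congrArg (· ≫ (λ_ (tens B (l'.map φ))).hom)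
      (id_tensorHom (𝟙_ C) (relabel φ B l'))).trans ?_
    exact leftUnitor_naturality _
  | a :: t, l' => by
    obtain ⟨p, hp⟩ := append_relabel φ B t l'
    exact ⟨.cons p (.here _), append_arr_step _ _ _ _ _ _ hp⟩

theorem append_assoc (A : ι → C) : ∀ l l' l'' : List ι,
    ∃ p : Arr (l ++ l' ++ l'') (l ++ (l' ++ l'')),
      append A l l' ▷ tens A l'' ≫ append A (l ++ l') l'' ≫ arrange A p =
        (α_ _ _ _).hom ≫ tens A l ◁ append A l' l'' ≫ append A l (l' ++ l'')
  | [], l', l'' => by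
    refine ⟨Arr.id _, ?_⟩
    rw [arrange_id, Category.comp_id]
    change (λ_ (tens A l')).hom ▷ tens A l'' ≫ append A l' l'' =
      (α_ (𝟙_ C) (tens A l') (tens A l'')).hom ≫ 𝟙_ C ◁ append A l' l'' ≫
        (λ_ (tens A (l' ++ l''))).hom
    simp
  | a :: t, l', l'' => by
    obtain ⟨p, hp⟩ := append_assoc A t l' l''
    exact ⟨.cons p (.here _), append_assoc_step _ _ _ _ _ hp⟩

theorem append_nil (A : ι → C) : ∀ l : List ι, ∃ p : Arr l (l ++ []),
    (ρ_ (tens A l)).hom ≫ arrange A p = append A l []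
  | [] => ⟨.nil, (Category.comp_id _).trans unitors_equal.symm⟩
  | a :: t => by
    obtain ⟨p, hp⟩ := append_nil A t
    exact ⟨.cons p (.here _), append_nil_step _ _ hp⟩

theorem put_append (A : ι → C) {a : ι} (m : List ι) : ∀ {t l : List ι} (i : Ins a t l),
    ∃ i' : Ins a (t ++ m) (l ++ m), put A i ▷ tens A m ≫ append A l m =
      (α_ _ _ _).hom ≫ A a ◁ append A t m ≫ put A i'
  | _, _, .here t => by
    refine ⟨.here _, ?_⟩
    refine (congrArg (· ≫ append A (a :: t) m) (id_whiskerRight (A a ⊗ tens A t) _)).trans ?_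
    refine (Category.id_comp _).trans ?_
    exact congrArg (_ ≫ ·) (Category.comp_id _).symm
  | _, _, .there b i => by
    obtain ⟨i', hi⟩ := put_append A m i
    refine ⟨.there b i', ?_⟩
    have := put_append_step (b := A b) _ _ _ _ hi (𝟙 _)
    rw [Category.comp_id, Category.comp_id] at this
    exact this

/-- By the hexagon, moving `a` past the factors of `l` one at a time is the braiding with the whole
of `tens A l`. This is the inductive step for `append_braid`. -/
theorem put_middle (A : ι → C) (a : ι) (t : List ι) : ∀ l : List ι,
    ∃ i : Ins a (l ++ t) (l ++ a :: t), A a ◁ append A l t ≫ put A i =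
      swap (A a) (tens A l) (tens A t) ≫ append A l (a :: t)
  | [] => ⟨.here _, put_middle_nil _ _⟩
  | b :: l => by
    obtain ⟨i, hi⟩ := put_middle A a t l
    refine ⟨.there b i, ?_⟩
    have := put_middle_step (b := A b) _ _ _ hi (𝟙 _)
    rw [Category.comp_id, Category.comp_id] at this
    exact this

theorem append_braid (A : ι → C) (l' : List ι) : ∀ l : List ι,
    ∃ p : Arr (l ++ l') (l' ++ l), append A l l' ≫ arrange A p = (β_ _ _).hom ≫ append A l' l
  | [] => by
    obtain ⟨p, hp⟩ := append_nil A l'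
    refine ⟨p, ?_⟩
    rw [← hp]
    change (λ_ (tens A l')).hom ≫ _ = (β_ (𝟙_ C) (tens A l')).hom ≫ _
    rw [braiding_rightUnitor_assoc]
  | a :: t => by
    obtain ⟨p, hp⟩ := append_braid A l' t
    obtain ⟨i, hi⟩ := put_middle A a t l'
    exact ⟨.cons p i, append_braid_step _ _ _ _ _ hp hi⟩

theorem arrange_append_left (A : ι → C) (m : List ι) : ∀ {l l' : List ι} (p : Arr l l'),
    ∃ r : Arr (l ++ m) (l' ++ m),
      arrange A p ▷ tens A m ≫ append A l' m = append A l m ≫ arrange A r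
  | _, _, .nil => by
    refine ⟨Arr.id _, ?_⟩
    rw [arrange_id, Category.comp_id]
    refine (congrArg (· ≫ append A [] m) (id_whiskerRight (𝟙_ C) _)).trans ?_
    exact Category.id_comp _
  | _, _, .cons p i => by
    obtain ⟨r, hr⟩ := arrange_append_left A m p
    obtain ⟨i', hi⟩ := put_append A m i
    exact ⟨.cons r i', arrange_append_step _ _ _ _ _ _ _ hr hi⟩

theorem arrange_append_right (A : ι → C) {m m' : List ι} (q : Arr m m') : ∀ l : List ι,
    ∃ r : Arr (l ++ m) (l ++ m'),
      tens A l ◁ arrange A q ≫ append A l m' = append A l m ≫ arrange A r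
  | [] => ⟨q, leftUnitor_naturality _⟩
  | a :: t => by
    obtain ⟨r, hr⟩ := arrange_append_right A q t
    refine ⟨.cons r (.here _), ?_⟩
    have := append_arr_step (b := A a) (𝟙 (tens A t)) (arrange A q) _ (append A t m')
      (arrange A r) (𝟙 _) (by rw [id_tensorHom, Category.comp_id, hr])
    rw [MonoidalCategory.whiskerLeft_id, id_tensorHom] at this
    refine Eq.trans ?_ (this.trans ?_)
    · refine congrArg (_ ≫ ·) ?_
      rw [MonoidalCategory.whiskerLeft_id, Category.comp_id]
      exact (Category.comp_id _).symm
    · exact congrArg (_ ≫ ·) (Category.comp_id _).symm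

end Append

/-! ### Equality up to rearrangement of tensor factors. -/

section Sim

variable {ι κ : Type} {C : Type u} [Category.{v} C] [MonoidalCategory C] [SymmetricCategory C]

theorem put_inv_step {a b t l : C} (P : a ⊗ t ⟶ l) (r : l ⟶ a ⊗ t) (h : P ≫ r = 𝟙 _) :
    (swap a b t ≫ b ◁ P) ≫ (b ◁ r ≫ (swap b a t ≫ a ◁ 𝟙 _)) = 𝟙 _ := by
  rw [MonoidalCategory.whiskerLeft_id, Category.comp_id, Category.assoc,
    ← whiskerLeft_comp_assoc, h, MonoidalCategory.whiskerLeft_id, Category.id_comp, swap_swap]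

theorem put_inv (A : ι → C) {a : ι} : ∀ {t l : List ι} (i : Ins a t l),
    ∃ p : Arr l (a :: t), put A i ≫ arrange A p = 𝟙 (tens A (a :: t))
  | _, _, .here t => ⟨Arr.id _, by rw [arrange_id]; exact Category.comp_id _⟩
  | _, _, .there b i => by
    obtain ⟨p, hp⟩ := put_inv A i
    exact ⟨.cons p (.there a (.here _)), put_inv_step _ _ hp⟩

theorem arrange_inv_step {a t t' l : C} (p : t ⟶ t') (P : a ⊗ t' ⟶ l) (r : l ⟶ a ⊗ t')
    (q : t' ⟶ t) (h : P ≫ r = 𝟙 _) (h' : p ≫ q = 𝟙 _) :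
    (a ◁ p ≫ P) ≫ r ≫ (a ◁ q ≫ 𝟙 _) = 𝟙 _ := by
  rw [Category.comp_id, Category.assoc, reassoc_of% h, ← whiskerLeft_comp, h',
    MonoidalCategory.whiskerLeft_id]

theorem arrange_inv (A : ι → C) : ∀ {l l' : List ι} (p : Arr l l'),
    ∃ q : Arr l' l, arrange A p ≫ arrange A q = 𝟙 _
  | _, _, .nil => ⟨.nil, Category.comp_id _⟩
  | _, _, .cons p i => by
    obtain ⟨q, hq⟩ := arrange_inv A p
    obtain ⟨r, hr⟩ := put_inv A i
    obtain ⟨s, hs⟩ := arrange_comp A r (.cons q (.here _))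
    refine ⟨s, ?_⟩
    rw [← hs]
    exact arrange_inv_step _ _ _ _ hr hq

/-- Every rearrangement has a right inverse which is again a rearrangement, and so has a right
inverse too; hence the inverse is two-sided. -/
theorem isIso_arrange (A : ι → C) {l l' : List ι} (p : Arr l l') : IsIso (arrange A p) := by
  obtain ⟨q, hq⟩ := arrange_inv A p
  obtain ⟨r, hr⟩ := arrange_inv A q
  have : arrange A p = arrange A r := by
    rw [← Category.comp_id (arrange A p), ← hr, reassoc_of% hq]
  exact ⟨arrange A q, hq, by rw [this, hr]⟩

/-- Two morphisms to tensor products of lists are similar if they differ by a rearrangement. -/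
def Sim (A : ι → C) {X : C} {l l' : List ι} (f : X ⟶ tens A l) (g : X ⟶ tens A l') : Prop :=
  ∃ p : Arr l l', f ≫ arrange A p = g

/-- The tensor product of two morphisms to tensor products of lists. -/
def merge {A : ι → C} {X Y : C} {l m : List ι} (f : X ⟶ tens A l) (g : Y ⟶ tens A m) :
    X ⊗ Y ⟶ tens A (l ++ m) := (f ⊗ₘ g) ≫ append A l m

namespace Sim

variable {A : ι → C} {X Y Z : C} {l l' l'' m m' : List ι} {f : X ⟶ tens A l} {g : X ⟶ tens A l'}
  {h : X ⟶ tens A l''}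

theorem refl (f : X ⟶ tens A l) : Sim A f f := ⟨Arr.id l, by rw [arrange_id, Category.comp_id]⟩

theorem of_eq {f f' : X ⟶ tens A l} (h : f = f') : Sim A f f' := h ▸ refl f

theorem arrange (f : X ⟶ tens A l) (p : Arr l l') : Sim A f (f ≫ arrange A p) := ⟨p, rfl⟩

theorem symm : Sim A f g → Sim A g f := by
  rintro ⟨p, rfl⟩
  obtain ⟨q, hq⟩ := arrange_inv A p
  exact ⟨q, by rw [Category.assoc, hq, Category.comp_id]⟩

theorem trans : Sim A f g → Sim A g h → Sim A f h := by
  rintro ⟨p, rfl⟩ ⟨q, rfl⟩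
  obtain ⟨r, hr⟩ := arrange_comp A p q
  exact ⟨r, by rw [Category.assoc, hr]⟩

/-- The coherence principle: a list without repetitions has only the identity rearrangement to
itself. Identities for `𝒦` are therefore proved up to rearrangement, and made exact at the end by
`order_nodup`. -/
theorem eq {f f' : X ⟶ tens A l} (h : Sim A f f') (hl : l.Nodup) : f = f' := by
  obtain ⟨p, rfl⟩ := h
  rw [arrange_eq A p (Arr.id l) hl, arrange_id, Category.comp_id]

theorem precomp (k : Y ⟶ X) (hfg : Sim A f g) : Sim A (k ≫ f) (k ≫ g) := by
  obtain ⟨p, rfl⟩ := hfg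
  exact ⟨p, Category.assoc _ _ _⟩

theorem merge {f' : Y ⟶ tens A m} {g' : Y ⟶ tens A m'} (hf : Sim A f g) (hf' : Sim A f' g') :
    Sim A (merge f f') (WeightedSets.merge g g') := by
  obtain ⟨p, rfl⟩ := hf
  obtain ⟨q, rfl⟩ := hf'
  obtain ⟨r, hr⟩ := arrange_append_left A m p
  obtain ⟨s, hs⟩ := arrange_append_right A q l'
  have h1 : Sim A (WeightedSets.merge f f')
      ((f ⊗ₘ f') ≫ WeightedSets.arrange A p ▷ tens A m ≫ append A l' m) :=
    ⟨r, by rw [WeightedSets.merge, Category.assoc, hr]⟩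
  refine h1.trans ⟨s, ?_⟩
  rw [Category.assoc, Category.assoc, ← hs, WeightedSets.merge, ← Category.assoc (_ ▷ _),
    ← MonoidalCategory.tensorHom_def, tensorHom_comp_tensorHom_assoc]

variable (f : X ⟶ tens A l) (g : Y ⟶ tens A l') (k : Z ⟶ tens A l'')

theorem merge_braid : Sim A ((β_ X Y).hom ≫ WeightedSets.merge g f)
    (WeightedSets.merge f g) := by
  obtain ⟨p, hp⟩ := append_braid A l' l
  refine symm ⟨p, ?_⟩
  rw [WeightedSets.merge, WeightedSets.merge, Category.assoc, hp,
    BraidedCategory.braiding_naturality_assoc]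

theorem merge_assoc : Sim A (WeightedSets.merge (WeightedSets.merge f g) k)
    ((α_ X Y Z).hom ≫ WeightedSets.merge f (WeightedSets.merge g k)) := by
  obtain ⟨p, hp⟩ := append_assoc A l l' l''
  refine ⟨p, ?_⟩
  have h1 : WeightedSets.merge (WeightedSets.merge f g) k =
      ((f ⊗ₘ g) ⊗ₘ k) ≫ append A l l' ▷ _ ≫ append A _ _ := by
    rw [← tensorHom_id, tensorHom_comp_tensorHom_assoc, Category.comp_id]
    rfl
  have h2 : WeightedSets.merge f (WeightedSets.merge g k) =
      (f ⊗ₘ (g ⊗ₘ k)) ≫ _ ◁ append A l' l'' ≫ append A _ _ := by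
    rw [← id_tensorHom, tensorHom_comp_tensorHom_assoc, Category.comp_id]
    rfl
  rw [h1, h2, Category.assoc, Category.assoc, hp, associator_naturality_assoc]

theorem merge_unit : WeightedSets.merge (l := []) (𝟙 (𝟙_ C)) f = (λ_ X).hom ≫ f := by
  refine (congrArg (· ≫ (λ_ (tens A l)).hom) (id_tensorHom (𝟙_ C) f)).trans ?_
  exact leftUnitor_naturality f

end Sim

theorem precomp_merge {A : ι → C} {X Y X' Y' : C} {l m : List ι} (a : X' ⟶ X) (b : Y' ⟶ Y)
    (f : X ⟶ tens A l) (g : Y ⟶ tens A m) : (a ⊗ₘ b) ≫ merge f g = merge (a ≫ f) (b ≫ g) :=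
  tensorHom_comp_tensorHom_assoc _ _ _ _ _

end Sim

/-! ### The lax symmetric monoidal structure on `𝒦(A)`. -/

section KBraided

variable {C : Type u} [Category.{v} C] [MonoidalCategory C] [SymmetricCategory C]

/-- A map of weighted sets which does not decrease weights. -/
structure U.Fn (S T : U n) where
  toFun : S.carrier → T.carrier
  weight_le : ∀ s, S.weight s ≤ T.weight (toFun s)

/-- The underlying function of a morphism. -/
def U.fn {S T : U n} (f : S ⟶ T) : U.Fn S T := ⟨f.equiv, f.weight_le⟩

/-- Composition of functions. -/
def U.Fn.comp {S T W : U n} (f : U.Fn S T) (g : U.Fn T W) : U.Fn S W :=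
  ⟨g.toFun ∘ f.toFun, fun s => (f.weight_le s).trans (g.weight_le _)⟩

/-- The inclusion of a summand. -/
def U.inl (S T : U n) : U.Fn S (S ⊗ T) := ⟨Sum.inl, fun _ => le_refl _⟩

/-- The inclusion of a summand. -/
def U.inr (S T : U n) : U.Fn T (S ⊗ T) := ⟨Sum.inr, fun _ => le_refl _⟩

variable (A : Fin n ⥤ C)

/-- The factors of `𝒦(S)`. -/
abbrev factor (S : U n) (s : S.carrier) : C := A.obj (S.weight s)

/-- The map on tensor products of lists induced by a function of weighted sets. -/
def kmap {S T : U n} (u : U.Fn S T) (l : List S.carrier) :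
    tens (factor A S) l ⟶ tens (factor A T) (l.map u.toFun) :=
  tensMap (B := fun s => factor A T (u.toFun s)) (fun s => A.map (homOfLE (u.weight_le s))) l ≫
    relabel u.toFun (factor A T) l

variable {A}

theorem Sim.kmap {S T : U n} (u : U.Fn S T) {X : C} {l l' : List S.carrier}
    {f : X ⟶ tens (factor A S) l} {g : X ⟶ tens (factor A S) l'} (h : Sim _ f g) :
    Sim _ (f ≫ kmap A u l) (g ≫ WeightedSets.kmap A u l') := by
  obtain ⟨p, rfl⟩ := h
  refine ⟨p.map u.toFun, ?_⟩
  have h2 := arrange_naturality (B := fun s => factor A T (u.toFun s))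
    (fun s => A.map (homOfLE (u.weight_le s))) p
  have h3 := arrange_relabel u.toFun (factor A T) p
  simp only [WeightedSets.kmap, Category.assoc]
  rw [reassoc_of% h2, h3]

/-- Functoriality holds up to rearrangement, which is enough for `Sim.eq`. Functions rather than
bijections are allowed so that the inclusions of `S` and `T` into `S ⊔ T` are covered. -/
theorem sim_kmap_comp {S T W : U n} (u : U.Fn S T) (v : U.Fn T W) (l : List S.carrier) :
    Sim _ (kmap A u l ≫ kmap A v (l.map u.toFun)) (kmap A (u.comp v) l) := by
  obtain ⟨p, hp⟩ := relabel_comp u.toFun v.toFun (factor A W) l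
  refine ⟨p, ?_⟩
  have h4 := relabel_naturality u.toFun (B' := fun s => factor A W (v.toFun s))
    (fun s => A.map (homOfLE (v.weight_le s))) l
  have h1 : (fun s => A.map (homOfLE ((u.comp v).weight_le s))) =
      fun s => A.map (homOfLE (u.weight_le s)) ≫ A.map (homOfLE (v.weight_le (u.toFun s))) :=
    funext fun s => A.map_comp (homOfLE (u.weight_le s)) (homOfLE (v.weight_le (u.toFun s)))
  simp only [kmap, Category.assoc]
  rw [reassoc_of% h4]
  refine (congrArg (fun k => tensMap _ l ≫ tensMap _ l ≫ k) hp).trans ?_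
  refine Eq.trans ?_ (congrArg (· ≫ _) ((congrArg (fun f => tensMap f l) h1).trans
    (tensMap_comp _ _ _))).symm
  exact (Category.assoc _ _ _).symm

theorem sim_kmap_id (S : U n) (l : List S.carrier) : Sim _ (kmap A (U.fn (𝟙 S)) l) (𝟙 _) := by
  obtain ⟨p, hp⟩ := relabel_id (factor A S) l
  refine ⟨p, ?_⟩
  have h1 : (fun s => A.map (homOfLE ((U.fn (𝟙 S)).weight_le s))) =
    fun s => 𝟙 (factor A S s) := funext fun s => A.map_id _
  exact (Category.assoc _ _ _).trans ((congrArg (fun f => f ≫ relabel id (factor A S) l ≫ arrange _ p)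
    ((congrArg (fun f => tensMap f l) h1).trans (tensMap_id _ _))).trans
      ((Category.id_comp _).trans hp))

theorem sim_merge_kmap {S T : U n} (u : U.Fn S T) {X Y : C} {l m : List S.carrier}
    (f : X ⟶ tens (factor A S) l) (g : Y ⟶ tens (factor A S) m) :
    Sim _ (merge (f ≫ kmap A u l) (g ≫ kmap A u m)) (merge f g ≫ kmap A u (l ++ m)) := by
  obtain ⟨p, hp⟩ := append_relabel u.toFun (factor A T) l m
  refine ⟨p, ?_⟩
  have h1 := append_tensMap (B := fun s => factor A T (u.toFun s))
    (fun s => A.map (homOfLE (u.weight_le s))) l m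
  simp only [merge, kmap, ← tensorHom_comp_tensorHom, Category.assoc]
  rw [hp, reassoc_of% h1]

theorem sim_map {S T : U n} (φ : S ⟶ T) :
    Sim _ (kmap A (U.fn φ) (order S)) ((kObj A).map φ) := by
  refine ⟨orderArr φ, ?_⟩
  rw [kmap, Category.assoc]
  rfl

theorem sim_comp_map {S T : U n} (φ : S ⟶ T) {X : C} {l : List S.carrier}
    {f : X ⟶ tens (factor A S) l} {g : X ⟶ (kObj A).obj S} (h : Sim _ f g) :
    Sim _ (f ≫ kmap A (U.fn φ) l) (g ≫ (kObj A).map φ) :=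
  (h.kmap _).trans ((sim_map φ).precomp g)

theorem mem_order (S : U n) (s : S.carrier) : s ∈ order S := by simp [order]

theorem order_append (S T : U n) :
    ((order S).map (U.inl S T).toFun ++ (order T).map (U.inr S T).toFun).Perm (order (S ⊗ T)) := by
  refine (List.perm_ext_iff_of_nodup (List.Nodup.append ((order_nodup S).map Sum.inl_injective)
    ((order_nodup T).map Sum.inr_injective) ?_) (order_nodup _)).2 fun x => ?_
  · intro x hx hx'
    obtain ⟨s, -, rfl⟩ := List.mem_map.1 hx
    obtain ⟨t, -, ht⟩ := List.mem_map.1 hx'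
    cases ht
  · refine iff_of_true ?_ (mem_order (S ⊗ T) x)
    obtain s | t := x
    · exact List.mem_append_left _ (List.mem_map.2 ⟨s, mem_order S s, rfl⟩)
    · exact List.mem_append_right _ (List.mem_map.2 ⟨t, mem_order T t, rfl⟩)

theorem order_unit : (order (𝟙_ (U n))) = [] :=
  List.eq_nil_iff_forall_not_mem.2 fun x => Empty.elim x

variable (A)

/-- The tensorator of `𝒦`. -/
noncomputable def kMu (S T : U n) : (kObj A).obj S ⊗ (kObj A).obj T ⟶ (kObj A).obj (S ⊗ T) :=
  merge (kmap A (U.inl S T) (order S)) (kmap A (U.inr S T) (order T)) ≫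
    arrange _ (Arr.exists (order_append S T)).some

/-- The unit of `𝒦`. -/
noncomputable def kEps : 𝟙_ C ⟶ (kObj A).obj (𝟙_ (U n)) :=
  𝟙 (tens (factor A (𝟙_ (U n))) []) ≫
    arrange _ (Arr.exists (List.Perm.of_eq order_unit.symm)).some

variable {A}

theorem sim_kMu (S T : U n) : Sim _ (merge (kmap A (U.inl S T) (order S))
    (kmap A (U.inr S T) (order T))) (kMu A S T) := .arrange _ _

theorem sim_kEps : Sim _ (𝟙 (tens (factor A (𝟙_ (U n))) [])) (kEps A) := .arrange _ _

/-- A normal form: only the functions from `S` and `T` to `W` matter, not the enumerations chosen on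
the way. The coherence laws below follow by comparing such normal forms. -/
theorem sim_kMu_map {S T W : U n} (φ : S ⊗ T ⟶ W) :
    Sim _ (merge (kmap A ((U.inl S T).comp (U.fn φ)) (order S))
      (kmap A ((U.inr S T).comp (U.fn φ)) (order T))) (kMu A S T ≫ (kObj A).map φ) :=
  ((sim_kmap_comp _ _ _).symm.merge (sim_kmap_comp _ _ _).symm).trans
    ((sim_merge_kmap _ _ _).trans (sim_comp_map φ (sim_kMu S T)))

theorem sim_map_kMu {S S' T T' : U n} (f : S ⟶ S') (g : T ⟶ T') :
    Sim _ (merge (kmap A ((U.fn f).comp (U.inl S' T')) (order S))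
      (kmap A ((U.fn g).comp (U.inr S' T')) (order T)))
      (((kObj A).map f ⊗ₘ (kObj A).map g) ≫ kMu A S' T') := by
  refine Sim.trans (.trans ?_ (.of_eq (precomp_merge _ _ _ _).symm)) ((sim_kMu S' T').precomp _)
  exact ((sim_kmap_comp _ _ _).symm.trans ((sim_map f).kmap _)).merge
    ((sim_kmap_comp _ _ _).symm.trans ((sim_map g).kmap _))

theorem kMu_natural {S S' T T' : U n} (f : S ⟶ S') (g : T ⟶ T') :
    ((kObj A).map f ⊗ₘ (kObj A).map g) ≫ kMu A S' T' = kMu A S T ≫ (kObj A).map (f ⊗ₘ g) :=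
  ((sim_map_kMu f g).symm.trans (sim_kMu_map (f ⊗ₘ g))).eq (order_nodup _)

theorem kMu_braided (S T : U n) : kMu A S T ≫ (kObj A).map (β_ S T).hom =
    (β_ _ _).hom ≫ kMu A T S :=
  ((sim_kMu_map (β_ S T).hom).symm.trans
    ((Sim.merge_braid _ _).symm.trans ((sim_kMu T S).precomp _))).eq (order_nodup _)

theorem kMu_left_unitality (S : U n) : (λ_ ((kObj A).obj S)).hom =
    (kEps A ⊗ₘ 𝟙 _) ≫ kMu A (𝟙_ _) S ≫ (kObj A).map (λ_ S).hom := by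
  refine Sim.eq (A := factor A S) (Sim.symm ?_) (order_nodup S)
  refine ((sim_kMu_map (λ_ S).hom).symm.precomp _).trans (.trans
    (.of_eq (precomp_merge _ _ _ _)) ?_)
  refine (Sim.merge ((sim_kEps.symm.kmap _).trans (.of_eq (Category.id_comp _)))
    ((Sim.of_eq (Category.id_comp _)).trans (sim_kmap_id S (order S)))).trans ?_
  refine (Sim.of_eq ?_).trans ((Sim.of_eq (Sim.merge_unit _)).trans
    (.of_eq (Category.comp_id _)))
  exact congrArg (fun f => merge (l := []) f _) (Category.id_comp _)

theorem sim_kMu_kMu {S T W : U n} (V : U n) (φ : (S ⊗ T) ⊗ W ⟶ V) :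
    Sim _ (merge (merge (kmap A (((U.inl S T).comp (U.inl (S ⊗ T) W)).comp (U.fn φ)) (order S))
      (kmap A (((U.inr S T).comp (U.inl (S ⊗ T) W)).comp (U.fn φ)) (order T)))
      (kmap A ((U.inr (S ⊗ T) W).comp (U.fn φ)) (order W)))
      ((kMu A S T ⊗ₘ 𝟙 _) ≫ kMu A (S ⊗ T) W ≫ (kObj A).map φ) := by
  refine Sim.trans (.trans ?_ (.of_eq (precomp_merge _ _ _ _).symm)) ((sim_kMu_map φ).precomp _)
  refine Sim.merge ?_ (.of_eq (Category.id_comp _).symm)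
  refine Sim.trans ?_ ((sim_kMu S T).kmap _)
  exact ((sim_kmap_comp (U.inl S T) ((U.inl (S ⊗ T) W).comp (U.fn φ)) _).symm.merge
    (sim_kmap_comp (U.inr S T) ((U.inl (S ⊗ T) W).comp (U.fn φ)) _).symm).trans
      (sim_merge_kmap _ _ _)

theorem kMu_associativity (S T W : U n) :
    (kMu A S T ⊗ₘ 𝟙 ((kObj A).obj W)) ≫ kMu A (S ⊗ T) W ≫ (kObj A).map (α_ S T W).hom =
      (α_ _ _ _).hom ≫ (𝟙 ((kObj A).obj S) ⊗ₘ kMu A T W) ≫ kMu A S (T ⊗ W) := by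
  refine Sim.eq (A := factor A (S ⊗ T ⊗ W)) ((sim_kMu_kMu _ (α_ S T W).hom).symm.trans ?_)
    (order_nodup _)
  refine (Sim.merge_assoc _ _ _).trans (Sim.precomp _ ?_)
  refine Sim.trans (.trans ?_ (.of_eq (precomp_merge _ _ _ _).symm))
    ((sim_kMu S (T ⊗ W)).precomp _)
  refine Sim.merge (.of_eq (Category.id_comp _).symm) ?_
  refine Sim.trans ?_ ((sim_kMu T W).kmap _)
  exact ((sim_kmap_comp (U.inl T W) (U.inr S (T ⊗ W)) _).symm.merge
    (sim_kmap_comp (U.inr T W) (U.inr S (T ⊗ W)) _).symm).trans (sim_merge_kmap _ _ _)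

variable (A) in
noncomputable instance kObjLaxBraided : (kObj A).LaxBraided where
  toLaxMonoidal := Functor.LaxMonoidal.ofTensorHom (kEps A) (kMu A)
    (fun f g => kMu_natural f g) kMu_associativity kMu_left_unitality (fun S => by
      rw [← braiding_leftUnitor, kMu_left_unitality, ← braiding_leftUnitor S,
        ← BraidedCategory.braiding_naturality_assoc, (kObj A).map_comp,
        reassoc_of% (kMu_braided (A := A) S (𝟙_ _))])
  braided S T := kMu_braided S T

end KBraided

/-! ### The tensorator of `𝒦(A)` is invertible and natural in `A`. -/

section KStrong

variable {C : Type u} [Category.{v} C] [MonoidalCategory C] [SymmetricCategory C]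

instance isIso_append {ι : Type} (A : ι → C) : ∀ l l' : List ι, IsIso (append A l l')
  | [], l' => inferInstanceAs (IsIso (λ_ (tens A l')).hom)
  | a :: t, l' => by
    have := isIso_append A t l'
    exact inferInstanceAs (IsIso ((α_ (A a) (tens A t) (tens A l')).hom ≫ A a ◁ append A t l'))

instance isIso_relabel {ι κ : Type} (φ : ι → κ) (B : κ → C) : ∀ l, IsIso (relabel φ B l)
  | [] => inferInstanceAs (IsIso (𝟙 (𝟙_ C)))
  | a :: t => by
    have := isIso_relabel φ B t
    exact inferInstanceAs (IsIso (B (φ a) ◁ relabel φ B t))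

theorem isIso_tensMap {ι : Type} {A B : ι → C} (f : ∀ i, A i ⟶ B i) (hf : ∀ i, IsIso (f i)) :
    ∀ l, IsIso (tensMap f l)
  | [] => inferInstanceAs (IsIso (𝟙 (𝟙_ C)))
  | a :: t => by
    have := isIso_tensMap f hf t
    have := hf a
    exact inferInstanceAs (IsIso (f a ⊗ₘ tensMap f t))

theorem isIso_map_of_eq (A : Fin n ⥤ C) {i j : Fin n} (h : i ≤ j) (e : i = j) :
    IsIso (A.map (homOfLE h)) := by
  subst e
  exact inferInstanceAs (IsIso (A.map (𝟙 i)))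

/-- When weights are preserved, as for the inclusions of summands, only identity maps of the chain
are applied. -/
theorem isIso_kmap (A : Fin n ⥤ C) {S T : U n} (u : U.Fn S T)
    (h : ∀ s, S.weight s = T.weight (u.toFun s)) (l : List S.carrier) : IsIso (kmap A u l) := by
  have := isIso_tensMap (B := fun s => factor A T (u.toFun s))
    (fun s => A.map (homOfLE (u.weight_le s))) (fun s => isIso_map_of_eq A _ (h s)) l
  rw [kmap]
  infer_instance

variable (A : Fin n ⥤ C)

theorem isIso_merge {ι : Type} {A : ι → C} {X Y : C} {l m : List ι} (f : X ⟶ tens A l)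
    (g : Y ⟶ tens A m) (_ : IsIso f) (_ : IsIso g) : IsIso (merge f g) :=
  inferInstanceAs (IsIso ((f ⊗ₘ g) ≫ append A l m))

instance (S T : U n) : IsIso (kMu A S T) :=
  IsIso.comp_isIso' (isIso_merge _ _ (isIso_kmap A (U.inl S T) (fun _ => rfl) (order S))
    (isIso_kmap A (U.inr S T) (fun _ => rfl) (order T))) (isIso_arrange _ _)

instance : IsIso (kEps A) := IsIso.comp_isIso' (inferInstanceAs (IsIso (𝟙 (𝟙_ C))))
  (isIso_arrange _ _)

theorem kObj_map {S T : U n} (φ : S ⟶ T) : (kObj A).map φ =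
    kmap A (U.fn φ) (order S) ≫ arrange (factor A T) (orderArr φ) :=
  (Category.assoc _ _ _).symm

instance (S T : U n) : IsIso (Functor.LaxMonoidal.μ (kObj A) S T) :=
  inferInstanceAs (IsIso (kMu A S T))

instance : IsIso (Functor.LaxMonoidal.ε (kObj A)) := inferInstanceAs (IsIso (kEps A))

noncomputable instance kObjBraided : (kObj A).Braided where
  toMonoidal := Functor.Monoidal.ofLaxMonoidal _
  braided S T := kMu_braided S T

theorem kmap_tensMap {A B : Fin n ⥤ C} (f : A ⟶ B) {S T : U n} (u : U.Fn S T)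
    (l : List S.carrier) : kmap A u l ≫ tensMap (fun t => f.app (T.weight t)) (l.map u.toFun) =
      tensMap (fun s => f.app (S.weight s)) l ≫ kmap B u l := by
  have h2 := relabel_naturality u.toFun (fun s => f.app (T.weight s)) l
  rw [kmap, Category.assoc]
  refine (congrArg (_ ≫ ·) h2).trans ?_
  rw [kmap, ← Category.assoc, ← Category.assoc]
  congr 1
  rw [← tensMap_comp, ← tensMap_comp]
  exact congrArg (fun g => tensMap g l) (funext fun s => f.naturality _)

theorem merge_tensMap {ι : Type} {A B : ι → C} (f : ∀ i, A i ⟶ B i) {X Y : C} {l m : List ι}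
    (g : X ⟶ tens A l) (h : Y ⟶ tens A m) : merge g h ≫ tensMap f (l ++ m) =
      merge (g ≫ tensMap f l) (h ≫ tensMap f m) := by
  rw [merge, merge, Category.assoc, ← append_tensMap, tensorHom_comp_tensorHom_assoc]

instance kFunctor_map_isMonoidal {A B : Fin n ⥤ C} (f : A ⟶ B) :
    NatTrans.IsMonoidal (F₁ := kObj A) (F₂ := kObj B) ((kFunctor n C).map f) where
  unit := by
    refine (Category.assoc _ _ _).trans ((Category.id_comp _).trans ((arrange_naturality
      (fun s => f.app ((𝟙_ (U n)).weight s)) _).trans ?_))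
    exact rfl
  tensor S T := by
    refine (Category.assoc _ _ _).trans ((congrArg (_ ≫ ·) (arrange_naturality
      (fun s => f.app ((S ⊗ T).weight s)) _)).trans ((Category.assoc _ _ _).symm.trans ?_))
    refine (congrArg (· ≫ _) ?_).trans (Category.assoc _ _ _)
    refine (merge_tensMap _ _ _).trans (Eq.trans ?_ (precomp_merge _ _ _ _).symm)
    exact congrArg₂ merge (kmap_tensMap f (U.inl S T) _) (kmap_tensMap f (U.inr S T) _)

end KStrong

/-! ### Monoidal functors and tensor products of lists. -/

section ListMu

open Functor.LaxMonoidal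

variable {ι κ : Type} {C : Type u} [Category.{v} C] [MonoidalCategory C] [SymmetricCategory C]
  {C' : Type u'} [Category.{v'} C'] [MonoidalCategory C'] [SymmetricCategory C']

section

variable (H : C ⥤ C') [H.LaxBraided]

/-- A lax braided functor respects the exchange of adjacent factors, the move from which all
rearrangements are built. -/
theorem map_swap (a b t : C) : H.obj a ◁ μ H b t ≫ μ H a (b ⊗ t) ≫ H.map (swap a b t) =
    swap (H.obj a) (H.obj b) (H.obj t) ≫ H.obj b ◁ μ H a t ≫ μ H b (a ⊗ t) := by
  simp only [swap, H.map_comp, Category.assoc]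
  rw [associativity_inv_assoc, ← μ_natural_left_assoc, ← comp_whiskerRight_assoc,
    Functor.LaxBraided.braided, comp_whiskerRight_assoc, Functor.LaxMonoidal.associativity]

theorem put_listMu_step {a b t l : C} {t' l' : C'} (P : H.obj a ⊗ t' ⟶ l') (k : t' ⟶ H.obj t)
    (k' : l' ⟶ H.obj l) (p : a ⊗ t ⟶ l) (h : P ≫ k' = H.obj a ◁ k ≫ μ H a t ≫ H.map p) :
    (swap (H.obj a) (H.obj b) t' ≫ H.obj b ◁ P) ≫ (H.obj b ◁ k' ≫ μ H b l) =
      H.obj a ◁ (H.obj b ◁ k ≫ μ H b t) ≫ μ H a (b ⊗ t) ≫ H.map (swap a b t ≫ b ◁ p) := by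
  have h' := congrArg (fun f => H.obj b ◁ f) h
  have hs := swap_naturality (𝟙 (H.obj a)) (𝟙 (H.obj b)) k
  simp only [id_tensorHom] at hs
  simp only [whiskerLeft_comp] at h'
  rw [H.map_comp, whiskerLeft_comp, Category.assoc, Category.assoc, reassoc_of% map_swap H a b t,
    ← μ_natural_right, reassoc_of% hs, reassoc_of% h']

theorem arrange_listMu_step {a t s l : C} {t' s' l' : C'} (q : t' ⟶ s') (P : H.obj a ⊗ s' ⟶ l')
    (k : t' ⟶ H.obj t) (k' : s' ⟶ H.obj s) (k'' : l' ⟶ H.obj l) (p : a ⊗ s ⟶ l) (r : t ⟶ s)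
    (h : q ≫ k' = k ≫ H.map r) (h' : P ≫ k'' = H.obj a ◁ k' ≫ μ H a s ≫ H.map p) :
    (H.obj a ◁ q ≫ P) ≫ k'' = (H.obj a ◁ k ≫ μ H a t) ≫ H.map (a ◁ r ≫ p) := by
  have h2 := congrArg (fun f => H.obj a ◁ f) h
  simp only [whiskerLeft_comp] at h2
  rw [Category.assoc, h', reassoc_of% h2, H.map_comp, μ_natural_right_assoc, Category.assoc]

theorem tensMap_listMu_step {a b t s : C} {t' s' : C'} (f : a ⟶ b) (q : t' ⟶ s')
    (k : t' ⟶ H.obj t) (k' : s' ⟶ H.obj s) (r : t ⟶ s) (h : q ≫ k' = k ≫ H.map r) :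
    (H.map f ⊗ₘ q) ≫ (H.obj b ◁ k' ≫ μ H b s) = (H.obj a ◁ k ≫ μ H a t) ≫ H.map (f ⊗ₘ r) := by
  rw [Category.assoc, ← μ_natural, ← id_tensorHom, ← id_tensorHom, tensorHom_comp_tensorHom_assoc,
    tensorHom_comp_tensorHom_assoc, h, Category.comp_id, Category.id_comp]

theorem append_listMu_step {a t m tm : C} {t' m' tm' : C'} (q : t' ⊗ m' ⟶ tm')
    (k : t' ⟶ H.obj t) (j : m' ⟶ H.obj m) (k' : tm' ⟶ H.obj tm) (p : t ⊗ m ⟶ tm)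
    (h : q ≫ k' = (k ⊗ₘ j) ≫ μ H t m ≫ H.map p) :
    ((α_ (H.obj a) t' m').hom ≫ H.obj a ◁ q) ≫ (H.obj a ◁ k' ≫ μ H a tm) =
      ((H.obj a ◁ k ≫ μ H a t) ⊗ₘ j) ≫ μ H (a ⊗ t) m ≫ H.map ((α_ a t m).hom ≫ a ◁ p) := by
  have h2 := congrArg (fun f => H.obj a ◁ f) h
  simp only [whiskerLeft_comp] at h2
  have h3 : (H.obj a ◁ k ≫ μ H a t) ⊗ₘ j = ((𝟙 _ ⊗ₘ k) ⊗ₘ j) ≫ μ H a t ▷ _ := by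
    rw [← tensorHom_id, tensorHom_comp_tensorHom, Category.comp_id, id_tensorHom]
  simp only [h3, Category.assoc, H.map_comp]
  rw [reassoc_of% Functor.LaxMonoidal.associativity H a t m,
    associator_naturality_assoc, id_tensorHom, reassoc_of% h2, ← μ_natural_right]

/-- The comparison of a tensor product of images with the image of a tensor product. -/
def listMu (X : ι → C) : ∀ l : List ι, tens (fun i => H.obj (X i)) l ⟶ H.obj (tens X l)
  | [] => ε H
  | a :: t => H.obj (X a) ◁ listMu X t ≫ μ H (X a) (tens X t)

theorem put_listMu (X : ι → C) {a : ι} : ∀ {t l : List ι} (i : Ins a t l),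
    put (fun i => H.obj (X i)) i ≫ listMu H X l =
      H.obj (X a) ◁ listMu H X t ≫ μ H (X a) (tens X t) ≫ H.map (put X i)
  | _, _, .here t => by
    refine (Category.id_comp _).trans ?_
    have : H.map (put X (.here t : Ins a t _)) = 𝟙 _ := H.map_id _
    rw [this]
    exact congrArg (_ ≫ ·) (Category.comp_id _).symm
  | _, _, .there b i => put_listMu_step H _ _ _ _ (put_listMu X i)

theorem arrange_listMu (X : ι → C) : ∀ {l l' : List ι} (p : Arr l l'),
    arrange (fun i => H.obj (X i)) p ≫ listMu H X l' = listMu H X l ≫ H.map (arrange X p)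
  | _, _, .nil => by
    have : H.map (arrange X (.nil : Arr [] [])) = 𝟙 _ := H.map_id _
    rw [this]
    exact (Category.id_comp _).trans (Category.comp_id _).symm
  | _, _, .cons p i => arrange_listMu_step H _ _ _ _ _ _ _ (arrange_listMu X p) (put_listMu H X i)

theorem tensMap_listMu {X Y : ι → C} (f : ∀ i, X i ⟶ Y i) : ∀ l : List ι,
    tensMap (fun i => H.map (f i)) l ≫ listMu H Y l = listMu H X l ≫ H.map (tensMap f l)
  | [] => by
    have : H.map (tensMap f []) = 𝟙 _ := H.map_id _
    rw [this]
    exact (Category.id_comp _).trans (Category.comp_id _).symm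
  | a :: t => tensMap_listMu_step H _ _ _ _ _ (tensMap_listMu f t)

theorem relabel_listMu (φ : ι → κ) (X : κ → C) : ∀ l : List ι,
    relabel φ (fun i => H.obj (X i)) l ≫ listMu H X (l.map φ) =
      listMu H (fun i => X (φ i)) l ≫ H.map (relabel φ X l)
  | [] => by
    have : H.map (relabel φ X []) = 𝟙 _ := H.map_id _
    rw [this]
    exact (Category.id_comp _).trans (Category.comp_id _).symm
  | a :: t => by
    have := tensMap_listMu_step H (𝟙 (X (φ a))) _ _ _ _ (relabel_listMu φ X t)
    rw [H.map_id, id_tensorHom, id_tensorHom] at this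
    exact this

theorem append_listMu (X : ι → C) : ∀ l l' : List ι,
    append (fun i => H.obj (X i)) l l' ≫ listMu H X (l ++ l') =
      (listMu H X l ⊗ₘ listMu H X l') ≫ μ H (tens X l) (tens X l') ≫ H.map (append X l l')
  | [], l' => by
    change (λ_ (tens (fun i => H.obj (X i)) l')).hom ≫ listMu H X l' =
      (ε H ⊗ₘ listMu H X l') ≫ μ H (𝟙_ C) (tens X l') ≫ H.map (λ_ (tens X l')).hom
    rw [← leftUnitor_naturality, Functor.LaxMonoidal.left_unitality,
      MonoidalCategory.tensorHom_def', Category.assoc]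
  | a :: t, l' => append_listMu_step H _ _ _ _ _ (append_listMu X t l')

end

theorem isIso_listMu (H : C ⥤ C') [H.Braided] (X : ι → C) : ∀ l : List ι, IsIso (listMu H X l)
  | [] => inferInstanceAs (IsIso (ε H))
  | a :: t => by
    have := isIso_listMu H X t
    exact inferInstanceAs (IsIso (H.obj (X a) ◁ listMu H X t ≫ μ H (X a) (tens X t)))

theorem listMu_nat_step {H H' : C ⥤ C'} [H.LaxBraided] [H'.LaxBraided] (τ : H ⟶ H')
    [NatTrans.IsMonoidal τ] {a t : C} {s s' : C'} (q : s ⟶ s') (k : s ⟶ H.obj t)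
    (k' : s' ⟶ H'.obj t) (h : q ≫ k' = k ≫ τ.app t) :
    (τ.app a ⊗ₘ q) ≫ (H'.obj a ◁ k' ≫ μ H' a t) = (H.obj a ◁ k ≫ μ H a t) ≫ τ.app (a ⊗ t) := by
  rw [Category.assoc, NatTrans.IsMonoidal.tensor, ← id_tensorHom, ← id_tensorHom,
    tensorHom_comp_tensorHom_assoc, tensorHom_comp_tensorHom_assoc, h, Category.comp_id,
    Category.id_comp]

theorem listMu_nat {H H' : C ⥤ C'} [H.LaxBraided] [H'.LaxBraided] (τ : H ⟶ H')
    [NatTrans.IsMonoidal τ] (X : ι → C) : ∀ l : List ι,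
    tensMap (fun i => τ.app (X i)) l ≫ listMu H' X l = listMu H X l ≫ τ.app (tens X l)
  | [] => (Category.id_comp _).trans NatTrans.IsMonoidal.unit.symm
  | _ :: t => listMu_nat_step τ _ _ _ (listMu_nat τ X t)

end ListMu

/-! ### Comparison of `𝒦(H(A))` with `H(𝒦(A))`. -/

section KComp

open Functor.LaxMonoidal

variable {C : Type u} [Category.{v} C] [MonoidalCategory C] [SymmetricCategory C]
  {C' : Type u'} [Category.{v'} C'] [MonoidalCategory C'] [SymmetricCategory C']

theorem kmap_listMu (A : Fin n ⥤ C) (H : C ⥤ C') [H.LaxBraided] {S T : U n} (u : U.Fn S T)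
    (l : List S.carrier) : kmap (A ⋙ H) u l ≫ listMu H (factor A T) (l.map u.toFun) =
      listMu H (factor A S) l ≫ H.map (kmap A u l) := by
  have h1 := relabel_listMu H u.toFun (factor A T) l
  have h2 := tensMap_listMu H (Y := fun s => factor A T (u.toFun s))
    (fun s => A.map (homOfLE (u.weight_le s))) l
  rw [kmap, kmap, H.map_comp, Category.assoc]
  refine (congrArg (_ ≫ ·) h1).trans ?_
  refine (Category.assoc _ _ _).symm.trans ((congrArg (· ≫ _) h2).trans (Category.assoc _ _ _))

theorem merge_listMu {ι : Type} (H : C ⥤ C') [H.LaxBraided] (A : ι → C) {X Y : C'} {l m : List ι}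
    (f : X ⟶ tens (fun i => H.obj (A i)) l) (g : Y ⟶ tens (fun i => H.obj (A i)) m) :
    merge f g ≫ listMu H A (l ++ m) = ((f ≫ listMu H A l) ⊗ₘ (g ≫ listMu H A m)) ≫
      μ H _ _ ≫ H.map (append A l m) := by
  rw [merge, Category.assoc, append_listMu, tensorHom_comp_tensorHom_assoc]

/-- The comparison `𝒦(H(A)) ⟶ H(𝒦(A))`. -/
noncomputable def kComp (A : Fin n ⥤ C) (H : C ⥤ C') [H.LaxBraided] :
    kObj (A ⋙ H) ⟶ kObj A ⋙ H where
  app S := listMu H (factor A S) (order S)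
  naturality S T φ := by
    have h1 := kmap_listMu A H (U.fn φ) (order S)
    have h2 := arrange_listMu H (factor A T) (orderArr φ)
    refine (congrArg (· ≫ _) (kObj_map (A ⋙ H) φ)).trans (Eq.trans ?_
      (congrArg (fun k => listMu H (factor A S) (order S) ≫ H.map k) (kObj_map A φ)).symm)
    refine Eq.trans ?_ (congrArg (listMu H (factor A S) (order S) ≫ ·)
      (H.map_comp (kmap A (U.fn φ) (order S)) (arrange (factor A T) (orderArr φ)))).symm
    refine (Category.assoc _ _ _).trans ((congrArg (_ ≫ ·) h2).trans ?_)
    exact (Category.assoc _ _ _).symm.trans ((congrArg (· ≫ _) h1).trans (Category.assoc _ _ _))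

instance (A : Fin n ⥤ C) (H : C ⥤ C') [H.Braided] : IsIso (kComp A H) := by
  have : ∀ S, IsIso ((kComp A H).app S) := fun S => isIso_listMu H (factor A S) (order S)
  exact NatIso.isIso_of_isIso_app _

instance kComp_isMonoidal (A : Fin n ⥤ C) (H : C ⥤ C') [H.LaxBraided] :
    NatTrans.IsMonoidal (kComp A H) where
  unit := by
    refine (Category.assoc _ _ _).trans ((Category.id_comp _).trans
      ((arrange_listMu H (factor A (𝟙_ (U n))) _).trans ?_))
    exact congrArg (fun k => ε H ≫ H.map k) (Category.id_comp _).symm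
  tensor S T := by
    refine (Category.assoc _ _ _).trans ((congrArg (_ ≫ ·)
      (arrange_listMu H (factor A (S ⊗ T)) _)).trans ((Category.assoc _ _ _).symm.trans ?_))
    refine (congrArg (· ≫ _) (merge_listMu H (factor A (S ⊗ T)) _ _)).trans ?_
    refine (congrArg (fun k => (k ≫ _) ≫ _) (congrArg₂ (· ⊗ₘ ·) (kmap_listMu A H (U.inl S T) _)
      (kmap_listMu A H (U.inr S T) _))).trans ?_
    refine Eq.trans ?_ (congrArg (fun k => (_ ⊗ₘ _) ≫ μ H _ _ ≫ k) (H.map_comp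
      (merge (kmap A (U.inl S T) _) (kmap A (U.inr S T) _)) (arrange _ _))).symm
    refine Eq.trans ?_ (congrArg (fun k => (_ ⊗ₘ _) ≫ μ H _ _ ≫ k ≫ _) (H.map_comp _ _)).symm
    rw [← tensorHom_comp_tensorHom, Category.assoc, Category.assoc, Category.assoc,
      μ_natural_assoc]
    exact congrArg (fun k => (_ ⊗ₘ _) ≫ μ H _ _ ≫ k) (Category.assoc _ _ _).symm

end KComp

/-! ### The values of `𝒦(A)` at points. -/

section KPoint

variable {C : Type u} [Category.{v} C] [MonoidalCategory C] [SymmetricCategory C]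

theorem order_point (i : Fin n) : (order ((point n).obj i)).Perm [()] :=
  (List.perm_ext_iff_of_nodup (order_nodup _) (List.nodup_singleton _)).2 fun x =>
    iff_of_true (mem_order _ x) (List.mem_singleton.2 rfl)

/-- The identification of `𝒦(e_i)` with a tensor product with one factor. -/
noncomputable def kPointArr (A : Fin n ⥤ C) (i : Fin n) :
    (kObj A).obj ((point n).obj i) ⟶ tens (factor A ((point n).obj i)) [()] :=
  arrange _ (Arr.exists (order_point i)).some

theorem kmap_rightUnitor (A : Fin n ⥤ C) {i j : Fin n} (f : i ⟶ j) :
    kmap A (U.fn ((point n).map f)) [()] ≫ (ρ_ (A.obj j)).hom = (ρ_ (A.obj i)).hom ≫ A.map f := by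
  change ((A.map f ⊗ₘ 𝟙 (𝟙_ C)) ≫ A.obj j ◁ 𝟙 (𝟙_ C)) ≫ (ρ_ (A.obj j)).hom = _
  rw [MonoidalCategory.whiskerLeft_id, Category.comp_id, tensorHom_id, rightUnitor_naturality]

/-- The isomorphism `𝒦(A)(e_i) ≅ A_i`. -/
noncomputable def kPoint (A : Fin n ⥤ C) : point n ⋙ kObj A ⟶ A where
  app i := kPointArr A i ≫ (ρ_ (A.obj i)).hom
  naturality i j f := by
    have h : (kObj A).map ((point n).map f) ≫ kPointArr A j =
        kPointArr A i ≫ kmap A (U.fn ((point n).map f)) [()] := by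
      -- A list with one element has no repetitions, so the comparison may be made up to
      -- rearrangement.
      refine Sim.eq (A := factor A ((point n).obj j)) ?_ (List.nodup_singleton _)
      refine (Sim.arrange ((kObj A).map ((point n).map f)) _).symm.trans ?_
      refine (sim_map (A := A) ((point n).map f)).symm.trans ?_
      refine Sim.trans (.of_eq (Category.id_comp _).symm) ?_
      refine Sim.kmap _ ?_
      exact ⟨(Arr.exists (order_point i)).some, Category.id_comp _⟩
    refine (Category.assoc _ _ _).symm.trans ((congrArg (· ≫ _) h).trans ?_)
    refine (Category.assoc _ _ _).trans ((congrArg (_ ≫ ·) (kmap_rightUnitor A f)).trans ?_)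
    exact (Category.assoc _ _ _).symm

instance (A : Fin n ⥤ C) : IsIso (kPoint A) := by
  have : ∀ i, IsIso ((kPoint A).app i) := fun i => IsIso.comp_isIso' (isIso_arrange _ _)
    (inferInstanceAs (IsIso (ρ_ (A.obj i)).hom))
  exact NatIso.isIso_of_isIso_app _

theorem kPoint_naturality {A B : Fin n ⥤ C} (f : A ⟶ B) (i : Fin n) :
    ((kFunctor n C).map f).app ((point n).obj i) ≫ (kPoint B).app i =
      (kPoint A).app i ≫ f.app i := by
  have h := arrange_naturality (fun s => f.app (((point n).obj i).weight s))
    (Arr.exists (order_point i)).some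
  refine (Category.assoc _ _ _).symm.trans ((congrArg (· ≫ _) h.symm).trans ?_)
  refine (Category.assoc _ _ _).trans (Eq.trans (congrArg (_ ≫ ·) ?_) (Category.assoc _ _ _).symm)
  change (f.app i ⊗ₘ 𝟙 (𝟙_ C)) ≫ (ρ_ (B.obj i)).hom = (ρ_ (A.obj i)).hom ≫ f.app i
  rw [tensorHom_id, rightUnitor_naturality]

end KPoint

/-! ### Recovering a tensor functor on `U n` from its values at points. -/

section KUniv

/-- The elements of a tensor product of one-point sets. -/
def elt (S : U n) : ∀ l : List S.carrier, (tens (factor (point n) S) l).carrier → S.carrier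
  | [] => Empty.elim
  | a :: t => Sum.elim (fun _ => a) (elt S t)

theorem weight_elt (S : U n) : ∀ (l : List S.carrier) (x : (tens (factor (point n) S) l).carrier),
    S.weight (elt S l x) = (tens (factor (point n) S) l).weight x
  | [], x => Empty.elim x
  | _ :: _, Sum.inl _ => rfl
  | _ :: t, Sum.inr x => weight_elt S t x

theorem elt_mem (S : U n) : ∀ (l : List S.carrier) (x : (tens (factor (point n) S) l).carrier),
    elt S l x ∈ l
  | [], x => Empty.elim x
  | _ :: _, Sum.inl _ => List.mem_cons_self
  | _ :: t, Sum.inr x => List.mem_cons_of_mem _ (elt_mem S t x)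

theorem elt_injective (S : U n) : ∀ (l : List S.carrier), l.Nodup → Function.Injective (elt S l)
  | [], _ => fun x => Empty.elim x
  | a :: t, h => by
    rw [List.nodup_cons] at h
    rintro (x | x) (y | y) hxy
    · rfl
    · exact (h.1 ((show a = elt S t y from hxy) ▸ elt_mem S t y)).elim
    · exact (h.1 ((show elt S t x = a from hxy) ▸ elt_mem S t x)).elim
    · exact congrArg Sum.inr (elt_injective S t h.2 hxy)

theorem elt_surjective (S : U n) : ∀ (l : List S.carrier) {s : S.carrier}, s ∈ l →
    ∃ x, elt S l x = s
  | a :: t, s, h => by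
    obtain rfl | h := List.mem_cons.1 h
    · exact ⟨Sum.inl (), rfl⟩
    · obtain ⟨x, hx⟩ := elt_surjective S t h
      exact ⟨Sum.inr x, hx⟩

/-- Rearranging factors in `U n` does not change which element of `S` a point names. As `elt` is
injective on lists without repetitions, it lets naturality and monoidality of `kUniv` be checked on
elements. -/
theorem elt_put (S : U n) {a : S.carrier} : ∀ {t l : List S.carrier} (i : Ins a t l)
    (x : (tens (factor (point n) S) (a :: t)).carrier),
    elt S l ((put (factor (point n) S) i).equiv x) = elt S (a :: t) x
  | _, _, .here _, _ => rfl
  | _, _, .there _ i, Sum.inl x => elt_put S i (Sum.inl x)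
  | _, _, .there _ _, Sum.inr (Sum.inl _) => rfl
  | _, _, .there _ i, Sum.inr (Sum.inr x) => elt_put S i (Sum.inr x)

theorem elt_arrange (S : U n) : ∀ {l l' : List S.carrier} (p : Arr l l')
    (x : (tens (factor (point n) S) l).carrier),
    elt S l' ((arrange (factor (point n) S) p).equiv x) = elt S l x
  | _, _, .nil, _ => rfl
  | _, _, .cons _ i, Sum.inl x => elt_put S i (Sum.inl x)
  | _, _, .cons p i, Sum.inr x => (elt_put S i (Sum.inr _)).trans (elt_arrange S p x)

theorem elt_kmap {S T : U n} (u : U.Fn S T) : ∀ (l : List S.carrier)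
    (x : (tens (factor (point n) S) l).carrier),
    elt T (l.map u.toFun) ((kmap (point n) u l).equiv x) = u.toFun (elt S l x)
  | [], x => Empty.elim x
  | _ :: _, Sum.inl _ => rfl
  | _ :: t, Sum.inr x => elt_kmap u t x

theorem elt_append_inl (S : U n) : ∀ (l l' : List S.carrier)
    (x : (tens (factor (point n) S) l).carrier),
    elt S (l ++ l') ((append (factor (point n) S) l l').equiv (Sum.inl x)) = elt S l x
  | [], _, x => Empty.elim x
  | _ :: _, _, Sum.inl _ => rfl
  | _ :: t, l', Sum.inr x => elt_append_inl S t l' x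

theorem elt_append_inr (S : U n) : ∀ (l l' : List S.carrier)
    (x : (tens (factor (point n) S) l').carrier),
    elt S (l ++ l') ((append (factor (point n) S) l l').equiv (Sum.inr x)) = elt S l' x
  | [], _, _ => rfl
  | _ :: t, l', x => elt_append_inr S t l' x

/-- A weighted set is the union of its points. -/
noncomputable def kUnivIso (S : U n) : (kObj (point n)).obj S ≅ S :=
  U.mkIso (Equiv.ofBijective (elt S (order S)) ⟨elt_injective S _ (order_nodup S),
    fun s => elt_surjective S _ (mem_order S s)⟩) (weight_elt S (order S))

variable (n) in
/-- A weighted set is the union of its points, naturally. -/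
noncomputable def kUniv : kObj (point n) ≅ 𝟭 (U n) :=
  NatIso.ofComponents kUnivIso fun {S T} φ => by
    refine U.hom_ext fun x => ?_
    refine (congrArg (fun k => elt T (order T) (k.equiv x)) (kObj_map (point n) φ)).trans ?_
    exact (elt_arrange T (orderArr φ) _).trans (elt_kmap (U.fn φ) (order S) x)

instance kUniv_isMonoidal : NatTrans.IsMonoidal (kUniv n).hom where
  unit := U.hom_ext fun x => Empty.elim x
  tensor S T := U.hom_ext (by
    rintro (x | x)
    · exact (elt_arrange (S ⊗ T) _ _).trans ((elt_append_inl (S ⊗ T) _ _ _).trans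
        (elt_kmap (U.inl S T) (order S) x))
    · exact (elt_arrange (S ⊗ T) _ _).trans ((elt_append_inr (S ⊗ T) _ _ _).trans
        (elt_kmap (U.inr S T) (order T) x)))

variable {C : Type u} [Category.{v} C] [MonoidalCategory C] [SymmetricCategory C]

/-- A tensor functor on weighted sets is determined by its values on points. -/
noncomputable def kCounit (H : U n ⥤ C) [H.LaxBraided] : kObj (point n ⋙ H) ⟶ 𝟭 (U n) ⋙ H :=
  kComp (point n) H ≫ Functor.whiskerRight (kUniv n).hom H

instance (H : U n ⥤ C) [H.Braided] : IsIso (kCounit H) := by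
  rw [kCounit]
  infer_instance

instance (H : U n ⥤ C) [H.Braided] : NatTrans.IsMonoidal (kCounit H) := by
  rw [kCounit]
  infer_instance

theorem kCounit_naturality {H H' : U n ⥤ C} [H.LaxBraided] [H'.LaxBraided] (τ : H ⟶ H')
    [NatTrans.IsMonoidal τ] (S : U n) :
    ((kFunctor n C).map (Functor.whiskerLeft (point n) τ)).app S ≫ (kCounit H').app S =
      (kCounit H).app S ≫ τ.app S := by
  have h := listMu_nat τ (factor (point n) S) (order S)
  refine (Category.assoc _ _ _).symm.trans ((congrArg (· ≫ _) h).trans ?_)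
  refine (Category.assoc _ _ _).trans (Eq.trans (congrArg (_ ≫ ·) ?_) (Category.assoc _ _ _).symm)
  exact (τ.naturality _).symm

end KUniv

/-! ### Functoriality in `K`, and the value of `N ↦ N ⊙ K` at principal injectives. -/

section Evaluation

variable {C : Type u} [Category.{v} C] [Abelian C] [Linear ℂ C]

theorem odotMap_id (K : U n ⥤ C) : odotMap (𝟙 K) = 𝟙 (odot K) :=
  NatTrans.ext (funext fun N => odot_hom_ext fun S φ => by
    rw [odotMap_ev, NatTrans.id_app, NatTrans.id_app, Category.comp_id, Category.id_comp])

theorem odotMap_comp {K K' K'' : U n ⥤ C} (k : K ⟶ K') (k' : K' ⟶ K'') :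
    odotMap (k ≫ k') = odotMap k ≫ odotMap k' :=
  NatTrans.ext (funext fun N => odot_hom_ext fun S φ => by
    rw [odotMap_ev, NatTrans.comp_app, NatTrans.comp_app, Category.assoc, odotMap_ev,
      odotMap_ev_assoc])

theorem ToStructuredHom.IsUniversal.isIso {Q : U n ⥤ Vect} {K K' : U n ⥤ C} {P P' : C}
    {t : ToStructuredHom P Q K} {t' : ToStructuredHom P' Q K'} (ht : t.IsUniversal)
    (ht' : t'.IsUniversal) (k : K ⟶ K') [IsIso k] (f : P ⟶ P')
    (hf : ∀ S m, f ≫ t'.app S m = t.app S m ≫ k.app S) : IsIso f := by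
  have h : ∀ S m, ht.lift (t'.postcomp (inv k)) ≫ t.app S m = t'.app S m ≫ (inv k).app S :=
    fun S m => ht.lift_app _ S m
  refine ⟨ht.lift (t'.postcomp (inv k)), ht.hom_ext fun S m => ?_, ht'.hom_ext fun S m => ?_⟩
  · rw [Category.assoc, h, reassoc_of% (hf S m), NatIso.isIso_inv_app, IsIso.hom_inv_id,
      Category.comp_id, Category.id_comp]
  · rw [Category.assoc, hf, reassoc_of% (h S m), NatIso.isIso_inv_app, IsIso.inv_hom_id,
      Category.comp_id, Category.id_comp]

/-- The evaluation `J_A ⊙ K ⟶ K(A)`. -/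
noncomputable def odotInj (K : U n ⥤ C) : principalInjective n ⋙ odot K ⟶ K where
  app A := (odotEv K ((principalInjective n).obj A)).app A (injElt A)
  naturality A B f := by
    refine (odot_map_ev K ((principalInjective n).map f) B (injElt B)).trans ?_
    rw [dualMap_injMap, (odotEv K _).naturality]

/-- The dual of `J_A` is free on `injElt A`, so families on it are morphisms to `K(A)`; the inverse
is the lift of the family whose value there is the identity. -/
instance (K : U n ⥤ C) : IsIso (odotInj K) := by
  have h : ∀ A, IsIso ((odotInj K).app A) := fun A => by
    have hl := (odotEv_isUniversal K _).lift_app ((isFree_inj A).family (𝟙 (K.obj A))) A (injElt A)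
    replace hl := hl.trans ((isFree_inj A).family_app (𝟙 (K.obj A)))
    refine ⟨_, ?_, hl⟩
    have key : (odotEv K ((principalInjective n).obj A)).precomp ((odotInj K).app A ≫
        (odotEv_isUniversal K _).lift ((isFree_inj A).family (𝟙 (K.obj A)))) =
        (odotEv K ((principalInjective n).obj A)).precomp (𝟙 _) := by
      refine (isFree_inj A).hom_ext ?_
      refine (Category.assoc _ _ _).trans ((congrArg (_ ≫ ·) hl).trans ?_)
      exact (Category.comp_id _).trans (Category.id_comp _).symm
    exact odot_hom_ext fun S φ =>
      LinearMap.congr_fun (congrFun (congrArg ToStructuredHom.app key) S) φ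
  exact NatIso.isIso_of_isIso_app _

theorem odotInj_naturality {K K' : U n ⥤ C} (k : K ⟶ K') (A : U n) :
    (odotMap k).app ((principalInjective n).obj A) ≫ (odotInj K').app A =
      (odotInj K).app A ≫ k.app A :=
  odotMap_ev k _ A (injElt A)

end Evaluation

/-! ### The two functors and the equivalence. -/

section Equivalence

open Functor.LaxMonoidal

variable {C : Type u} [Category.{v} C] [Abelian C] [Linear ℂ C] [MonoidalCategory C]
  [SymmetricCategory C] [MonoidalPreadditive C] [MonoidalLinear ℂ C]

section Psi

variable [∀ X : C, PreservesFiniteLimits (tensorLeft X)]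

/-- The map `𝒦(A) ⟶ 𝒦(B)` induced by a map of chains. -/
noncomputable def kMap {A B : Fin n ⥤ C} (f : A ⟶ B) : kObj A ⟶ kObj B := (kFunctor n C).map f

variable (n C) in
/-- The functor sending a chain `A` to the left-exact tensor functor `N ↦ N ⊙ 𝒦(A)`. -/
noncomputable def ofChain : (Fin n ⥤ C) ⥤ LExTensorFunctor n C where
  obj A := { functor := odot (kObj A) }
  map f :=
    { natTrans := odotMap (kMap f)
      isMonoidal := by
        apply +allowSynthFailures odotMap_isMonoidal
        exact kFunctor_map_isMonoidal f }
  map_id A := LExTensorFunctor.Hom.ext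
    ((congrArg odotMap ((kFunctor n C).map_id A)).trans (odotMap_id _))
  map_comp f g := LExTensorFunctor.Hom.ext
    ((congrArg odotMap ((kFunctor n C).map_comp f g)).trans (odotMap_comp _ _))

/-- The structured tensor products `N ⊙ 𝒦(A)` are computed by `ofChain`. -/
noncomputable def ofChainIsStructuredTensor :
    IsStructuredTensor (kFunctor n C) (ofChain n C ⋙ LExTensorFunctor.forget n C) where
  homEquiv A N _ :=
    { toFun := fun g => (odotEv (kObj A) N).precomp g
      invFun := (odotEv_isUniversal (kObj A) N).lift
      left_inv := fun _ => odot_hom_ext fun _ _ => (odotEv_isUniversal (kObj A) N).lift_app _ _ _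
      right_inv := (odotEv_isUniversal (kObj A) N).precomp_lift }
  homEquiv_precomp _ _ _ _ _ _ := ToStructuredHom.ext (funext fun _ => LinearMap.ext fun _ =>
    Category.assoc _ _ _)
  homEquiv_map A _ _ h _ g := ToStructuredHom.ext (funext fun S => LinearMap.ext fun φ =>
    (Category.assoc _ _ _).trans (congrArg (g ≫ ·) (odot_map_ev (kObj A) h S φ)))
  homEquiv_app k N _ g := ToStructuredHom.ext (funext fun S => LinearMap.ext fun φ =>
    (Category.assoc _ _ _).trans ((congrArg (g ≫ ·)
      (odotMap_ev ((kFunctor n C).map k) N S φ)).trans (Category.assoc _ _ _).symm))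

variable (n C) in
/-- The chain of a functor `N ↦ N ⊙ 𝒦(A)` is `A`. -/
noncomputable def ofChainEval : ofChain n C ⋙ evalInjectives n C ⟶ 𝟭 (Fin n ⥤ C) where
  app A := Functor.whiskerLeft (point n) (odotInj (kObj A)) ≫ kPoint A
  naturality A B f := by
    refine NatTrans.ext (funext fun i => ?_)
    refine (Category.assoc _ _ _).symm.trans ((congrArg (· ≫ (kPoint B).app i)
      (odotInj_naturality ((kFunctor n C).map f) ((point n).obj i))).trans ?_)
    refine (Category.assoc _ _ _).trans ((congrArg (_ ≫ ·) (kPoint_naturality f i)).trans ?_)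
    exact (Category.assoc _ _ _).symm

instance : IsIso (ofChainEval n C) := by
  have h : ∀ A, IsIso ((ofChainEval n C).app A) := fun A =>
    inferInstanceAs (IsIso (Functor.whiskerLeft (point n) (odotInj (kObj A)) ≫ kPoint A))
  exact NatIso.isIso_of_isIso_app _

end Psi

/-! ### A left-exact tensor functor is recovered from its chain. -/

section Counit

variable (F : LExTensorFunctor n C)

/-- The restriction of `F` to the principal injectives. -/
noncomputable def LExTensorFunctor.onInj : U n ⥤ C := principalInjective n ⋙ F.functor

noncomputable instance : F.onInj.Braided :=
  inferInstanceAs (principalInjective n ⋙ F.functor).Braided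

theorem onInj_ε : ε F.onInj = ε F.functor ≫ F.functor.map (toInj (dualUnit n)) := rfl

theorem onInj_μ (A B : U n) : μ F.onInj A B = μ F.functor _ _ ≫ F.functor.map (injMu A B) := rfl

/-- The values of `F` on principal injectives are determined by its chain. -/
noncomputable def chainCounit : kObj ((evalInjectives n C).obj F) ⟶ F.onInj :=
  kCounit F.onInj ≫ F.onInj.leftUnitor.hom

theorem isIso_chainCounit : IsIso (C := U n ⥤ C) (Y := principalInjective n ⋙ F.functor)
    (chainCounit F) :=
  inferInstanceAs (IsIso (kCounit F.onInj ≫ F.onInj.leftUnitor.hom))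

instance : NatTrans.IsMonoidal (chainCounit F) :=
  inferInstanceAs (NatTrans.IsMonoidal (kCounit F.onInj ≫ F.onInj.leftUnitor.hom))

theorem chainCounit_naturality {F G : LExTensorFunctor n C} (α : F ⟶ G) (S : U n) :
    ((kFunctor n C).map ((evalInjectives n C).map α)).app S ≫ (chainCounit G).app S =
      (chainCounit F).app S ≫ α.natTrans.app ((principalInjective n).obj S) := by
  have : NatTrans.IsMonoidal (F₁ := F.onInj) (F₂ := G.onInj)
      (Functor.whiskerLeft (principalInjective n) α.natTrans) :=
    NatTrans.IsMonoidal.whiskerLeft α.natTrans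
  have h := kCounit_naturality (H := F.onInj) (H' := G.onInj)
    (Functor.whiskerLeft (principalInjective n) α.natTrans) S
  refine (congrArg (_ ≫ ·) (Category.comp_id _)).trans (h.trans ?_)
  exact congrArg (· ≫ _) (Category.comp_id _).symm

/-- Since `N` is the structured tensor product of `N` with `J`, left exactness and linearity of `F`
make `F(N)` that of `N` with `F ∘ J`. -/
theorem mapFunctor_injFamily_isUniversal (N : ModD n) :
    ((injFamily N).mapFunctor F.functor).IsUniversal :=
  (injFamily_isUniversal N).map (presentation N) F.functor

variable {F} in
theorem LExTensorFunctor.hom_ext {N : ModD n} {X : C} {f g : X ⟶ F.functor.obj N}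
    (h : ∀ (S : U n) (φ : (dual N).obj S),
      f ≫ F.functor.map (toInj φ) = g ≫ F.functor.map (toInj φ)) : f = g :=
  (mapFunctor_injFamily_isUniversal F N).hom_ext h

variable {F} in
theorem LExTensorFunctor.tensor_hom_ext {M N : ModD n} {X : C} {f g : X ⟶ F.functor.obj (M ⊗ N)}
    (h : ∀ (S T : U n) (φ : (dual M).obj S) (ψ : (dual N).obj T),
      f ≫ F.functor.map (toInj (dualPair M N S T φ ψ)) =
        g ≫ F.functor.map (toInj (dualPair M N S T φ ψ))) : f = g := by
  have key : ((injFamily (M ⊗ N)).mapFunctor F.functor).precomp f =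
      ((injFamily (M ⊗ N)).mapFunctor F.functor).precomp g :=
    ToStructuredHom.tensor_ext h
  exact LExTensorFunctor.hom_ext fun S φ =>
    LinearMap.congr_fun (congrFun (congrArg ToStructuredHom.app key) S) φ

variable {F} in
theorem LExTensorFunctor.unit_hom_ext {X : C} {f g : X ⟶ F.functor.obj (𝟙_ (ModD n))}
    (h : f ≫ F.functor.map (toInj (dualUnit n)) = g ≫ F.functor.map (toInj (dualUnit n))) :
    f = g := by
  have key : ((injFamily (𝟙_ (ModD n))).mapFunctor F.functor).precomp f =
      ((injFamily (𝟙_ (ModD n))).mapFunctor F.functor).precomp g :=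
    isFree_unit.hom_ext h
  exact LExTensorFunctor.hom_ext fun S φ =>
    LinearMap.congr_fun (congrFun (congrArg ToStructuredHom.app key) S) φ

/-- A left-exact functor is computed by structured tensor products with its restriction to
the principal injectives. -/
noncomputable def fromOdotApp (N : ModD n) :
    (odot (kObj ((evalInjectives n C).obj F))).obj N ⟶ F.functor.obj N :=
  (mapFunctor_injFamily_isUniversal F N).lift
    ((odotEv (kObj ((evalInjectives n C).obj F)) N).postcomp (chainCounit F))

theorem fromOdotApp_toInj {N : ModD n} (S : U n) (φ : (dual N).obj S) :
    fromOdotApp F N ≫ F.functor.map (toInj φ) =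
      (odotEv (kObj ((evalInjectives n C).obj F)) N).app S φ ≫ (chainCounit F).app S :=
  (mapFunctor_injFamily_isUniversal F N).lift_app _ S φ

/-- The comparison of `F` with the functor determined by its chain. -/
noncomputable def fromOdot : odot (kObj ((evalInjectives n C).obj F)) ⟶ F.functor where
  app N := fromOdotApp F N
  naturality N N' h := LExTensorFunctor.hom_ext fun S φ => by
    have h1 : h ≫ toInj φ = toInj (((dualMap h).app S).hom φ) :=
      toInj_hom_ext (by rw [dualMap_comp, dualMap_toInj, dualMap_toInj])
    have h2 := fromOdotApp_toInj F S (((dualMap h).app S).hom φ)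
    rw [← h1, F.functor.map_comp, ← odot_map_ev] at h2
    refine (Category.assoc _ _ _).trans ((congrArg (_ ≫ ·) (fromOdotApp_toInj F S φ)).trans ?_)
    exact (Category.assoc _ _ _).symm.trans (h2.symm.trans (Category.assoc _ _ _).symm)

/-- Source and target carry universal families on `N^∨`, with values in functors identified by
`chainCounit`. -/
instance isIso_fromOdot : IsIso (fromOdot F) := by
  have h : ∀ N, IsIso ((fromOdot F).app N) := fun N =>
    have := isIso_chainCounit F
    (odotEv_isUniversal _ N).isIso (mapFunctor_injFamily_isUniversal F N) (chainCounit F) _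
      fun S φ => fromOdotApp_toInj F S φ
  exact NatIso.isIso_of_isIso_app _

variable [∀ X : C, PreservesFiniteLimits (tensorLeft X)]

/-- Morphisms to `F(M ⊗ N)` are tested on pairings, and morphisms to `F(𝟙)` on `dualUnit`; there
both conditions become monoidality of `chainCounit`. -/
theorem fromOdot_isMonoidal : NatTrans.IsMonoidal (fromOdot F) where
  unit := LExTensorFunctor.unit_hom_ext (by
    have h := NatTrans.IsMonoidal.unit (τ := chainCounit F)
    rw [onInj_ε] at h
    rw [← h, Category.assoc]
    refine (congrArg (_ ≫ ·) (fromOdotApp_toInj F _ _)).trans ?_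
    exact odotEps_ev_assoc (kObj ((evalInjectives n C).obj F)) _)
  tensor M N := LExTensorFunctor.tensor_hom_ext fun S T φ ψ => by
    have h := NatTrans.IsMonoidal.tensor (τ := chainCounit F) S T
    rw [onInj_μ] at h
    -- Factoring the pairing through `toInj φ ⊗ₘ toInj ψ` lets it pass across the tensorator of `F`,
    -- so that `fromOdotApp_toInj` applies in each factor.
    rw [dualPair_toInj, F.functor.map_comp, Category.assoc, Category.assoc, ← μ_natural_assoc,
      tensorHom_comp_tensorHom_assoc]
    refine Eq.trans ?_ (congrArg (fun k => k ≫ _) (congrArg₂ (· ⊗ₘ ·)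
      (fromOdotApp_toInj F S φ) (fromOdotApp_toInj F T ψ))).symm
    rw [← F.functor.map_comp, ← dualPair_toInj]
    refine (congrArg (_ ≫ ·) (fromOdotApp_toInj F _ _)).trans ?_
    refine (odotMu_ev_assoc (kObj ((evalInjectives n C).obj F)) φ ψ _).trans ?_
    refine (congrArg (_ ≫ ·) h).trans ?_
    exact tensorHom_comp_tensorHom_assoc _ _ _ _ _

/-- An isomorphism of functors which is monoidal is an isomorphism of tensor functors. -/
theorem LExTensorFunctor.isIso_of_isIso_natTrans {F G : LExTensorFunctor n C} (α : F ⟶ G)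
    [IsIso α.natTrans] : IsIso α :=
  have : NatTrans.IsMonoidal (asIso α.natTrans).hom := α.isMonoidal
  ⟨{ natTrans := inv α.natTrans
     isMonoidal := inferInstanceAs (NatTrans.IsMonoidal (asIso α.natTrans).inv) },
    LExTensorFunctor.Hom.ext (IsIso.hom_inv_id α.natTrans),
    LExTensorFunctor.Hom.ext (IsIso.inv_hom_id α.natTrans)⟩

variable (n C) in
/-- A left-exact tensor functor is determined by its chain. -/
noncomputable def evalOfChain : evalInjectives n C ⋙ ofChain n C ⟶ 𝟭 (LExTensorFunctor n C) where
  app F := { natTrans := fromOdot F, isMonoidal := fromOdot_isMonoidal F }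
  naturality F G α := LExTensorFunctor.Hom.ext (NatTrans.ext (funext fun N =>
    LExTensorFunctor.hom_ext fun S φ => by
      have h1 := fromOdotApp_toInj G S φ
      have h2 := fromOdotApp_toInj F S φ
      have h3 := chainCounit_naturality α S
      refine (Category.assoc _ _ _).trans ((congrArg (_ ≫ ·) h1).trans ?_)
      refine (odotMap_ev_assoc (kMap ((evalInjectives n C).map α)) N S φ _).trans ?_
      refine (congrArg (_ ≫ ·) h3).trans ((Category.assoc _ _ _).symm.trans ?_)
      refine (congrArg (· ≫ _) h2.symm).trans ((Category.assoc _ _ _).trans ?_)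
      refine (congrArg (_ ≫ ·) (α.natTrans.naturality (toInj φ))).trans ?_
      exact (Category.assoc _ _ _).symm))

instance : IsIso (evalOfChain n C) := by
  have h : ∀ F, IsIso ((evalOfChain n C).app F) := fun F =>
    have : IsIso ((evalOfChain n C).app F).natTrans := isIso_fromOdot F
    LExTensorFunctor.isIso_of_isIso_natTrans _
  exact NatIso.isIso_of_isIso_app _

end Counit

end Equivalence

end WeightedSets

theorem mainTheorem5 (n : ℕ) (hn : 1 ≤ n) (C : Type u) [Category.{v} C] [Abelian C] [Linear ℂ C]
    [MonoidalCategory C] [SymmetricCategory C] [MonoidalPreadditive C] [MonoidalLinear ℂ C]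
    (hexact : ∀ X : C, PreservesFiniteLimits (tensorLeft X)) :
    ∃ Ψ : (Fin n ⥤ C) ⥤ WeightedSets.LExTensorFunctor n C,
      Nonempty (WeightedSets.IsStructuredTensor (WeightedSets.kFunctor n C)
        (Ψ ⋙ WeightedSets.LExTensorFunctor.forget n C)) ∧
      Nonempty (𝟭 _ ≅ Ψ ⋙ WeightedSets.evalInjectives n C) ∧
      Nonempty (WeightedSets.evalInjectives n C ⋙ Ψ ≅ 𝟭 _) :=
  ⟨WeightedSets.ofChain n C, ⟨WeightedSets.ofChainIsStructuredTensor⟩,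
    ⟨(asIso (WeightedSets.ofChainEval n C)).symm⟩, ⟨asIso (WeightedSets.evalOfChain n C)⟩⟩
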